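/- **Setting.** A concurrent program consists of finitely many finite-state processes whose transitions are labelled with instructions $\mathsf{rd}(x,d)$, $\mathsf{wr}(x,d)$, $\mathsf{arw}(x,d,d')$, $\mathsf{nop}$, $\mathsf{mf}$ over a finite set of shared variables and a finite data domain. Under TSO each process has an unbounded FIFO store buffer: a write appends a message to the own buffer; a read takes the newest own buffered value of the variable and, if there is none, the memory value; $\mathsf{arw}$ and $\mathsf{mf}$ require the own buffer to be empty, and $\mathsf{arw}(x,d,d')$ changes the memory value of $x$ from $d$ to $d'$; an update moves the oldest message of some buffer to the memory. In the TSO game of a program with a set of final local states, players A and B alternately execute exactly one instruction of an arbitrary process. Player B wins a play if it visits a configuration in which it is player A's turn and some process is in a final local state; otherwise player A wins. In the *B-TSO game*, player B may perform any number of updates before and after each of her own moves; in the *before-only* (*after-only*) variant she may do so only before (only after) her own moves. Player A never updates. The *safety problem* asks, given a program with final local states whose game is deadlock-free (every configuration has a successor) and a configuration of this game, whether player A has a winning strategy from it. **Theorem.** 1. The safety problem is undecidable for the B-TSO game, for its before-only variant and for its after-only variant. 2. Let $\mathcal L$ be a perfect channel system with finite state set $S$, finite message set $M$ and transition relation $\Delta\subseteq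 S\times(\{!m,?m\mid m\in M\}\cup\{\mathsf{nop}\})\times S$, let $s_0\in S$ and $S_F\subseteq S$. Let $\mathcal P$ be the following program with two processes, variables $x_w,x_r,y$ and data domain $M\uplus\{0,1,\bot,\top\}$. * Process 1 has the states $S$, one state $h_t$ for each $t\in\Delta$, and $h_L,h_F$. For $t=(s,\mathsf{nop},s')$: $s\xrightarrow{\mathsf{nop}}h_t\xrightarrow{\mathsf{nop}}s'$. For $t=(s,!m,s')$: $s\xrightarrow{\mathsf{wr}(x_w,m)}h_t\xrightarrow{\mathsf{wr}(y,1)}s'$. In both cases also $h_t\xrightarrow{\mathsf{rd}(x_r,m')}h_L$ for all $m'\in M$. For $t=(s,?m,s')$: $s\xrightarrow{\mathsf{rd}(x_r,m)}h_t\xrightarrow{\mathsf{rd}(x_r,\bot)}s'$. For $s\in S_F$: $s\xrightarrow{\mathsf{wr}(x_w,\top)}h_F$. The states $h_L,h_F$ have $\mathsf{nop}$ self-loops. * Process 2 has the states $q_1$, $q_m$ ($m\in M$), $q_3,\dots,q_{14}$, $h_1,\dots,h_5$, $q_L$, $q_F$. Main cycle: $q_1\xrightarrow{\mathsf{rd}(x_w,m)}q_m\xrightarrow{\mathsf{wr}(x_r,m)}q_3$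 ($m\in M$) and $q_3\xrightarrow{\mathsf{mf}}q_4\xrightarrow{\mathsf{wr}(x_w,\bot)}q_5\xrightarrow{\mathsf{nop}}q_6\xrightarrow{\mathsf{mf}}q_7\xrightarrow{\mathsf{rd}(y,0)}q_8\xrightarrow{\mathsf{rd}(y,1)}q_9\xrightarrow{\mathsf{wr}(y,0)}q_{10}\xrightarrow{\mathsf{mf}}q_{11}\xrightarrow{\mathsf{rd}(x_w,\bot)}q_{12}\xrightarrow{\mathsf{wr}(x_r,\bot)}q_{13}\xrightarrow{\mathsf{nop}}q_{14}\xrightarrow{\mathsf{mf}}q_1$. Detours: for $(q,h)\in\{(q_1,h_1),(q_3,h_2),(q_8,h_3),(q_{10},h_4),(q_{14},h_5)\}$, $\mathsf{nop}$ transitions $q\to h$, $h\to q$, $h\to q_F$. Exits: to $q_L$ by $\mathsf{rd}(x_w,m)$ ($m\in M$) from each of $q_1,q_{11},q_{14}$, by $\mathsf{nop}$ from $q_3$ and $q_6$, and by $\mathsf{rd}(y,1)$ from $q_7$; to $q_F$ by $\mathsf{nop}$ from $q_m$ ($m\in M$) and $q_4$, and by $\mathsf{rd}(x_w,\top)$ from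 $q_1$. The states $q_L,q_F$ have $\mathsf{nop}$ self-loops. The only final local state is $q_F$. Let $c_0$ be the configuration in which it is player B's turn, the local states are $(s_0,q_1)$, both buffers are empty, and $x_w=x_r=\bot$, $y=0$. Then, in the B-TSO game of $\mathcal P$ as well as in its before-only and after-only variants, every configuration reachable from $c_0$ has a successor, and player B has a winning strategy from $c_0$ if and only if some state of $S_F$ is reachable in $\mathcal L$ from $s_0$ with the empty channel. 3. The map $(\mathcal L,s_0,S_F)\mapsto(\mathcal P,\{q_F\},c_0)$ is computable. -/

import Mathlib

namespace TSO

/-! ### Safety games -/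

/-- The two players. -/
inductive Player
  | A
  | B
  deriving DecidableEq

/-- The opponent of a player. -/
def Player.other : Player → Player
  | .A => .B
  | .B => .A

/-- A game arena: every configuration is owned by one of the two players, and all final
configurations belong to player A. -/
structure Game where
  Conf : Type
  owner : Conf → Player
  Move : Conf → Conf → Prop
  final : Set Conf
  owner_final : ∀ c ∈ final, owner c = Player.A

namespace Game

/-- Every configuration has a successor. -/
def DeadlockFree (G : Game) : Prop :=
  ∀ c, ∃ c', G.Move c c'

/-- Every configuration that is reachable from `c₀` has a successor. -/
def DeadlockFreeFrom (G : Game) (c₀ : G.Conf) : Prop :=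
  ∀ c, Relation.ReflTransGen G.Move c₀ c → ∃ c', G.Move c c'

/-- `σ` is a (history dependent) strategy of player `p`. Its arguments are the list of the earlier
configurations and the current one. Wherever it is the turn of `p`, the strategy picks a legal
move; elsewhere its value is irrelevant. -/
def IsStrategy (G : Game) (p : Player) (σ : List G.Conf → G.Conf → G.Conf) : Prop :=
  ∀ h c, G.owner c = p → (∃ c', G.Move c c') → G.Move c (σ h c)

/-- The history and the current configuration after `n` moves of the play from `c₀` in which
player A uses `σA` and player B uses `σB`. -/
def playHist (G : Game) (σA σB : List G.Conf → G.Conf → G.Conf) (c₀ : G.Conf) :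
    ℕ → List G.Conf × G.Conf
  | 0 => ([], c₀)
  | n + 1 =>
    let h := (playHist G σA σB c₀ n).1
    let c := (playHist G σA σB c₀ n).2
    (h ++ [c],
      match G.owner c with
      | Player.A => σA h c
      | Player.B => σB h c)

/-- The play induced by two strategies and an initial configuration. -/
def play (G : Game) (σA σB : List G.Conf → G.Conf → G.Conf) (c₀ : G.Conf) (n : ℕ) : G.Conf :=
  (G.playHist σA σB c₀ n).2

/-- `c` is winning for player A: she has a strategy that avoids the final configurations
against all strategies of player B. -/
def WinningA (G : Game) (c : G.Conf) : Prop :=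
  ∃ σA, G.IsStrategy Player.A σA ∧
    ∀ σB, G.IsStrategy Player.B σB → ∀ n, G.play σA σB c n ∉ G.final

/-- `c` is winning for player B: she has a strategy that reaches a final configuration
against all strategies of player A. -/
def WinningB (G : Game) (c : G.Conf) : Prop :=
  ∃ σB, G.IsStrategy Player.B σB ∧
    ∀ σA, G.IsStrategy Player.A σA → ∃ n, G.play σA σB c n ∈ G.final

end Game

/-! ### Concurrent programs and their TSO semantics -/

/-- Instructions over the shared variables `X` and the data domain `V`: read, write, atomic
read-write, skip, memory fence. -/
inductive Instr (X V : Type)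
  | rd (x : X) (v : V)
  | wr (x : X) (v : V)
  | arw (x : X) (v v' : V)
  | nop
  | mf

/-- Renaming of variables and values. -/
def Instr.map {X V X' V' : Type} (f : X → X') (g : V → V') : Instr X V → Instr X' V'
  | .rd x v => .rd (f x) (g v)
  | .wr x v => .wr (f x) (g v)
  | .arw x v v' => .arw (f x) (g v) (g v')
  | .nop => .nop
  | .mf => .mf

/-- A concurrent program with process identifiers `I`, shared variables `X` and data domain `V`:
each process is a finite transition system labelled with instructions. -/
structure Program (I X V : Type) where
  State : I → Type
  trans : ∀ i, State i → Instr X V → State i → Prop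
  finite_proc : Finite I
  finite_var : Finite X
  finite_val : Finite V
  finite_state : ∀ i, Finite (State i)

/-- A TSO configuration: local states, store buffers (newest message first), memory. -/
structure Config {I X V : Type} (P : Program I X V) where
  state : ∀ i, P.State i
  buf : I → List (X × V)
  mem : X → V

section Semantics

variable {I X V : Type} [DecidableEq I] [DecidableEq X]

/-- Move process `i` to the local state `q`. -/
def Config.goto {P : Program I X V} (c : Config P) (i : I) (q : P.State i) : Config P :=
  { c with state := Function.update c.state i q }

/-- `Step P c i a c'`: process `i` executes the instruction `a`. -/
inductive Step (P : Program I X V) : Config P → I → Instr X V → Config P → Prop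
  | readOwn (c : Config P) (i : I) (q : P.State i) (x : X) (v : V) (w : List (X × V))
      (ht : P.trans i (c.state i) (.rd x v) q)
      (hb : (c.buf i).filter (fun m => decide (m.1 = x)) = (x, v) :: w) :
      Step P c i (.rd x v) (c.goto i q)
  | readMem (c : Config P) (i : I) (q : P.State i) (x : X) (v : V)
      (ht : P.trans i (c.state i) (.rd x v) q)
      (hb : (c.buf i).filter (fun m => decide (m.1 = x)) = []) (hm : c.mem x = v) :
      Step P c i (.rd x v) (c.goto i q)
  | write (c : Config P) (i : I) (q : P.State i) (x : X) (v : V)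
      (ht : P.trans i (c.state i) (.wr x v) q) :
      Step P c i (.wr x v)
        { c.goto i q with buf := Function.update c.buf i ((x, v) :: c.buf i) }
  | arw (c : Config P) (i : I) (q : P.State i) (x : X) (v v' : V)
      (ht : P.trans i (c.state i) (.arw x v v') q) (hb : c.buf i = []) (hm : c.mem x = v) :
      Step P c i (.arw x v v') { c.goto i q with mem := Function.update c.mem x v' }
  | skip (c : Config P) (i : I) (q : P.State i) (ht : P.trans i (c.state i) .nop q) :
      Step P c i .nop (c.goto i q)
  | fence (c : Config P) (i : I) (q : P.State i) (ht : P.trans i (c.state i) .mf q)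
      (hb : c.buf i = []) :
      Step P c i .mf (c.goto i q)

/-- The oldest message in the buffer of some process is moved to the memory. -/
inductive Update (P : Program I X V) : Config P → Config P → Prop
  | mk (c : Config P) (i : I) (w : List (X × V)) (x : X) (v : V) (hb : c.buf i = w ++ [(x, v)]) :
      Update P c
        { c with buf := Function.update c.buf i w, mem := Function.update c.mem x v }

/-- Some (possibly zero) buffer updates. -/
def Updates (P : Program I X V) : Config P → Config P → Prop :=
  Relation.ReflTransGen (Update P)

end Semantics

/-! ### TSO games -/

/-- When a player is allowed to update buffers, relative to her own move. -/
inductive Timing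
  | never
  | before
  | after
  | always
  deriving DecidableEq

/-- Updates are allowed before the own move. -/
def Timing.AllowsBefore (t : Timing) : Prop := t = .before ∨ t = .always

/-- Updates are allowed after the own move. -/
def Timing.AllowsAfter (t : Timing) : Prop := t = .after ∨ t = .always

section TSOGame

variable {I X V : Type} [DecidableEq I] [DecidableEq X]

/-- One turn of a player who may update at the times given by `t`: buffer updates if they are
allowed before the move, exactly one instruction of some process, buffer updates if they are
allowed after the move. -/
def Turn (P : Program I X V) (t : Timing) (c c' : Config P) : Prop :=
  ∃ c₁ c₂ : Config P,
    (c₁ = c ∨ (t.AllowsBefore ∧ Updates P c c₁)) ∧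
    (∃ i a, Step P c₁ i a c₂) ∧
    (c' = c₂ ∨ (t.AllowsAfter ∧ Updates P c₂ c'))

/-- The TSO game of the program `P` with the sets `F i` of final local states, where player `p`
may update buffers at the times `ρ p`. A configuration is a TSO configuration together with
the player whose turn it is. -/
def tsoGame (P : Program I X V) (F : ∀ i, Set (P.State i)) (ρ : Player → Timing) : Game where
  Conf := Config P × Player
  owner c := c.2
  Move c c' := c'.2 = c.2.other ∧ Turn P (ρ c.2) c.1 c'.1
  final := {c | c.2 = Player.A ∧ ∃ i, c.1.state i ∈ F i}
  owner_final := fun _ h => h.1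

end TSOGame

/-- Only player B may update buffers, at the times given by `t`. -/
def onlyB (t : Timing) : Player → Timing
  | .A => .never
  | .B => t

/-! ### The safety problem as a decision problem -/

/-- `Instr X V` as a sum of products. -/
def Instr.equivSum (X V : Type) :
    Instr X V ≃ (X × V) ⊕ (X × V) ⊕ (X × V × V) ⊕ Bool where
  toFun
    | .rd x v => .inl (x, v)
    | .wr x v => .inr (.inl (x, v))
    | .arw x v v' => .inr (.inr (.inl (x, v, v')))
    | .nop => .inr (.inr (.inr false))
    | .mf => .inr (.inr (.inr true))
  invFun
    | .inl (x, v) => .rd x v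
    | .inr (.inl (x, v)) => .wr x v
    | .inr (.inr (.inl (x, v, v'))) => .arw x v v'
    | .inr (.inr (.inr false)) => .nop
    | .inr (.inr (.inr true)) => .mf
  left_inv := by rintro (_ | _ | _ | _ | _) <;> rfl
  right_inv := by rintro (⟨_, _⟩ | ⟨_, _⟩ | ⟨_, _, _⟩ | _ | _) <;> rfl

instance {X V : Type} [Primcodable X] [Primcodable V] : Primcodable (Instr X V) :=
  Primcodable.ofEquiv _ (Instr.equivSum X V)

/-- Players as Booleans. -/
def Player.equivBool : Player ≃ Bool where
  toFun
    | .A => false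
    | .B => true
  invFun
    | false => .A
    | true => .B
  left_inv := by rintro (_ | _) <;> rfl
  right_inv := by rintro (_ | _) <;> rfl

instance : Primcodable Player := Primcodable.ofEquiv _ Player.equivBool

/-- A finite description of a program, its final local states and a game configuration. Processes,
local states, variables and values are numbered from zero. -/
structure GameCode where
  numVars : ℕ
  numVals : ℕ
  /-- For each process, the number of its local states and the list of its transitions. -/
  procs : List (ℕ × List (ℕ × Instr ℕ ℕ × ℕ))
  /-- Pairs of a process and one of its final local states. -/
  finals : List (ℕ × ℕ)
  states : List ℕ
  bufs : List (List (ℕ × ℕ))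
  mem : List ℕ
  player : Player

/-- Game descriptions as tuples. -/
def GameCode.equivProd : GameCode ≃
    ℕ × ℕ × List (ℕ × List (ℕ × Instr ℕ ℕ × ℕ)) × List (ℕ × ℕ) × List ℕ ×
      List (List (ℕ × ℕ)) × List ℕ × Player where
  toFun g := (g.numVars, g.numVals, g.procs, g.finals, g.states, g.bufs, g.mem, g.player)
  invFun t := ⟨t.1, t.2.1, t.2.2.1, t.2.2.2.1, t.2.2.2.2.1, t.2.2.2.2.2.1, t.2.2.2.2.2.2.1,
    t.2.2.2.2.2.2.2⟩
  left_inv _ := rfl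
  right_inv _ := rfl

instance : Primcodable GameCode := Primcodable.ofEquiv _ GameCode.equivProd

/-- `g` describes the program `P`, the final local states `F` and the configuration `c` with
player `p` to move, for some numbering of the processes, variables, values and local states. -/
def GameCode.Describes (g : GameCode) {I X V : Type} (P : Program I X V)
    (F : ∀ i, Set (P.State i)) (c : Config P) (p : Player) : Prop :=
  ∃ (eI : I ≃ Fin g.procs.length) (eX : X ≃ Fin g.numVars) (eV : V ≃ Fin g.numVals)
    (eQ : ∀ i, P.State i ≃ Fin (g.procs.get (eI i)).1),
    (∀ i q a q', P.trans i q a q' ↔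
      ((eQ i q : ℕ), a.map (fun x => (eX x : ℕ)) (fun v => (eV v : ℕ)), (eQ i q' : ℕ)) ∈
        (g.procs.get (eI i)).2) ∧
    (∀ i q, q ∈ F i ↔ ((eI i : ℕ), (eQ i q : ℕ)) ∈ g.finals) ∧
    (∀ i, g.states[(eI i : ℕ)]? = some (eQ i (c.state i) : ℕ)) ∧
    (∀ i, g.bufs[(eI i : ℕ)]? =
      some ((c.buf i).map fun m => ((eX m.1 : ℕ), (eV m.2 : ℕ)))) ∧
    (∀ x, g.mem[(eX x : ℕ)]? = some (eV (c.mem x) : ℕ)) ∧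
    g.player = p

/-- The safety problem for the TSO games with update rights `ρ` is decidable: an algorithm, given
a description of a program with final states whose game is deadlock-free and of a configuration
of this game, tells whether the configuration is winning for player A. -/
def SafetyDecidable (ρ : Player → Timing) : Prop :=
  ∃ f : GameCode → Bool, Computable f ∧
    ∀ (g : GameCode) (I X V : Type) [DecidableEq I] [DecidableEq X] (P : Program I X V)
      (F : ∀ i, Set (P.State i)) (c : Config P) (p : Player),
      g.Describes P F c p → (tsoGame P F ρ).DeadlockFree →
        (f g = true ↔ (tsoGame P F ρ).WinningA (c, p))

/-! ### Perfect channel systems -/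

/-- Channel operations: send, receive, skip. -/
inductive ChanOp (M : Type)
  | send (m : M)
  | recv (m : M)
  | nop

/-- Renaming of messages. -/
def ChanOp.map {M M' : Type} (f : M → M') : ChanOp M → ChanOp M'
  | .send m => .send (f m)
  | .recv m => .recv (f m)
  | .nop => .nop

/-- A perfect channel system with states `S` and messages `M`. -/
structure PCS (S M : Type) where
  trans : Set (S × ChanOp M × S)
  finite_state : Finite S
  finite_msg : Finite M

/-- One step of a perfect channel system. The newest message of the channel comes first. -/
inductive PCS.Step {S M : Type} (L : PCS S M) : S × List M → S × List M → Prop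
  | send (s s' : S) (m : M) (w : List M) (h : (s, .send m, s') ∈ L.trans) :
      PCS.Step L (s, w) (s', m :: w)
  | recv (s s' : S) (m : M) (w : List M) (h : (s, .recv m, s') ∈ L.trans) :
      PCS.Step L (s, w ++ [m]) (s', w)
  | nop (s s' : S) (w : List M) (h : (s, .nop, s') ∈ L.trans) :
      PCS.Step L (s, w) (s', w)

/-- Some state in `SF` is reachable from the state `s₀` with an empty channel. -/
def PCS.Reaches {S M : Type} (L : PCS S M) (s₀ : S) (SF : Set S) : Prop :=
  ∃ s ∈ SF, ∃ w, Relation.ReflTransGen L.Step (s₀, []) (s, w)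

/-- `ChanOp M` as a sum. -/
def ChanOp.equivSum (M : Type) : ChanOp M ≃ M ⊕ M ⊕ Unit where
  toFun
    | .send m => .inl m
    | .recv m => .inr (.inl m)
    | .nop => .inr (.inr ())
  invFun
    | .inl m => .send m
    | .inr (.inl m) => .recv m
    | .inr (.inr _) => .nop
  left_inv := by rintro (_ | _ | _) <;> rfl
  right_inv := by rintro (_ | _ | _) <;> rfl

instance {M : Type} [Primcodable M] : Primcodable (ChanOp M) :=
  Primcodable.ofEquiv _ (ChanOp.equivSum M)

/-- A finite description of a perfect channel system, an initial state and final states. -/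
structure PCSCode where
  numStates : ℕ
  numMsgs : ℕ
  trans : List (ℕ × ChanOp ℕ × ℕ)
  init : ℕ
  finals : List ℕ

/-- Descriptions of channel systems as tuples. -/
def PCSCode.equivProd : PCSCode ≃ ℕ × ℕ × List (ℕ × ChanOp ℕ × ℕ) × ℕ × List ℕ where
  toFun g := (g.numStates, g.numMsgs, g.trans, g.init, g.finals)
  invFun t := ⟨t.1, t.2.1, t.2.2.1, t.2.2.2.1, t.2.2.2.2⟩
  left_inv _ := rfl
  right_inv _ := rfl

instance : Primcodable PCSCode := Primcodable.ofEquiv _ PCSCode.equivProd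

/-- `d` describes `L`, the initial state `s₀` and the set `SF` of final states, for some
numbering of the states and messages; all listed transitions are proper and distinct. -/
def PCSCode.Describes (d : PCSCode) {S M : Type} (L : PCS S M) (s₀ : S) (SF : Set S) : Prop :=
  ∃ (eS : S ≃ Fin d.numStates) (eM : M ≃ Fin d.numMsgs),
    d.trans.Nodup ∧
    (∀ t : ℕ × ChanOp ℕ × ℕ, t ∈ d.trans ↔
      ∃ s o s', (s, o, s') ∈ L.trans ∧
        t = ((eS s : ℕ), o.map (fun m => (eM m : ℕ)), (eS s' : ℕ))) ∧
    d.init = eS s₀ ∧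
    (∀ s, s ∈ SF ↔ (eS s : ℕ) ∈ d.finals)

/-! ### The two-process program that simulates a perfect channel system -/

/-- The two process identifiers. -/
inductive Proc2
  | one
  | two
  deriving DecidableEq

/-- The three shared variables. -/
inductive RVar
  | xw
  | xr
  | y
  deriving DecidableEq

/-- The data domain: the messages and four further values. -/
inductive RVal (M : Type)
  | msg (m : M)
  | zero
  | one
  | bot
  | top

/-- The local states of the first process: the states of `L`, one auxiliary state for each
transition of `L`, and two further states. -/
inductive State1 {S M : Type} (L : PCS S M)
  | chan (s : S)
  | aux (t : L.trans)
  | hL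
  | hF

/-- The local states of the second process. -/
inductive State2 (M : Type)
  | q1
  | qm (m : M)
  | q3
  | q4
  | q5
  | q6
  | q7
  | q8
  | q9
  | q10
  | q11
  | q12
  | q13
  | q14
  | h1
  | h2
  | h3
  | h4
  | h5
  | qL
  | qF

/-- The transitions of the first process. -/
inductive Trans1 {S M : Type} (L : PCS S M) (SF : Set S) :
    State1 L → Instr RVar (RVal M) → State1 L → Prop
  | nop1 (s s' : S) (h : (s, .nop, s') ∈ L.trans) :
      Trans1 L SF (.chan s) .nop (.aux ⟨_, h⟩)
  | nop2 (s s' : S) (h : (s, .nop, s') ∈ L.trans) :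
      Trans1 L SF (.aux ⟨_, h⟩) .nop (.chan s')
  | nopL (s s' : S) (h : (s, .nop, s') ∈ L.trans) (m' : M) :
      Trans1 L SF (.aux ⟨_, h⟩) (.rd .xr (.msg m')) .hL
  | send1 (s s' : S) (m : M) (h : (s, .send m, s') ∈ L.trans) :
      Trans1 L SF (.chan s) (.wr .xw (.msg m)) (.aux ⟨_, h⟩)
  | send2 (s s' : S) (m : M) (h : (s, .send m, s') ∈ L.trans) :
      Trans1 L SF (.aux ⟨_, h⟩) (.wr .y .one) (.chan s')
  | sendL (s s' : S) (m : M) (h : (s, .send m, s') ∈ L.trans) (m' : M) :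
      Trans1 L SF (.aux ⟨_, h⟩) (.rd .xr (.msg m')) .hL
  | recv1 (s s' : S) (m : M) (h : (s, .recv m, s') ∈ L.trans) :
      Trans1 L SF (.chan s) (.rd .xr (.msg m)) (.aux ⟨_, h⟩)
  | recv2 (s s' : S) (m : M) (h : (s, .recv m, s') ∈ L.trans) :
      Trans1 L SF (.aux ⟨_, h⟩) (.rd .xr .bot) (.chan s')
  | final (s : S) (h : s ∈ SF) : Trans1 L SF (.chan s) (.wr .xw .top) .hF
  | loopL : Trans1 L SF .hL .nop .hL
  | loopF : Trans1 L SF .hF .nop .hF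

/-- The transitions of the second process. -/
inductive Trans2 (M : Type) : State2 M → Instr RVar (RVal M) → State2 M → Prop
  -- the main cycle
  | t1 (m : M) : Trans2 M .q1 (.rd .xw (.msg m)) (.qm m)
  | tm (m : M) : Trans2 M (.qm m) (.wr .xr (.msg m)) .q3
  | t3 : Trans2 M .q3 .mf .q4
  | t4 : Trans2 M .q4 (.wr .xw .bot) .q5
  | t5 : Trans2 M .q5 .nop .q6
  | t6 : Trans2 M .q6 .mf .q7
  | t7 : Trans2 M .q7 (.rd .y .zero) .q8
  | t8 : Trans2 M .q8 (.rd .y .one) .q9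
  | t9 : Trans2 M .q9 (.wr .y .zero) .q10
  | t10 : Trans2 M .q10 .mf .q11
  | t11 : Trans2 M .q11 (.rd .xw .bot) .q12
  | t12 : Trans2 M .q12 (.wr .xr .bot) .q13
  | t13 : Trans2 M .q13 .nop .q14
  | t14 : Trans2 M .q14 .mf .q1
  -- the detours
  | d1 : Trans2 M .q1 .nop .h1
  | d1' : Trans2 M .h1 .nop .q1
  | d1F : Trans2 M .h1 .nop .qF
  | d2 : Trans2 M .q3 .nop .h2
  | d2' : Trans2 M .h2 .nop .q3
  | d2F : Trans2 M .h2 .nop .qF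
  | d3 : Trans2 M .q8 .nop .h3
  | d3' : Trans2 M .h3 .nop .q8
  | d3F : Trans2 M .h3 .nop .qF
  | d4 : Trans2 M .q10 .nop .h4
  | d4' : Trans2 M .h4 .nop .q10
  | d4F : Trans2 M .h4 .nop .qF
  | d5 : Trans2 M .q14 .nop .h5
  | d5' : Trans2 M .h5 .nop .q14
  | d5F : Trans2 M .h5 .nop .qF
  -- the exits to the states where player A, respectively player B, has won
  | e1L (m : M) : Trans2 M .q1 (.rd .xw (.msg m)) .qL
  | emF (m : M) : Trans2 M (.qm m) .nop .qF
  | e3L : Trans2 M .q3 .nop .qL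
  | e4F : Trans2 M .q4 .nop .qF
  | e6L : Trans2 M .q6 .nop .qL
  | e7L : Trans2 M .q7 (.rd .y .one) .qL
  | e11L (m : M) : Trans2 M .q11 (.rd .xw (.msg m)) .qL
  | e14L (m : M) : Trans2 M .q14 (.rd .xw (.msg m)) .qL
  | e1F : Trans2 M .q1 (.rd .xw .top) .qF
  | loopL : Trans2 M .qL .nop .qL
  | loopF : Trans2 M .qF .nop .qF

theorem finite_rVal (M : Type) [Finite M] : Finite (RVal M) := by
  refine Finite.of_surjective
    (fun z : M ⊕ Fin 4 => match z with
      | .inl m => RVal.msg m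
      | .inr 0 => .zero | .inr 1 => .one | .inr 2 => .bot | .inr 3 => .top) ?_
  rintro (m | _ | _ | _ | _)
  exacts [⟨.inl m, rfl⟩, ⟨.inr 0, rfl⟩, ⟨.inr 1, rfl⟩, ⟨.inr 2, rfl⟩, ⟨.inr 3, rfl⟩]

theorem finite_chanOp (M : Type) [Finite M] : Finite (ChanOp M) :=
  Finite.of_equiv _ (ChanOp.equivSum M).symm

theorem finite_state1 {S M : Type} (L : PCS S M) : Finite (State1 L) := by
  have := L.finite_state
  have := L.finite_msg
  have := finite_chanOp M
  refine Finite.of_surjective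
    (fun z : S ⊕ L.trans ⊕ Bool => match z with
      | .inl s => State1.chan s
      | .inr (.inl t) => .aux t
      | .inr (.inr false) => .hL
      | .inr (.inr true) => .hF) ?_
  rintro (s | t | _ | _)
  exacts [⟨.inl s, rfl⟩, ⟨.inr (.inl t), rfl⟩, ⟨.inr (.inr false), rfl⟩, ⟨.inr (.inr true), rfl⟩]

theorem finite_state2 (M : Type) [Finite M] : Finite (State2 M) := by
  refine Finite.of_surjective
    (fun z : M ⊕ Fin 20 => match z with
      | .inl m => State2.qm m
      | .inr 0 => .q1 | .inr 1 => .q3 | .inr 2 => .q4 | .inr 3 => .q5 | .inr 4 => .q6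
      | .inr 5 => .q7 | .inr 6 => .q8 | .inr 7 => .q9 | .inr 8 => .q10 | .inr 9 => .q11
      | .inr 10 => .q12 | .inr 11 => .q13 | .inr 12 => .q14 | .inr 13 => .h1 | .inr 14 => .h2
      | .inr 15 => .h3 | .inr 16 => .h4 | .inr 17 => .h5 | .inr 18 => .qL | .inr _ => .qF) ?_
  rintro (_ | m | _ | _ | _ | _ | _ | _ | _ | _ | _ | _ | _ | _ | _ | _ | _ | _ | _ | _ | _)
  exacts [⟨.inr 0, rfl⟩, ⟨.inl m, rfl⟩, ⟨.inr 1, rfl⟩, ⟨.inr 2, rfl⟩, ⟨.inr 3, rfl⟩,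
    ⟨.inr 4, rfl⟩, ⟨.inr 5, rfl⟩, ⟨.inr 6, rfl⟩, ⟨.inr 7, rfl⟩, ⟨.inr 8, rfl⟩, ⟨.inr 9, rfl⟩,
    ⟨.inr 10, rfl⟩, ⟨.inr 11, rfl⟩, ⟨.inr 12, rfl⟩, ⟨.inr 13, rfl⟩, ⟨.inr 14, rfl⟩,
    ⟨.inr 15, rfl⟩, ⟨.inr 16, rfl⟩, ⟨.inr 17, rfl⟩, ⟨.inr 18, rfl⟩, ⟨.inr 19, rfl⟩]

/-- The local states of the two processes. -/
def RState {S M : Type} (L : PCS S M) : Proc2 → Type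
  | .one => State1 L
  | .two => State2 M

/-- The transitions of the two processes. -/
def RTrans {S M : Type} (L : PCS S M) (SF : Set S) :
    ∀ i, RState L i → Instr RVar (RVal M) → RState L i → Prop
  | .one => Trans1 L SF
  | .two => Trans2 M

/-- The two-process program that simulates the perfect channel system `L`. -/
def reductionProgram {S M : Type} (L : PCS S M) (SF : Set S) : Program Proc2 RVar (RVal M) where
  State := RState L
  trans := RTrans L SF
  finite_proc := Finite.of_surjective
    (fun b : Bool => match b with
      | false => Proc2.one
      | true => Proc2.two)
    (by rintro (_ | _); exacts [⟨false, rfl⟩, ⟨true, rfl⟩])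
  finite_var := Finite.of_surjective
    (fun n : Fin 3 => match n with
      | 0 => RVar.xw
      | 1 => RVar.xr
      | 2 => RVar.y)
    (by rintro (_ | _ | _); exacts [⟨0, rfl⟩, ⟨1, rfl⟩, ⟨2, rfl⟩])
  finite_val := have := L.finite_msg; finite_rVal M
  finite_state
    | .one => finite_state1 L
    | .two => have := L.finite_msg; finite_state2 M

/-- The only final local state is `qF` in the second process. -/
def reductionFinal {S M : Type} (L : PCS S M) (SF : Set S) :
    ∀ i, Set ((reductionProgram L SF).State i)
  | .one => (∅ : Set (State1 L))
  | .two => ({State2.qF} : Set (State2 M))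

/-- The initial configuration: the first process is in the channel state `s₀`, the second one
in `q1`, and all buffers are empty. -/
def reductionInit {S M : Type} (L : PCS S M) (SF : Set S) (s₀ : S) :
    Config (reductionProgram L SF) where
  state
    | .one => (State1.chan s₀ : State1 L)
    | .two => (State2.q1 : State2 M)
  buf := fun _ => []
  mem
    | .xw => .bot
    | .xr => .bot
    | .y => .zero

/-- The TSO game on the program that simulates `L`, where only player B may update buffers, at the
times given by `t`. -/
def reductionGame {S M : Type} (L : PCS S M) (SF : Set S) (t : Timing) : Game :=
  tsoGame (reductionProgram L SF) (reductionFinal L SF) (onlyB t)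

end TSO

/-!
The store buffer of the first process plays the role of the channel. To send `m`, the first process
writes `m` to `xw` and `1` to `y`, so that the channel contents is stored in its buffer as pairs of
messages. The second process moves the oldest pair back to the first process through the variable
`xr`. Player B owns the buffers and wants the simulation to go on, because the second process can
read `top` and reach its final state once the first process is in a final channel state. Whoever
deviates from the simulation lets the opponent move to `qL`, `qF` or `hL` (see `BWins.of_reachable`
for player B and `trap_safeSet` for player A).

Both directions are positional. If a final channel state is reachable, player B forces a win within
a bounded number of moves (`Game.Attr`), by induction on the path in the channel system. She updates
only when she enters a `nop` detour (`BWins.of_detour`) or together with a read that commutes with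
the updates (`move_B_of_commute`). Hence it does not matter whether she may update before or after
her moves, and the strategy is uniform in the three variants. Otherwise the configurations that
satisfy an invariant, saying that the buffers and the memory represent a reachable configuration of
the channel system, form a trap for player B (`Game.Trap`). The invariant is stable under updates,
hence the argument does not depend on their timing.

For the undecidability, a fixed universal partial recursive function is turned into a Turing machine
with finitely many states. The machine is simulated by a queue rewriting system on cyclic words, and
this by a channel system that receives left-hand sides and sends right-hand sides of rules. So
reachability is undecidable in one fixed channel system when the input is given as initial channel
contents (`exists_pcs_undecidable`), and the initial channel contents is the initial content of a
buffer. The safety problem speaks of games without any deadlock, while the simulating program is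
only free of deadlocks in the reachable configurations. Therefore the second process gets the
possibility to resign; this removes all deadlocks and does not change the winner
(`deadlockFree_resign`, `Game.Attr.resign`, `Game.Trap.resign`).
-/

namespace TSO

/-! ### Positional certificates for winning a safety game -/

namespace Game

variable {G : Game}

/-- `G.Attr n c`: player B can force a visit to a final configuration from `c` within `n` moves. -/
inductive Attr (G : Game) : ℕ → G.Conf → Prop
  | final {n c} : c ∈ G.final → Attr G n c
  | moveB {n c c'} : G.owner c = .B → G.Move c c' → Attr G n c' → Attr G (n + 1) c
  | moveA {n c} : G.owner c = .A → (∃ c', G.Move c c') → (∀ c', G.Move c c' → Attr G n c') →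
      Attr G (n + 1) c

theorem Attr.mono {n m : ℕ} {c : G.Conf} (h : G.Attr n c) (hnm : n ≤ m) : G.Attr m c := by
  induction h generalizing m with
  | final hc => exact .final hc
  | moveB ho hm _ ih =>
    obtain ⟨m, rfl⟩ : ∃ k, m = k + 1 := ⟨m - 1, by omega⟩
    exact .moveB ho hm (ih (by omega))
  | moveA ho he _ ih =>
    obtain ⟨m, rfl⟩ : ∃ k, m = k + 1 := ⟨m - 1, by omega⟩
    exact .moveA ho he fun c' h' => ih c' h' (by omega)

open Classical in
/-- A history-independent choice of a successor with the least attractor rank. Where no successor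
lies in the attractor, any successor is picked. -/
noncomputable def attrChoice (G : Game) (c : G.Conf) : G.Conf :=
  if h : ∃ n c', G.Move c c' ∧ G.Attr n c' then (Nat.find_spec h).choose
  else if h' : ∃ c', G.Move c c' then h'.choose else c

theorem attrChoice_move {c : G.Conf} (h : ∃ c', G.Move c c') : G.Move c (G.attrChoice c) := by
  classical
  unfold attrChoice
  split_ifs with h₁
  · exact (Nat.find_spec h₁).choose_spec.1
  · exact h.choose_spec

theorem attrChoice_attr {n : ℕ} {c c' : G.Conf} (hm : G.Move c c') (h : G.Attr n c') :
    G.Attr n (G.attrChoice c) := by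
  classical
  unfold attrChoice
  have h₁ : ∃ n c', G.Move c c' ∧ G.Attr n c' := ⟨n, c', hm, h⟩
  rw [dif_pos h₁]
  exact (Nat.find_spec h₁).choose_spec.2.mono (Nat.find_min' h₁ ⟨c', hm, h⟩)

theorem play_succ (σA σB : List G.Conf → G.Conf → G.Conf) (c₀ : G.Conf) (k : ℕ) :
    G.play σA σB c₀ (k + 1) =
      match G.owner (G.play σA σB c₀ k) with
      | .A => σA (G.playHist σA σB c₀ k).1 (G.play σA σB c₀ k)
      | .B => σB (G.playHist σA σB c₀ k).1 (G.play σA σB c₀ k) := rfl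

/-- Player B wins by always choosing a successor of least rank; a play that follows this choice
visits a final configuration within `n` moves. -/
theorem Attr.winningB {n : ℕ} {c : G.Conf} (h : G.Attr n c) : G.WinningB c := by
  refine ⟨fun _ => G.attrChoice, fun _ c _ hc => attrChoice_move hc, fun σA hA => ?_⟩
  have key : ∀ n k, G.Attr n (G.play σA (fun _ => G.attrChoice) c k) →
      ∃ m, G.play σA (fun _ => G.attrChoice) c m ∈ G.final := by
    intro n
    induction n with
    | zero => intro k hk; cases hk with | final hf => exact ⟨k, hf⟩
    | succ n ih =>
      intro k hk
      have hs := play_succ σA (fun _ => G.attrChoice) c k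
      cases hk with
      | final hf => exact ⟨k, hf⟩
      | moveB ho hm hc' =>
        apply ih (k + 1)
        rw [hs, ho]
        exact attrChoice_attr hm hc'
      | moveA ho he hall =>
        apply ih (k + 1)
        rw [hs, ho]
        exact hall _ (hA _ _ ho he)
  exact key n 0 h

theorem WinningB.not_winningA {c : G.Conf} (hB : G.WinningB c) : ¬ G.WinningA c := by
  rintro ⟨σA, hA, hA'⟩
  obtain ⟨σB, hB, hB'⟩ := hB
  obtain ⟨n, hn⟩ := hB' σA hA
  exact hA' σB hB n hn

/-- A trap for player B: a set of non-final configurations in which player A can stay and which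
player B cannot leave. -/
structure Trap (G : Game) (W : Set G.Conf) : Prop where
  not_final : ∀ c ∈ W, c ∉ G.final
  moveA : ∀ c ∈ W, G.owner c = .A → ∃ c' ∈ W, G.Move c c'
  existsB : ∀ c ∈ W, G.owner c = .B → ∃ c', G.Move c c'
  moveB : ∀ c ∈ W, G.owner c = .B → ∀ c', G.Move c c' → c' ∈ W

/-- Player A wins by always staying inside the trap. -/
theorem Trap.winningA {W : Set G.Conf} (h : G.Trap W) {c : G.Conf} (hc : c ∈ W) :
    G.WinningA c := by
  classical
  let f : G.Conf → G.Conf := fun c =>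
    if h : ∃ c' ∈ W, G.Move c c' then h.choose
    else if h' : ∃ c', G.Move c c' then h'.choose else c
  refine ⟨fun _ => f, fun _ c _ hc => ?_, fun σB hB n => ?_⟩
  · simp only [f]
    split_ifs with h₁
    · exact h₁.choose_spec.2
    · exact hc.choose_spec
  · suffices G.play (fun _ => f) σB c n ∈ W from h.not_final _ this
    induction n with
    | zero => exact hc
    | succ n ih =>
      rw [play_succ]
      cases ho : G.owner (G.play (fun _ => f) σB c n) with
      | A =>
        have h₁ := h.moveA _ ih ho
        simp only [f, dif_pos h₁]
        exact h₁.choose_spec.1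
      | B => exact h.moveB _ ih ho _ (hB _ _ ho (h.existsB _ ih ho))

end Game

/-! ### Executing single instructions -/

section TSOGame

variable {I X V : Type} [DecidableEq I] [DecidableEq X] {P : Program I X V}

/-- The value that a process with store buffer `b` reads from the variable `x` if the memory
is `m`. -/
def readVal (b : List (X × V)) (m : X → V) (x : X) : V :=
  ((b.filter fun e => decide (e.1 = x)).head?.map Prod.snd).getD (m x)

theorem readVal_eq_mem {b : List (X × V)} {x : X} (h : ∀ e ∈ b, e.1 ≠ x) (m : X → V) :
    readVal b m x = m x := by
  have : b.filter (fun e => decide (e.1 = x)) = [] := by simpa using h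
  simp [readVal, this]

theorem readVal_mem_or (b : List (X × V)) (m : X → V) (x : X) :
    (x, readVal b m x) ∈ b ∨ readVal b m x = m x := by
  unfold readVal
  rcases hf : b.filter (fun e => decide (e.1 = x)) with _ | ⟨e, w⟩
  · right; rw [hf]; rfl
  · left; rw [hf]
    have : e ∈ b.filter (fun e => decide (e.1 = x)) := by simp [hf]
    obtain ⟨he, hx⟩ : e ∈ b ∧ e.1 = x := by simpa using this
    rw [← hx]
    exact he

/-- `a.Exec b m b' m'`: executing the instruction `a` changes the store buffer of the executing
process from `b` to `b'` and the memory from `m` to `m'`. -/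
def Instr.Exec : Instr X V → List (X × V) → (X → V) → List (X × V) → (X → V) → Prop
  | .rd x v, b, m, b', m' => readVal b m x = v ∧ b' = b ∧ m' = m
  | .wr x v, b, m, b', m' => b' = (x, v) :: b ∧ m' = m
  | .arw x v v', b, m, b', m' => b = [] ∧ m x = v ∧ b' = b ∧ m' = Function.update m x v'
  | .nop, b, m, b', m' => b' = b ∧ m' = m
  | .mf, b, m, b', m' => b = [] ∧ b' = b ∧ m' = m

/-- The effect of a step of one process, with reads and fences expressed by `Instr.Exec`. -/
theorem step_iff {c c' : Config P} {i : I} {a : Instr X V} :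
    Step P c i a c' ↔ ∃ q b' m', P.trans i (c.state i) a q ∧ a.Exec (c.buf i) c.mem b' m' ∧
      c' = ⟨Function.update c.state i q, Function.update c.buf i b', m'⟩ := by
  constructor
  · intro h
    cases h with
    | readOwn q x v w ht hb =>
      exact ⟨q, _, _, ht, ⟨by simp [readVal, hb], rfl, rfl⟩, by simp [Config.goto]⟩
    | readMem q x v ht hb hm =>
      exact ⟨q, _, _, ht, ⟨by simp [readVal, hb, hm], rfl, rfl⟩, by simp [Config.goto]⟩
    | write q x v ht => exact ⟨q, _, _, ht, ⟨rfl, rfl⟩, rfl⟩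
    | arw q x v v' ht hb hm => exact ⟨q, _, _, ht, ⟨hb, hm, rfl, rfl⟩, by simp [Config.goto]⟩
    | skip q ht => exact ⟨q, _, _, ht, ⟨rfl, rfl⟩, by simp [Config.goto]⟩
    | fence q ht hb => exact ⟨q, _, _, ht, ⟨hb, rfl, rfl⟩, by simp [Config.goto]⟩
  · rintro ⟨q, b', m', ht, he, rfl⟩
    cases a with
    | rd x v =>
      obtain ⟨hr, rfl, rfl⟩ := he
      rw [Function.update_eq_self]
      rcases hf : (c.buf i).filter (fun e => decide (e.1 = x)) with _ | ⟨e, w⟩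
      · exact .readMem c i q x v ht hf (by simpa [readVal, hf] using hr)
      · have : e ∈ (c.buf i).filter (fun e => decide (e.1 = x)) := by simp [hf]
        have hx : e.1 = x := by simpa using (List.mem_filter.1 this).2
        have hv : e.2 = v := by simpa [readVal, hf] using hr
        exact .readOwn c i q x v w ht (by rw [hf, ← hx, ← hv])
    | wr x v => obtain ⟨rfl, rfl⟩ := he; exact .write c i q x v ht
    | arw x v v' =>
      obtain ⟨hb, hm, rfl, rfl⟩ := he
      rw [Function.update_eq_self]
      exact .arw c i q x v v' ht hb hm
    | nop =>
      obtain ⟨rfl, rfl⟩ := he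
      rw [Function.update_eq_self]
      exact .skip c i q ht
    | mf =>
      obtain ⟨hb, rfl, rfl⟩ := he
      rw [Function.update_eq_self]
      exact .fence c i q ht hb

variable {F : ∀ i, Set (P.State i)} {t : Timing}

theorem move_A_iff {c c' : Config P} {p : Player} :
    (tsoGame P F (onlyB t)).Move (c, .A) (c', p) ↔ p = .B ∧ ∃ i a, Step P c i a c' := by
  simp [tsoGame, onlyB, Player.other, Turn, Timing.AllowsBefore, Timing.AllowsAfter]

theorem move_B_cases {c c' : Config P} {p : Player}
    (h : (tsoGame P F (onlyB t)).Move (c, .B) (c', p)) :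
    p = .A ∧ ∃ c₁ c₂, Updates P c c₁ ∧ (∃ i a, Step P c₁ i a c₂) ∧ Updates P c₂ c' := by
  obtain ⟨hp, c₁, c₂, h₁, h₂, h₃⟩ := h
  refine ⟨hp, c₁, c₂, ?_, h₂, ?_⟩
  · rcases h₁ with rfl | h₁
    exacts [.refl, h₁.2]
  · rcases h₃ with h₃ | h₃
    · simp only at h₃; subst h₃; exact .refl
    · exact h₃.2

theorem move_B_of_step {c c' : Config P} (h : ∃ i a, Step P c i a c') :
    (tsoGame P F (onlyB t)).Move (c, .B) (c', .A) :=
  ⟨rfl, c, c', .inl rfl, h, .inl rfl⟩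

/-- If the instruction of player B commutes with the updates, then she can combine the two,
whether she may update before or after her own move. -/
theorem move_B_of_commute (ht : t ≠ .never) {c c₁ c₂ c' : Config P} (hu : Updates P c c₁)
    (hs : ∃ i a, Step P c₁ i a c') (hs' : ∃ i a, Step P c i a c₂) (hu' : Updates P c₂ c') :
    (tsoGame P F (onlyB t)).Move (c, .B) (c', .A) := by
  by_cases hb : t.AllowsBefore
  · exact ⟨rfl, c₁, c', .inr ⟨hb, hu⟩, hs, .inl rfl⟩
  · have ha : t.AllowsAfter := by
      cases t <;> simp_all [Timing.AllowsBefore, Timing.AllowsAfter]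
    exact ⟨rfl, c, c₂, .inl rfl, hs', .inr ⟨ha, hu'⟩⟩

end TSOGame

/-! ### Configurations of the simulating program -/

/-- The store buffers of the simulating program. -/
abbrev RBuf (M : Type) := List (RVar × RVal M)

section Flat

variable {S M : Type} {L : PCS S M} {SF : Set S}

/-- The memory with the values `x`, `r`, `y` of the variables `xw`, `xr`, `y`. -/
def mem3 (x r y : RVal M) : RVar → RVal M
  | .xw => x
  | .xr => r
  | .y => y

@[simp] theorem mem3_xw (x r y : RVal M) : mem3 x r y .xw = x := rfl

@[simp] theorem mem3_xr (x r y : RVal M) : mem3 x r y .xr = r := rfl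

@[simp] theorem mem3_y (x r y : RVal M) : mem3 x r y .y = y := rfl

@[simp] theorem mem3_inj {x r y x' r' y' : RVal M} :
    mem3 x r y = mem3 x' r' y' ↔ x = x' ∧ r = r' ∧ y = y' :=
  ⟨fun h => ⟨congrFun h .xw, congrFun h .xr, congrFun h .y⟩, by rintro ⟨rfl, rfl, rfl⟩; rfl⟩

theorem mem3_eta (m : RVar → RVal M) : mem3 (m .xw) (m .xr) (m .y) = m := by
  funext z; cases z <;> rfl

variable (L SF) in
/-- The configuration of the simulating program with local states `a`, `b`, store buffers `u`, `v`
and values `x`, `r`, `y` of the variables `xw`, `xr`, `y`. -/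
def conf (a : State1 L) (b : State2 M) (u v : RBuf M) (x r y : RVal M) :
    Config (reductionProgram L SF) where
  state
    | .one => a
    | .two => b
  buf
    | .one => u
    | .two => v
  mem := mem3 x r y

theorem conf_eta (c : Config (reductionProgram L SF)) :
    ∃ a b u v x r y, c = conf L SF a b u v x r y := by
  obtain ⟨s, b, m⟩ := c
  refine ⟨s .one, s .two, b .one, b .two, m .xw, m .xr, m .y, ?_⟩
  simp only [conf, mem3_eta, Config.mk.injEq, and_true]
  exact ⟨by funext i; cases i <;> rfl, by funext i; cases i <;> rfl⟩

theorem step_one_iff {a : State1 L} {b : State2 M} {u v : RBuf M} {x r y : RVal M}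
    {ins : Instr RVar (RVal M)} {c' : Config (reductionProgram L SF)} :
    Step (reductionProgram L SF) (conf L SF a b u v x r y) .one ins c' ↔
      ∃ a' u' x' r' y', Trans1 L SF a ins a' ∧ ins.Exec u (mem3 x r y) u' (mem3 x' r' y') ∧
        c' = conf L SF a' b u' v x' r' y' := by
  have key : ∀ (a' : State1 L) (u' : RBuf M) (m' : RVar → RVal M),
      (⟨Function.update (conf L SF a b u v x r y).state .one a',
        Function.update (conf L SF a b u v x r y).buf .one u', m'⟩ :
          Config (reductionProgram L SF)) =
        conf L SF a' b u' v (m' .xw) (m' .xr) (m' .y) := by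
    intro a' u' m'
    simp only [conf, mem3_eta, Config.mk.injEq, and_true]
    exact ⟨by funext i; cases i <;> rfl, by funext i; cases i <;> rfl⟩
  rw [step_iff]
  constructor
  · rintro ⟨q, b', m', ht, he, rfl⟩
    exact ⟨q, b', m' .xw, m' .xr, m' .y, ht, by rw [mem3_eta]; exact he, key _ _ _⟩
  · rintro ⟨a', u', x', r', y', ht, he, rfl⟩
    exact ⟨a', u', mem3 x' r' y', ht, he, (key a' u' (mem3 x' r' y')).symm⟩

theorem step_two_iff {a : State1 L} {b : State2 M} {u v : RBuf M} {x r y : RVal M}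
    {ins : Instr RVar (RVal M)} {c' : Config (reductionProgram L SF)} :
    Step (reductionProgram L SF) (conf L SF a b u v x r y) .two ins c' ↔
      ∃ b' v' x' r' y', Trans2 M b ins b' ∧ ins.Exec v (mem3 x r y) v' (mem3 x' r' y') ∧
        c' = conf L SF a b' u v' x' r' y' := by
  have key : ∀ (b' : State2 M) (v' : RBuf M) (m' : RVar → RVal M),
      (⟨Function.update (conf L SF a b u v x r y).state .two b',
        Function.update (conf L SF a b u v x r y).buf .two v', m'⟩ :
          Config (reductionProgram L SF)) =
        conf L SF a b' u v' (m' .xw) (m' .xr) (m' .y) := by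
    intro a' u' m'
    simp only [conf, mem3_eta, Config.mk.injEq, and_true]
    exact ⟨by funext i; cases i <;> rfl, by funext i; cases i <;> rfl⟩
  rw [step_iff]
  constructor
  · rintro ⟨q, b', m', ht, he, rfl⟩
    exact ⟨q, b', m' .xw, m' .xr, m' .y, ht, by rw [mem3_eta]; exact he, key _ _ _⟩
  · rintro ⟨a', u', x', r', y', ht, he, rfl⟩
    exact ⟨a', u', mem3 x' r' y', ht, he, (key a' u' (mem3 x' r' y')).symm⟩

/-- The value of the variable `z'`, formerly `x`, after the value `e` has been stored in `z`. -/
def store (z : RVar) (e : RVal M) (z' : RVar) (x : RVal M) : RVal M := if z = z' then e else x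

theorem update_iff {a : State1 L} {b : State2 M} {u v : RBuf M} {x r y : RVal M}
    {c' : Config (reductionProgram L SF)} :
    Update (reductionProgram L SF) (conf L SF a b u v x r y) c' ↔
      (∃ u' z e, u = u' ++ [(z, e)] ∧
        c' = conf L SF a b u' v (store z e .xw x) (store z e .xr r) (store z e .y y)) ∨
      (∃ v' z e, v = v' ++ [(z, e)] ∧
        c' = conf L SF a b u v' (store z e .xw x) (store z e .xr r) (store z e .y y)) := by
  have hm : ∀ z e, Function.update (mem3 x r y) z e =
      mem3 (store z e .xw x) (store z e .xr r) (store z e .y y) := by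
    intro z e; funext z'; cases z <;> cases z' <;> simp [store]
  have k₁ : ∀ (u' : RBuf M) z e,
      ({ conf L SF a b u v x r y with
          buf := Function.update (conf L SF a b u v x r y).buf .one u'
          mem := Function.update (conf L SF a b u v x r y).mem z e } :
          Config (reductionProgram L SF)) =
        conf L SF a b u' v (store z e .xw x) (store z e .xr r) (store z e .y y) := by
    intro u' z e
    simp only [conf, hm, Config.mk.injEq, and_true, true_and]
    funext i; cases i <;> simp
  have k₂ : ∀ (v' : RBuf M) z e,
      ({ conf L SF a b u v x r y with
          buf := Function.update (conf L SF a b u v x r y).buf .two v'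
          mem := Function.update (conf L SF a b u v x r y).mem z e } :
          Config (reductionProgram L SF)) =
        conf L SF a b u v' (store z e .xw x) (store z e .xr r) (store z e .y y) := by
    intro u' z e
    simp only [conf, hm, Config.mk.injEq, and_true, true_and]
    funext i; cases i <;> simp
  constructor
  · intro h
    generalize hc : conf L SF a b u v x r y = c at h
    obtain ⟨i, w, z, e, hb⟩ := h
    subst hc
    cases i with
    | one => exact .inl ⟨w, z, e, hb, k₁ _ _ _⟩
    | two => exact .inr ⟨w, z, e, hb, k₂ _ _ _⟩
  · rintro (⟨w, z, e, hb, rfl⟩ | ⟨w, z, e, hb, rfl⟩)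
    · rw [← k₁]; exact .mk _ Proc2.one w z e hb
    · rw [← k₂]; exact .mk _ Proc2.two w z e hb

/-- The encoding of the channel content `w` in the store buffer of the first process. -/
def enc : List M → RBuf M
  | [] => []
  | m :: w => (.y, .one) :: (.xw, .msg m) :: enc w

theorem enc_append (w w' : List M) : enc (w ++ w') = enc w ++ enc w' := by
  induction w with
  | nil => rfl
  | cons m w ih => simp [enc, ih]

theorem enc_concat (w : List M) (m : M) :
    enc (w ++ [m]) = enc w ++ [(.y, .one)] ++ [(.xw, .msg m)] := by
  simp [enc_append, enc]

theorem enc_eq_concat {w : List M} {u : RBuf M} {z : RVar} {e : RVal M}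
    (h : u ++ [(z, e)] = enc w) :
    ∃ w' m, w = w' ++ [m] ∧ u = enc w' ++ [(.y, .one)] ∧ z = .xw ∧ e = .msg m := by
  rcases List.eq_nil_or_concat w with rfl | ⟨w', m, rfl⟩
  · simp [enc] at h
  · rw [List.concat_eq_append, enc_concat] at h
    obtain ⟨h₁, h₂⟩ := List.append_inj' h rfl
    simp only [List.cons.injEq, Prod.mk.injEq, and_true] at h₂
    exact ⟨w', m, by simp, h₁, h₂.1, h₂.2⟩

theorem mem_enc {w : List M} {e : RVar × RVal M} (h : e ∈ enc w) :
    e = (.y, .one) ∨ ∃ m, e = (.xw, .msg m) := by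
  induction w with
  | nil => simp [enc] at h
  | cons m w ih =>
    simp only [enc, List.mem_cons] at h
    rcases h with h | h | h
    exacts [.inl h, .inr ⟨m, h⟩, ih h]

variable (L SF) in
/-- The variant of the initial configuration in which the channel content is `w`. -/
def startConf (s : S) (w : List M) : Config (reductionProgram L SF) :=
  conf L SF (.chan s) .q1 (enc w) [] .bot .bot .zero

theorem reductionInit_eq (s : S) : reductionInit L SF s = startConf L SF s [] := by
  refine congr (congr (congrArg Config.mk ?_) ?_) ?_ <;> funext i <;> cases i <;> rfl

/-! ### Freedom from deadlocks -/

/-- An admissible value for a variable; the value `top` is written only on entering `hF`. -/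
def Admissible (a : State1 L) (e : RVar × RVal M) : Prop :=
  (e.1 = .y → e.2 = .zero ∨ e.2 = .one) ∧
  (e.1 = .xw → a = .hF ∨ e.2 = .bot ∨ ∃ m, e.2 = .msg m)

/-- The invariant that excludes deadlocks: all values in the memory and in the buffers are
admissible. -/
structure Live (c : Config (reductionProgram L SF)) : Prop where
  buf : ∀ i, ∀ e ∈ c.buf i, Admissible (L := L) (c.state .one) e
  mem : ∀ z, Admissible (L := L) (c.state .one) (z, c.mem z)

theorem live_conf_iff {a : State1 L} {b : State2 M} {u v : RBuf M} {x r y : RVal M} :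
    Live (conf L SF a b u v x r y) ↔ (∀ e ∈ u, Admissible a e) ∧ (∀ e ∈ v, Admissible a e) ∧
      Admissible a (.xw, x) ∧ Admissible a (.y, y) := by
  constructor
  · rintro ⟨h, h'⟩
    exact ⟨h .one, h .two, h' .xw, h' .y⟩
  · rintro ⟨h₁, h₂, h₃, h₄⟩
    refine ⟨fun i => ?_, fun z => ?_⟩
    · cases i
      exacts [h₁, h₂]
    · cases z
      exacts [h₃, ⟨nofun, nofun⟩, h₄]

theorem Live.update {c c' : Config (reductionProgram L SF)} (h : Live c)
    (hu : Update (reductionProgram L SF) c c') : Live c' := by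
  obtain ⟨i, w, z, e, hb⟩ := hu
  have he : Admissible (L := L) (c.state .one) (z, e) := h.buf i _ (by simp [hb])
  refine ⟨fun j e' hj => ?_, fun z' => ?_⟩
  · rcases eq_or_ne j i with rfl | hne
    · refine h.buf j _ ?_
      simp only [Function.update_self] at hj
      simp [hb, hj]
    · simp only [Function.update_of_ne hne] at hj
      exact h.buf j _ hj
  · rcases eq_or_ne z' z with rfl | hne
    · simpa using he
    · simpa [Function.update_of_ne hne] using h.mem z'

theorem Live.updates {c c' : Config (reductionProgram L SF)} (h : Live c)
    (hu : Updates (reductionProgram L SF) c c') : Live c' := by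
  induction hu with
  | refl => exact h
  | tail _ h' ih => exact ih.update h'

theorem Trans1.admissible {a a' : State1 L} {ins : Instr RVar (RVal M)} (h : Trans1 L SF a ins a')
    {e : RVar × RVal M} (he : Admissible a e) : Admissible a' e := by
  refine ⟨he.1, fun hx => ?_⟩
  rcases he.2 hx with rfl | h'
  · cases h; exact .inl rfl
  · exact .inr h'

theorem Trans1.admissible_wr {a a' : State1 L} {z : RVar} {e : RVal M}
    (h : Trans1 L SF a (.wr z e) a') : Admissible a' (z, e) := by
  cases h <;> simp [Admissible]

theorem Trans2.admissible_wr {b b' : State2 M} {z : RVar} {e : RVal M}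
    (h : Trans2 M b (.wr z e) b') (a : State1 L) : Admissible a (z, e) := by
  cases h <;> simp [Admissible]

theorem Instr.Exec.forall_admissible {ins : Instr RVar (RVal M)} {u u' : RBuf M}
    {m m' : RVar → RVal M} (h : ins.Exec u m u' m') {a a' : State1 L}
    (hold : ∀ e, Admissible a e → Admissible a' e) (harw : ∀ z e e', ins ≠ .arw z e e')
    (hnew : ∀ z e, ins = .wr z e → Admissible a' (z, e)) (hu : ∀ e ∈ u, Admissible a e) :
    (∀ e ∈ u', Admissible a' e) ∧ m' = m := by
  have hu' : ∀ e ∈ u, Admissible a' e := fun e he => hold e (hu e he)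
  cases ins with
  | rd z e => obtain ⟨-, rfl, rfl⟩ := h; exact ⟨hu', rfl⟩
  | wr z e =>
    obtain ⟨rfl, rfl⟩ := h
    exact ⟨List.forall_mem_cons.2 ⟨hnew z e rfl, hu'⟩, rfl⟩
  | arw z e e' => exact absurd rfl (harw z e e')
  | nop => obtain ⟨rfl, rfl⟩ := h; exact ⟨hu', rfl⟩
  | mf => obtain ⟨-, rfl, rfl⟩ := h; exact ⟨hu', rfl⟩

theorem Live.step {c c' : Config (reductionProgram L SF)} (h : Live c) {i ins}
    (hs : Step (reductionProgram L SF) c i ins c') : Live c' := by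
  obtain ⟨a, b, u, v, x, r, y, rfl⟩ := conf_eta c
  rw [live_conf_iff] at h
  obtain ⟨h₁, h₂, h₃, h₄⟩ := h
  cases i with
  | one =>
    obtain ⟨a', u', x', r', y', ht, he, rfl⟩ := step_one_iff.1 hs
    obtain ⟨hu, hm⟩ := he.forall_admissible (fun _ => ht.admissible)
      (by rintro z e e' rfl; cases ht) (by rintro z e rfl; exact ht.admissible_wr) h₁
    obtain ⟨rfl, rfl, rfl⟩ := mem3_inj.1 hm
    exact live_conf_iff.2 ⟨hu, fun e he => ht.admissible (h₂ e he), ht.admissible h₃,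
      ht.admissible h₄⟩
  | two =>
    obtain ⟨b', v', x', r', y', ht, he, rfl⟩ := step_two_iff.1 hs
    obtain ⟨hv, hm⟩ := he.forall_admissible (fun _ h => h)
      (by rintro z e e' rfl; cases ht) (by rintro z e rfl; exact ht.admissible_wr a) h₂
    obtain ⟨rfl, rfl, rfl⟩ := mem3_inj.1 hm
    exact live_conf_iff.2 ⟨h₁, hv, h₃, h₄⟩

theorem step_one_nop {a a' : State1 L} {b : State2 M} {u v : RBuf M} {x r y : RVal M}
    (h : Trans1 L SF a .nop a') :
    ∃ i ins, Step (reductionProgram L SF) (conf L SF a b u v x r y) i ins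
      (conf L SF a' b u v x r y) :=
  ⟨.one, _, step_one_iff.2 ⟨_, _, _, _, _, h, ⟨rfl, rfl⟩, rfl⟩⟩

theorem step_one_wr {a a' : State1 L} {b : State2 M} {u v : RBuf M} {x r y : RVal M}
    {z : RVar} {e : RVal M} (h : Trans1 L SF a (.wr z e) a') :
    ∃ i ins, Step (reductionProgram L SF) (conf L SF a b u v x r y) i ins
      (conf L SF a' b ((z, e) :: u) v x r y) :=
  ⟨.one, _, step_one_iff.2 ⟨_, _, _, _, _, h, ⟨rfl, rfl⟩, rfl⟩⟩

theorem step_one_rd {a a' : State1 L} {b : State2 M} {u v : RBuf M} {x r y : RVal M}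
    {z : RVar} {e : RVal M} (h : Trans1 L SF a (.rd z e) a')
    (he : readVal u (mem3 x r y) z = e) :
    ∃ i ins, Step (reductionProgram L SF) (conf L SF a b u v x r y) i ins
      (conf L SF a' b u v x r y) :=
  ⟨.one, _, step_one_iff.2 ⟨_, _, _, _, _, h, ⟨he, rfl, rfl⟩, rfl⟩⟩

theorem step_two_nop {a : State1 L} {b b' : State2 M} {u v : RBuf M} {x r y : RVal M}
    (h : Trans2 M b .nop b') :
    ∃ i ins, Step (reductionProgram L SF) (conf L SF a b u v x r y) i ins
      (conf L SF a b' u v x r y) :=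
  ⟨.two, _, step_two_iff.2 ⟨_, _, _, _, _, h, ⟨rfl, rfl⟩, rfl⟩⟩

theorem step_two_wr {a : State1 L} {b b' : State2 M} {u v : RBuf M} {x r y : RVal M}
    {z : RVar} {e : RVal M} (h : Trans2 M b (.wr z e) b') :
    ∃ i ins, Step (reductionProgram L SF) (conf L SF a b u v x r y) i ins
      (conf L SF a b' u ((z, e) :: v) x r y) :=
  ⟨.two, _, step_two_iff.2 ⟨_, _, _, _, _, h, ⟨rfl, rfl⟩, rfl⟩⟩

theorem step_two_rd {a : State1 L} {b b' : State2 M} {u v : RBuf M} {x r y : RVal M}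
    {z : RVar} {e : RVal M} (h : Trans2 M b (.rd z e) b')
    (he : readVal v (mem3 x r y) z = e) :
    ∃ i ins, Step (reductionProgram L SF) (conf L SF a b u v x r y) i ins
      (conf L SF a b' u v x r y) :=
  ⟨.two, _, step_two_iff.2 ⟨_, _, _, _, _, h, ⟨he, rfl, rfl⟩, rfl⟩⟩

theorem step_two_mf {a : State1 L} {b b' : State2 M} {u : RBuf M} {x r y : RVal M}
    (h : Trans2 M b .mf b') :
    ∃ i ins, Step (reductionProgram L SF) (conf L SF a b u [] x r y) i ins
      (conf L SF a b' u [] x r y) :=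
  ⟨.two, _, step_two_iff.2 ⟨_, _, _, _, _, h, ⟨rfl, rfl, rfl⟩, rfl⟩⟩

/-- The second process can be blocked only in `q11`, by the value `top` of `xw`, and then the first
process is in `hF` and can idle. -/
theorem Live.exists_step {c : Config (reductionProgram L SF)} (h : Live c) :
    ∃ c', ∃ i ins, Step (reductionProgram L SF) c i ins c' := by
  obtain ⟨a, b, u, v, x, r, y, rfl⟩ := conf_eta c
  obtain ⟨-, h₂, h₃, h₄⟩ := live_conf_iff.1 h
  have hread : ∀ z, Admissible a (z, mem3 x r y z) →
      Admissible a (z, readVal v (mem3 x r y) z) := by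
    intro z hz
    rcases readVal_mem_or v (mem3 x r y) z with h | h
    · exact h₂ _ h
    · rwa [h]
  cases b with
  | q1 => exact ⟨_, step_two_nop .d1⟩
  | qm m => exact ⟨_, step_two_nop (.emF m)⟩
  | q3 => exact ⟨_, step_two_nop .d2⟩
  | q4 => exact ⟨_, step_two_nop .e4F⟩
  | q5 => exact ⟨_, step_two_nop .t5⟩
  | q6 => exact ⟨_, step_two_nop .e6L⟩
  | q7 =>
    rcases (hread .y h₄).1 rfl with h | h
    exacts [⟨_, step_two_rd .t7 h⟩, ⟨_, step_two_rd .e7L h⟩]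
  | q8 => exact ⟨_, step_two_nop .d3⟩
  | q9 => exact ⟨_, step_two_wr .t9⟩
  | q10 => exact ⟨_, step_two_nop .d4⟩
  | q11 =>
    rcases (hread .xw h₃).2 rfl with rfl | h | ⟨m, h⟩
    exacts [⟨_, step_one_nop .loopF⟩, ⟨_, step_two_rd .t11 h⟩, ⟨_, step_two_rd (.e11L m) h⟩]
  | q12 => exact ⟨_, step_two_wr .t12⟩
  | q13 => exact ⟨_, step_two_nop .t13⟩
  | q14 => exact ⟨_, step_two_nop .d5⟩
  | h1 => exact ⟨_, step_two_nop .d1F⟩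
  | h2 => exact ⟨_, step_two_nop .d2F⟩
  | h3 => exact ⟨_, step_two_nop .d3F⟩
  | h4 => exact ⟨_, step_two_nop .d4F⟩
  | h5 => exact ⟨_, step_two_nop .d5F⟩
  | qL => exact ⟨_, step_two_nop .loopL⟩
  | qF => exact ⟨_, step_two_nop .loopF⟩

theorem live_startConf (s : S) (w : List M) : Live (startConf L SF s w) := by
  refine live_conf_iff.2 ⟨fun e he => ?_, by simp, by simp [Admissible], by simp [Admissible]⟩
  rcases mem_enc he with rfl | ⟨m, rfl⟩ <;> simp [Admissible]

theorem deadlockFreeFrom_startConf (s : S) (w : List M) (t : Timing) (p : Player) :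
    (reductionGame L SF t).DeadlockFreeFrom (startConf L SF s w, p) := by
  intro c hc
  have hl : Live c.1 := by
    induction hc with
    | refl => exact live_startConf s w
    | @tail c₁ c₂ _ hm ih =>
      obtain ⟨c₁, p₁⟩ := c₁
      obtain ⟨c₂, p₂⟩ := c₂
      cases p₁ with
      | A =>
        obtain ⟨-, i, a, hs⟩ := move_A_iff.1 hm
        exact Live.step ih hs
      | B =>
        obtain ⟨-, d, d', h₁, ⟨i, a, h₂⟩, h₃⟩ := move_B_cases hm
        exact ((Live.updates ih h₁).step h₂).updates h₃
  obtain ⟨c', hs⟩ := hl.exists_step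
  obtain ⟨c, p⟩ := c
  cases p with
  | A => exact ⟨(c', .B), move_A_iff.2 ⟨rfl, hs⟩⟩
  | B => exact ⟨(c', .A), move_B_of_step hs⟩

end Flat

/-! ### Player B simulates the channel system -/

section BSide

variable {S M : Type} {L : PCS S M} {SF : Set S} {t : Timing}

variable (SF t) in
/-- Player B can force a win from the given configuration within a bounded number of moves. -/
def BWins (c : Config (reductionProgram L SF)) (p : Player) : Prop :=
  ∃ n, (reductionGame L SF t).Attr n (c, p)

theorem BWins.of_move {c c' : Config (reductionProgram L SF)}
    (hm : (reductionGame L SF t).Move (c, .B) (c', .A)) (h : BWins SF t c' .A) :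
    BWins SF t c .B := by
  obtain ⟨n, hn⟩ := h
  exact ⟨n + 1, .moveB rfl hm hn⟩

theorem BWins.of_step {c c' : Config (reductionProgram L SF)}
    (hs : ∃ i a, Step (reductionProgram L SF) c i a c') (h : BWins SF t c' .A) :
    BWins SF t c .B :=
  .of_move (move_B_of_step hs) h

theorem attr_qF {a : State1 L} {u v : RBuf M} {x r y : RVal M} {n : ℕ} :
    (reductionGame L SF t).Attr n (conf L SF a .qF u v x r y, .A) :=
  .final ⟨rfl, .two, rfl⟩

/-- Player B wins with her next move if the second process can enter `qF` unconditionally. -/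
theorem attr_of_exit {a : State1 L} {b : State2 M} {u v : RBuf M} {x r y : RVal M}
    (h : Trans2 M b .nop .qF) :
    (reductionGame L SF t).Attr 1 (conf L SF a b u v x r y, .B) :=
  .moveB rfl (move_B_of_step (step_two_nop h)) attr_qF

/-- Player A is forced to move to the configuration `c'`: after each other move, player B can
enter `qF` at once. -/
theorem BWins.of_forced {a : State1 L} {b : State2 M} {u v : RBuf M} {x r y : RVal M}
    {c' : Config (reductionProgram L SF)}
    (hs : ∃ i a', Step (reductionProgram L SF) (conf L SF a b u v x r y) i a' c')
    (h₁ : ∀ a' u' x' r' y' ins, Trans1 L SF a ins a' →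
      ins.Exec u (mem3 x r y) u' (mem3 x' r' y') →
        c' = conf L SF a' b u' v x' r' y' ∨ Trans2 M b .nop .qF)
    (h₂ : ∀ b' v' x' r' y' ins, Trans2 M b ins b' →
      ins.Exec v (mem3 x r y) v' (mem3 x' r' y') →
        c' = conf L SF a b' u v' x' r' y' ∨ Trans2 M b' .nop .qF)
    (h : BWins SF t c' .B) : BWins SF t (conf L SF a b u v x r y) .A := by
  obtain ⟨n, hn⟩ := h
  refine ⟨max n 1 + 1, .moveA rfl ⟨(c', .B), move_A_iff.2 ⟨rfl, hs⟩⟩ ?_⟩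
  rintro ⟨d, p⟩ hd
  obtain ⟨rfl, i, ins, hd⟩ := move_A_iff.1 hd
  have hn' := hn.mono (le_max_left n 1)
  cases i with
  | one =>
    obtain ⟨a', u', x', r', y', ht, he, rfl⟩ := step_one_iff.1 hd
    rcases h₁ _ _ _ _ _ _ ht he with rfl | hq
    exacts [hn', (attr_of_exit hq).mono (le_max_right n 1)]
  | two =>
    obtain ⟨b', v', x', r', y', ht, he, rfl⟩ := step_two_iff.1 hd
    rcases h₂ _ _ _ _ _ _ ht he with rfl | hq
    exacts [hn', (attr_of_exit hq).mono (le_max_right n 1)]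

/-- `Detour b h`: from `b`, the second process can make the detour `b → h → b`, and from `h` the
only other transition enters `qF`. -/
inductive Detour : State2 M → State2 M → Prop
  | d1 : Detour .q1 .h1
  | d2 : Detour .q3 .h2
  | d3 : Detour .q8 .h3
  | d4 : Detour .q10 .h4
  | d5 : Detour .q14 .h5

/-- On a detour, player B can perform arbitrary updates, whether she may update before or after
her own moves. -/
theorem BWins.of_detour (ht : t ≠ .never) {a : State1 L} {b h : State2 M} (hd : Detour b h)
    {u v u' v' : RBuf M} {x r y x' r' y' : RVal M}
    (hu : ∀ b, Updates (reductionProgram L SF) (conf L SF a b u v x r y)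
      (conf L SF a b u' v' x' r' y'))
    (hw : BWins SF t (conf L SF a b u' v' x' r' y') .B) :
    BWins SF t (conf L SF a b u v x r y) .B := by
  have hbh : Trans2 M b .nop h := by cases hd <;> constructor
  have hhb : Trans2 M h .nop b := by cases hd <;> constructor
  have hhF : Trans2 M h .nop .qF := by cases hd <;> constructor
  refine .of_move (move_B_of_commute ht (hu b) (step_two_nop hbh) (step_two_nop hbh) (hu h)) ?_
  refine .of_forced (step_two_nop hhb) (fun _ _ _ _ _ _ _ _ => .inr hhF) ?_ hw
  intro b' v'' x'' r'' y'' ins ht he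
  cases hd <;> cases ht <;>
    first
    | exact .inr .loopF
    | (obtain ⟨rfl, hm⟩ := he; obtain ⟨rfl, rfl, rfl⟩ := mem3_inj.1 hm; exact .inl rfl)

theorem update_one (a : State1 L) (b : State2 M) (u v : RBuf M) (z : RVar) (e x r y : RVal M) :
    Update (reductionProgram L SF) (conf L SF a b (u ++ [(z, e)]) v x r y)
      (conf L SF a b u v (store z e .xw x) (store z e .xr r) (store z e .y y)) :=
  update_iff.2 (.inl ⟨u, z, e, rfl, rfl⟩)

theorem update_two (a : State1 L) (b : State2 M) (u v : RBuf M) (z : RVar) (e x r y : RVal M) :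
    Update (reductionProgram L SF) (conf L SF a b u (v ++ [(z, e)]) x r y)
      (conf L SF a b u v (store z e .xw x) (store z e .xr r) (store z e .y y)) :=
  update_iff.2 (.inr ⟨v, z, e, rfl, rfl⟩)

theorem not_mem_xr_of_enc {u : RBuf M} {w : List M} {m : RVar → RVal M}
    (hu : u = enc w ∨ u = enc w ++ [(.y, .one)]) : readVal u m .xr = m .xr := by
  apply readVal_eq_mem
  intro e he
  have : e ∈ enc w ∨ e = (.y, .one) := by
    rcases hu with rfl | rfl
    · exact .inl he
    · simpa using he
  rcases this with h | rfl
  · rcases mem_enc h with rfl | ⟨m, rfl⟩ <;> simp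
  · simp

/-- The simulation of a transition that receives the message `m`. -/
theorem BWins.of_recv (ht : t ≠ .never) {s s' : S} {m : M} {w : List M}
    (hL : (s, .recv m, s') ∈ L.trans) (h : BWins SF t (startConf L SF s' w) .B) :
    BWins SF t (startConf L SF s (w ++ [m])) .B := by
  unfold startConf at h ⊢
  rw [enc_concat]
  -- a forced answer of player A for which the first process has no transition at all
  have noStep : ∀ {u : RBuf M} {x y : RVal M}, (u = enc w ∨ u = enc w ++ [(.y, .one)]) →
      ∀ {a' u' x' r' y'} {ins : Instr RVar (RVal M)},
        Trans1 L SF (.aux ⟨_, hL⟩) ins a' →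
        ins.Exec u (mem3 x (.msg m) y) u' (mem3 x' r' y') → False := by
    intro u x y hu a' u' x' r' y' ins ht he
    cases ht
    have := he.1
    rw [not_mem_xr_of_enc hu] at this
    simp at this
  refine .of_detour ht .d1 (fun b => .single (update_one _ b _ _ _ _ _ _ _)) ?_
  refine .of_step (step_two_rd (.t1 m) rfl) ?_
  refine .of_forced (step_two_wr (.tm m)) (fun _ _ _ _ _ _ _ _ => .inr (.emF m)) ?_ ?_
  · intro b' v' x' r' y' ins ht he
    cases ht
    · obtain ⟨rfl, hm⟩ := he; obtain ⟨rfl, rfl, rfl⟩ := mem3_inj.1 hm; exact .inl rfl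
    · exact .inr .loopF
  refine .of_detour ht .d2 (fun b => .single (update_two _ b _ [] _ _ _ _ _)) ?_
  refine .of_step (step_two_mf .t3) ?_
  refine .of_forced (step_two_wr .t4) (fun _ _ _ _ _ _ _ _ => .inr .e4F) ?_ ?_
  · intro b' v' x' r' y' ins ht he
    cases ht
    · obtain ⟨rfl, hm⟩ := he; obtain ⟨rfl, rfl, rfl⟩ := mem3_inj.1 hm; exact .inl rfl
    · exact .inr .loopF
  -- the read of `xr` by the first process commutes with the update of `xw`
  have hr : ∀ x y, readVal (enc w ++ [(.y, .one)]) (mem3 x (.msg m) y) .xr = .msg m :=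
    fun x y => not_mem_xr_of_enc (.inr rfl)
  refine .of_move (move_B_of_commute ht (.single (update_two _ _ _ [] _ _ _ _ _))
    (step_one_rd (.recv1 s s' m hL) (hr _ _)) (step_one_rd (.recv1 s s' m hL) (hr _ _))
    (.single (update_two _ _ _ [] _ _ _ _ _))) ?_
  refine .of_forced (step_two_nop .t5)
    (fun _ _ _ _ _ _ ht he => (noStep (.inr rfl) ht he).elim) ?_ ?_
  · intro b' v' x' r' y' ins ht he
    cases ht
    obtain ⟨rfl, hm⟩ := he; obtain ⟨rfl, rfl, rfl⟩ := mem3_inj.1 hm; exact .inl rfl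
  refine .of_step (step_two_mf .t6) ?_
  refine .of_forced (step_two_rd .t7 rfl)
    (fun _ _ _ _ _ _ ht he => (noStep (.inr rfl) ht he).elim) ?_ ?_
  · intro b' v' x' r' y' ins ht he
    cases ht
    · obtain ⟨-, rfl, hm⟩ := he; obtain ⟨rfl, rfl, rfl⟩ := mem3_inj.1 hm; exact .inl rfl
    · exact absurd he.1 (by simp [readVal, store])
  refine .of_detour ht .d3 (fun b => .single (update_one _ b _ _ _ _ _ _ _)) ?_
  refine .of_step (step_two_rd .t8 rfl) ?_
  refine .of_forced (step_two_wr .t9)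
    (fun _ _ _ _ _ _ ht he => (noStep (.inl rfl) ht he).elim) ?_ ?_
  · intro b' v' x' r' y' ins ht he
    cases ht
    obtain ⟨rfl, hm⟩ := he; obtain ⟨rfl, rfl, rfl⟩ := mem3_inj.1 hm; exact .inl rfl
  refine .of_detour ht .d4 (fun b => .single (update_two _ b _ [] _ _ _ _ _)) ?_
  refine .of_step (step_two_mf .t10) ?_
  refine .of_forced (step_two_rd .t11 rfl)
    (fun _ _ _ _ _ _ ht he => (noStep (.inl rfl) ht he).elim) ?_ ?_
  · intro b' v' x' r' y' ins ht he
    cases ht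
    · obtain ⟨-, rfl, hm⟩ := he; obtain ⟨rfl, rfl, rfl⟩ := mem3_inj.1 hm; exact .inl rfl
    · exact absurd he.1 (by simp [readVal, store])
  refine .of_step (step_two_wr .t12) ?_
  refine .of_forced (step_two_nop .t13)
    (fun _ _ _ _ _ _ ht he => (noStep (.inl rfl) ht he).elim) ?_ ?_
  · intro b' v' x' r' y' ins ht he
    cases ht
    obtain ⟨rfl, hm⟩ := he; obtain ⟨rfl, rfl, rfl⟩ := mem3_inj.1 hm; exact .inl rfl
  refine .of_detour ht .d5 (fun b => .single (update_two _ b _ [] _ _ _ _ _)) ?_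
  refine .of_step (step_two_mf .t14) ?_
  refine .of_forced (step_one_rd (.recv2 s s' m hL) (not_mem_xr_of_enc (.inl rfl))) ?_ ?_ h
  · intro a' u' x' r' y' ins ht he
    cases ht
    obtain ⟨-, rfl, hm⟩ := he; obtain ⟨rfl, rfl, rfl⟩ := mem3_inj.1 hm; exact .inl rfl
  · intro b' v' x' r' y' ins ht he
    cases ht
    case d1 => exact .inr .d1F
    case e1F => exact .inr .loopF
    all_goals exact absurd he.1 (by simp [readVal, store])

/-- After a transition of the channel system that is not a receive, player A can only complete
the simulation of this transition. -/
theorem BWins.of_idle {a : State1 L} {u u' : RBuf M} {s' : S}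
    (hs : ∃ i ins, Step (reductionProgram L SF) (conf L SF a .q1 u [] .bot .bot .zero) i ins
      (conf L SF (.chan s') .q1 u' [] .bot .bot .zero))
    (h₁ : ∀ a' u'' x' r' y' ins, Trans1 L SF a ins a' →
      ins.Exec u (mem3 .bot .bot .zero) u'' (mem3 x' r' y') →
        conf L SF (.chan s') .q1 u' [] .bot .bot .zero =
          conf L SF a' .q1 u'' [] x' r' y')
    (h : BWins SF t (conf L SF (.chan s') .q1 u' [] .bot .bot .zero) .B) :
    BWins SF t (conf L SF a .q1 u [] .bot .bot .zero) .A := by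
  refine .of_forced hs (fun _ _ _ _ _ _ ht he => .inl (h₁ _ _ _ _ _ _ ht he)) ?_ h
  intro b' v' x' r' y' ins ht he
  cases ht
  case d1 => exact .inr .d1F
  case e1F => exact .inr .loopF
  all_goals exact absurd he.1 (by simp [readVal])

theorem BWins.of_nop {s s' : S} {w : List M} (hL : (s, .nop, s') ∈ L.trans)
    (h : BWins SF t (startConf L SF s' w) .B) : BWins SF t (startConf L SF s w) .B := by
  refine .of_step (step_one_nop (.nop1 s s' hL)) (.of_idle (step_one_nop (.nop2 s s' hL)) ?_ h)
  intro a' u'' x' r' y' ins ht he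
  cases ht
  · obtain ⟨rfl, hm⟩ := he; obtain ⟨rfl, rfl, rfl⟩ := mem3_inj.1 hm; rfl
  · have := he.1
    rw [not_mem_xr_of_enc (.inl rfl)] at this
    simp at this

theorem BWins.of_send {s s' : S} {m : M} {w : List M} (hL : (s, .send m, s') ∈ L.trans)
    (h : BWins SF t (startConf L SF s' (m :: w)) .B) : BWins SF t (startConf L SF s w) .B := by
  refine .of_step (step_one_wr (.send1 s s' m hL)) (.of_idle (step_one_wr (.send2 s s' m hL)) ?_ h)
  intro a' u'' x' r' y' ins ht he
  cases ht
  · obtain ⟨rfl, hm⟩ := he; obtain ⟨rfl, rfl, rfl⟩ := mem3_inj.1 hm; rfl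
  · have := he.1
    rw [readVal_eq_mem] at this
    · simp at this
    · intro e he
      rcases List.mem_cons.1 he with rfl | he
      · simp
      · rcases mem_enc he with rfl | ⟨m, rfl⟩ <;> simp

/-- The first process can flush its buffer down to any prefix `u`. -/
theorem updates_enc (a : State1 L) (u : RBuf M) (w : List M) (v : RBuf M) (x r y : RVal M) :
    ∃ x' y', ∀ b, Updates (reductionProgram L SF) (conf L SF a b (u ++ enc w) v x r y)
      (conf L SF a b u v x' r y') := by
  induction w using List.reverseRecOn generalizing x y with
  | nil => exact ⟨x, y, fun b => by simpa [enc] using .refl⟩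
  | append_singleton w m ih =>
    obtain ⟨x', y', h⟩ := ih (.msg m) .one
    refine ⟨x', y', fun b => ?_⟩
    rw [enc_concat, ← List.append_assoc, ← List.append_assoc]
    exact .head (update_one _ _ _ _ _ _ _ _ _) (.head (update_one _ _ _ _ _ _ _ _ _) (h b))

/-- In a final state of the channel system, player B lets the first process write `top`, flushes
its buffer and wins with the second process. -/
theorem BWins.of_final (ht : t ≠ .never) {s : S} {w : List M} (hs : s ∈ SF) :
    BWins SF t (startConf L SF s w) .B := by
  refine .of_step (step_one_wr (.final s hs)) ?_
  have hw : BWins SF t (conf L SF .hF .q1 ((.xw, .top) :: enc w) [] .bot .bot .zero) .B := by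
    have hu : ∃ y', ∀ b, Updates (reductionProgram L SF)
        (conf L SF .hF b ((.xw, .top) :: enc w) [] .bot .bot .zero)
        (conf L SF .hF b [] [] .top .bot y') := by
      obtain ⟨x', y', h⟩ :=
        updates_enc (L := L) (SF := SF) .hF [(.xw, .top)] w [] .bot .bot .zero
      exact ⟨y', fun b => (h b).tail (update_one _ _ [] _ _ _ _ _ _)⟩
    obtain ⟨y', hu⟩ := hu
    refine .of_detour ht .d1 hu ?_
    exact .of_step (step_two_rd .e1F rfl) ⟨0, attr_qF⟩
  refine .of_forced (step_one_nop .loopF) ?_ ?_ hw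
  · intro a' u'' x' r' y' ins ht he
    cases ht
    obtain ⟨rfl, hm⟩ := he; obtain ⟨rfl, rfl, rfl⟩ := mem3_inj.1 hm; exact .inl rfl
  · intro b' v' x' r' y' ins ht he
    cases ht
    case d1 => exact .inr .d1F
    case e1F => exact .inr .loopF
    all_goals exact absurd he.1 (by simp [readVal])

/-- A path in the channel system to a final state yields a win of player B. The induction runs
backwards along the path, hence it keeps the channel contents arbitrary. -/
theorem BWins.of_reachable (ht : t ≠ .never) {s₀ s : S} {w₀ w : List M}
    (h : Relation.ReflTransGen L.Step (s₀, w₀) (s, w)) (hs : s ∈ SF) :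
    BWins SF t (startConf L SF s₀ w₀) .B := by
  suffices ∀ c, Relation.ReflTransGen L.Step c (s, w) → BWins SF t (startConf L SF c.1 c.2) .B from
    this _ h
  intro c h
  induction h using Relation.ReflTransGen.head_induction_on with
  | refl => exact .of_final ht hs
  | head h' _ ih =>
    cases h' with
    | send s s' m w h => exact .of_send h ih
    | recv s s' m w h => exact .of_recv ht h ih
    | nop s s' w h => exact .of_nop h ih

end BSide

/-! ### The invariant of player A -/

section ASide

variable {S M : Type} {L : PCS S M} {SF : Set S} {R : S × List M → Prop}

/-- All values of `xw` in the buffer are messages. -/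
def MsgBuf (u : RBuf M) : Prop := ∀ e ∈ u, (e.1 = .xw → ∃ m, e.2 = .msg m) ∧ e.1 ≠ .xr

/-- All entries of the buffer are of one of the two kinds that encode channel contents. -/
def ChanBuf (u : RBuf M) : Prop :=
  ∀ e ∈ u, (e.1 = .xw → ∃ m, e.2 = .msg m) ∧ e.1 ≠ .xr ∧ (e.1 = .y → e.2 = .one)

theorem ChanBuf.msgBuf {u : RBuf M} (h : ChanBuf u) : MsgBuf u :=
  fun e he => ⟨(h e he).1, (h e he).2.1⟩

theorem chanBuf_enc (w : List M) : ChanBuf (enc w) := by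
  intro e he
  rcases mem_enc he with rfl | ⟨m, rfl⟩ <;> simp

theorem chanBuf_append {u v : RBuf M} : ChanBuf (u ++ v) ↔ ChanBuf u ∧ ChanBuf v :=
  List.forall_mem_append

theorem msgBuf_append {u v : RBuf M} : MsgBuf (u ++ v) ↔ MsgBuf u ∧ MsgBuf v :=
  List.forall_mem_append

theorem MsgBuf.readVal_xr {u : RBuf M} (h : MsgBuf u) (m : RVar → RVal M) :
    readVal u m .xr = m .xr :=
  readVal_eq_mem (fun e he => (h e he).2) m

/-- `Taken R s m u y`: the message `m` has left the channel and not yet been received in the state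
`s`. Either exactly this message has left the buffer `u`, or the value `y = 1` records that player
B has performed too many updates. -/
inductive Taken (R : S × List M → Prop) (s : S) (m : M) : RBuf M → RVal M → Prop
  | fresh (w) (h : R (s, w ++ [m])) : Taken R s m (enc w ++ [(.y, .one)]) .zero
  | stale (u) (h : ChanBuf u) (hs : ∃ w, R (s, w)) : Taken R s m u .one

/-- `Clean R s u x y`: either the buffer `u` encodes a channel content `w` with `R (s, w)` and the
memory is back in its initial state, or a message in `xw` records that player B has performed too
many updates. -/
inductive Clean (R : S × List M → Prop) (s : S) : RBuf M → RVal M → RVal M → Prop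
  | clean (w) (h : R (s, w)) : Clean R s (enc w) .bot .zero
  | spoiled (u m y) (h : MsgBuf u) : Clean R s u (.msg m) y

/-- Like `Clean`, with no condition on the value of `y`. -/
inductive Released (R : S × List M → Prop) (s : S) : RBuf M → RVal M → Prop
  | clean (w) (h : R (s, w)) : Released R s (enc w) .bot
  | spoiled (u m) (h : MsgBuf u) : Released R s u (.msg m)

/-- `Confirm R s u x y`: the second process waits for `y = 1`, which is still in the buffer or has
already arrived. -/
inductive Confirm (R : S × List M → Prop) (s : S) : RBuf M → RVal M → RVal M → Prop
  | pending (w) (h : R (s, w)) : Confirm R s (enc w ++ [(.y, .one)]) .bot .zero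
  | released (u x) (h : Released R s u x) : Confirm R s u x .one
  | spoiled (u m y) (h : MsgBuf u) : Confirm R s u (.msg m) y

theorem Taken.chanBuf {s : S} {m : M} {u : RBuf M} {y : RVal M} (h : Taken R s m u y) :
    ChanBuf u := by
  cases h with
  | fresh w h => exact chanBuf_append.2 ⟨chanBuf_enc w, by simp [ChanBuf]⟩
  | stale u h hs => exact h

theorem Taken.exists_reach {s : S} {m : M} {u : RBuf M} {y : RVal M} (h : Taken R s m u y) :
    ∃ w, R (s, w) := by
  cases h with
  | fresh w h => exact ⟨_, h⟩
  | stale u h hs => exact hs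

theorem Taken.value {s : S} {m : M} {u : RBuf M} {y : RVal M} (h : Taken R s m u y) :
    y = .zero ∨ y = .one := by
  cases h <;> simp

theorem Taken.update {s : S} {m : M} {u : RBuf M} {z : RVar} {e x r y : RVal M}
    (h : Taken R s m (u ++ [(z, e)]) y) :
    store z e .xr r = r ∧ Taken R s m u (store z e .y y) ∧
      (store z e .xw x = x ∨ store z e .y y = .one ∧ ∃ m', store z e .xw x = .msg m') := by
  have hs := h.exists_reach
  have hc := chanBuf_append.1 h.chanBuf
  have hz := hc.2 (z, e) (by simp)
  generalize hu : u ++ [(z, e)] = u₀ at h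
  cases h with
  | fresh w h =>
    obtain ⟨rfl, h₂⟩ := List.append_inj' hu rfl
    simp only [List.cons.injEq, Prod.mk.injEq, and_true] at h₂
    obtain ⟨rfl, rfl⟩ := h₂
    exact ⟨rfl, .stale _ hc.1 hs, .inl rfl⟩
  | stale _ h _ =>
    cases z with
    | xw => exact ⟨rfl, .stale _ hc.1 hs, .inr ⟨rfl, hz.1 rfl⟩⟩
    | xr => exact absurd rfl hz.2.1
    | y =>
      have : e = .one := hz.2.2 rfl
      subst this
      exact ⟨rfl, .stale _ hc.1 hs, .inl rfl⟩

theorem MsgBuf.update {u : RBuf M} {m : M} {z : RVar} {e r : RVal M}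
    (h : MsgBuf (u ++ [(z, e)])) :
    store z e .xr r = r ∧ MsgBuf u ∧ ∃ m', store z e .xw (.msg m) = .msg m' := by
  have hc := msgBuf_append.1 h
  have hz := hc.2 (z, e) (by simp)
  cases z with
  | xw => exact ⟨rfl, hc.1, hz.1 rfl⟩
  | xr => exact absurd rfl hz.2
  | y => exact ⟨rfl, hc.1, m, rfl⟩

theorem update_enc {u : RBuf M} {w : List M} {z : RVar} {e x r y : RVal M}
    (h : u ++ [(z, e)] = enc w) :
    store z e .xr r = r ∧ store z e .y y = y ∧ ChanBuf u ∧
      ∃ w' m, w = w' ++ [m] ∧ u = enc w' ++ [(.y, .one)] ∧ store z e .xw x = .msg m := by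
  obtain ⟨w', m, hw, hu, rfl, rfl⟩ := enc_eq_concat h
  refine ⟨rfl, rfl, ?_, w', m, hw, hu, rfl⟩
  subst hu
  exact chanBuf_append.2 ⟨chanBuf_enc w', by simp [ChanBuf]⟩

theorem Clean.update {s : S} {u : RBuf M} {z : RVar} {e x r y : RVal M}
    (h : Clean R s (u ++ [(z, e)]) x y) :
    store z e .xr r = r ∧ Clean R s u (store z e .xw x) (store z e .y y) := by
  generalize hu : u ++ [(z, e)] = u₀ at h
  cases h with
  | clean w h =>
    obtain ⟨h₁, -, h₃, w', m, -, -, h₄⟩ := update_enc (x := .bot) (r := r) (y := .zero) hu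
    rw [h₄]
    exact ⟨h₁, .spoiled _ _ _ h₃.msgBuf⟩
  | spoiled _ m y h =>
    obtain ⟨h₁, h₂, m', h₃⟩ := MsgBuf.update (m := m) (r := r) (hu ▸ h)
    rw [h₃]
    exact ⟨h₁, .spoiled _ _ _ h₂⟩

theorem Released.update {s : S} {u : RBuf M} {z : RVar} {e x r : RVal M}
    (h : Released R s (u ++ [(z, e)]) x) :
    store z e .xr r = r ∧ Released R s u (store z e .xw x) := by
  generalize hu : u ++ [(z, e)] = u₀ at h
  cases h with
  | clean w h =>
    obtain ⟨h₁, -, h₃, w', m, -, -, h₄⟩ := update_enc (x := .bot) (r := r) (y := .zero) hu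
    rw [h₄]
    exact ⟨h₁, .spoiled _ _ h₃.msgBuf⟩
  | spoiled _ m h =>
    obtain ⟨h₁, h₂, m', h₃⟩ := MsgBuf.update (m := m) (r := r) (hu ▸ h)
    rw [h₃]
    exact ⟨h₁, .spoiled _ _ h₂⟩

theorem Confirm.update {s : S} {u : RBuf M} {z : RVar} {e x r y : RVal M}
    (h : Confirm R s (u ++ [(z, e)]) x y) :
    store z e .xr r = r ∧ Confirm R s u (store z e .xw x) (store z e .y y) := by
  generalize hu : u ++ [(z, e)] = u₀ at h
  cases h with
  | pending w h =>
    obtain ⟨rfl, h₂⟩ := List.append_inj' hu rfl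
    simp only [List.cons.injEq, Prod.mk.injEq, and_true] at h₂
    obtain ⟨rfl, rfl⟩ := h₂
    exact ⟨rfl, .released _ _ (.clean w h)⟩
  | released _ _ h =>
    cases h with
    | clean w h =>
      obtain ⟨h₁, -, h₃, w', m, -, -, h₄⟩ := update_enc (x := .bot) (r := r) (y := .zero) hu
      rw [h₄]
      exact ⟨h₁, .spoiled _ _ _ h₃.msgBuf⟩
    | spoiled _ m h =>
      obtain ⟨h₁, h₂, m', h₃⟩ := MsgBuf.update (m := m) (r := r) (hu ▸ h)
      rw [h₃]
      exact ⟨h₁, .spoiled _ _ _ h₂⟩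
  | spoiled _ m y h =>
    obtain ⟨h₁, h₂, m', h₃⟩ := MsgBuf.update (m := m) (r := r) (hu ▸ h)
    rw [h₃]
    exact ⟨h₁, .spoiled _ _ _ h₂⟩

/-- A condition on the two buffers and the values of `xw`, `xr` and `y`. -/
abbrev Phase (M : Type) := RBuf M → RBuf M → RVal M → RVal M → RVal M → Prop

/-- `Updated u v x r y u' v' x' r' y'`: an update leads from the former buffers and values to the
latter. -/
inductive Updated : RBuf M → RBuf M → RVal M → RVal M → RVal M → Phase M
  | one (u v z e x r y) : Updated (u ++ [(z, e)]) v x r y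
      u v (store z e .xw x) (store z e .xr r) (store z e .y y)
  | two (u v z e x r y) : Updated u (v ++ [(z, e)]) x r y
      u v (store z e .xw x) (store z e .xr r) (store z e .y y)

/-- A phase that no update can end. -/
def Stable (Φ : Phase M) : Prop :=
  ∀ ⦃u v x r y u' v' x' r' y'⦄, Φ u v x r y → Updated u v x r y u' v' x' r' y' → Φ u' v' x' r' y'

theorem append_singleton_eq_singleton {α : Type} {v : List α} {e e' : α} (h : v ++ [e] = [e']) :
    v = [] ∧ e = e' := by
  cases v <;> simp_all

/-- The phase in which the second process is in `q1` and waits for a message. -/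
inductive Idle (R : S × List M → Prop) (s : S) : Phase M
  | clean (w) (h : R (s, w)) : Idle R s (enc w) [] .bot .bot .zero
  | taken (m u y) (h : Taken R s m u y) : Idle R s u [] (.msg m) .bot y

/-- The phase in which the second process has written the message `m` to `xr`. -/
inductive Fetched (R : S × List M → Prop) (s : S) (m : M) : Phase M
  | buffered (u x y) (h : Taken R s m u y) : Fetched R s m u [(.xr, .msg m)] x .bot y
  | visible (u x y) (h : Taken R s m u y) : Fetched R s m u [] x (.msg m) y

/-- The phase in which the second process has written `bot` to `xw`. -/
inductive Reset (R : S × List M → Prop) (s : S) (m : M) : Phase M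
  | buffered (u x y) (h : Taken R s m u y) : Reset R s m u [(.xw, .bot)] x (.msg m) y
  | visible (u x y) (h : Taken R s m u y) (hx : y = .zero → x = .bot) :
      Reset R s m u [] x (.msg m) y

/-- The phase in which the second process waits for `y = 1`. -/
inductive Waiting (R : S × List M → Prop) (s : S) (m : M) : Phase M
  | mk (u x y) (h : Confirm R s u x y) : Waiting R s m u [] x (.msg m) y

/-- The phase in which the second process has read `y = 1` and not yet written `0` to `y`. -/
inductive Seen (R : S × List M → Prop) (s : S) (m : M) : Phase M
  | mk (u x y) (h : Released R s u x) : Seen R s m u [] x (.msg m) y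

/-- The phase in which the second process has written `0` to `y`. -/
inductive Cleared (R : S × List M → Prop) (s : S) (m : M) : Phase M
  | buffered (u x y) (h : Released R s u x) : Cleared R s m u [(.y, .zero)] x (.msg m) y
  | visible (u x y) (h : Clean R s u x y) : Cleared R s m u [] x (.msg m) y

/-- The phase in which the second process has written `bot` to `xr`. -/
inductive Finished (R : S × List M → Prop) (s : S) (m : M) : Phase M
  | buffered (u x y) (h : Clean R s u x y) : Finished R s m u [(.xr, .bot)] x (.msg m) y
  | visible (u x y) (h : Clean R s u x y) : Finished R s m u [] x .bot y

theorem stable_idle (s : S) : Stable (Idle R s) := by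
  rintro _ _ _ _ _ u' v' x' r' y' h ⟨⟩
  case one x r y z e =>
    generalize hu : u' ++ [(z, e)] = u₀ at h
    cases h with
    | clean w h =>
      obtain ⟨h₁, h₂, h₃, w', m, rfl, rfl, h₄⟩ := update_enc (x := .bot) (r := .bot) (y := .zero) hu
      rw [h₁, h₂, h₄]
      exact .taken _ _ _ (.fresh _ h)
    | taken m u y h =>
      subst hu
      obtain ⟨h₁, h₂, h₃⟩ := h.update (x := .msg m) (r := .bot)
      rw [h₁]
      rcases h₃ with h₃ | ⟨h₃, m', h₄⟩
      · rw [h₃]; exact .taken _ _ _ h₂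
      · rw [h₃, h₄]
        exact .taken _ _ _ (.stale _ h₂.chanBuf h₂.exists_reach)
  case two x r y z e =>
    generalize hv : v' ++ [(z, e)] = v₀ at h
    cases h <;> simp at hv

theorem stable_fetched (s : S) (m : M) : Stable (Fetched R s m) := by
  rintro _ _ _ _ _ u' v' x' r' y' h ⟨⟩
  case one x r y z e =>
    cases h with
    | buffered _ _ _ h =>
      obtain ⟨h₁, h₂, -⟩ := h.update (x := x) (r := .bot)
      rw [h₁]; exact .buffered _ _ _ h₂
    | visible _ _ _ h =>
      obtain ⟨h₁, h₂, -⟩ := h.update (x := x) (r := .msg m)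
      rw [h₁]; exact .visible _ _ _ h₂
  case two x r y z e =>
    generalize hv : v' ++ [(z, e)] = v₀ at h
    cases h with
    | buffered _ _ _ h =>
      obtain ⟨rfl, h'⟩ := append_singleton_eq_singleton hv
      cases h'
      exact .visible _ _ _ h
    | visible => simp at hv

theorem stable_reset (s : S) (m : M) : Stable (Reset R s m) := by
  rintro _ _ _ _ _ u' v' x' r' y' h ⟨⟩
  case one x r y z e =>
    cases h with
    | buffered _ _ _ h =>
      obtain ⟨h₁, h₂, -⟩ := h.update (x := x) (r := .msg m)
      rw [h₁]; exact .buffered _ _ _ h₂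
    | visible _ _ _ h hx =>
      obtain ⟨h₁, h₂, h₃⟩ := h.update (x := x) (r := .msg m)
      rw [h₁]
      refine .visible _ _ _ h₂ fun hy => ?_
      rcases h₃ with h₃ | ⟨h₃, -⟩
      · rw [h₃]
        apply hx
        cases z <;> try exact hy
        rcases h.value with h | rfl
        · exact h
        · obtain ⟨-, h₅⟩ := chanBuf_append.1 h.chanBuf
          have := (h₅ _ (List.mem_singleton_self _)).2.2 rfl
          simp only [store, if_true] at hy this
          rw [hy] at this
          cases this
      · rw [hy] at h₃; cases h₃
  case two x r y z e =>
    generalize hv : v' ++ [(z, e)] = v₀ at h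
    cases h with
    | buffered _ _ _ h =>
      obtain ⟨rfl, h'⟩ := append_singleton_eq_singleton hv
      cases h'
      exact .visible _ _ _ h fun _ => rfl
    | visible => simp at hv

theorem stable_waiting (s : S) (m : M) : Stable (Waiting R s m) := by
  rintro _ _ _ _ _ u' v' x' r' y' h ⟨⟩
  case one x r y z e =>
    obtain ⟨_, _, _, h⟩ := h
    obtain ⟨h₁, h₂⟩ := h.update (r := .msg m)
    rw [h₁]; exact .mk _ _ _ h₂
  case two x r y z e =>
    generalize hv : v' ++ [(z, e)] = v₀ at h
    cases h; simp at hv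

theorem stable_seen (s : S) (m : M) : Stable (Seen R s m) := by
  rintro _ _ _ _ _ u' v' x' r' y' h ⟨⟩
  case one x r y z e =>
    obtain ⟨_, _, _, h⟩ := h
    obtain ⟨h₁, h₂⟩ := h.update (r := .msg m)
    rw [h₁]; exact .mk _ _ _ h₂
  case two x r y z e =>
    generalize hv : v' ++ [(z, e)] = v₀ at h
    cases h; simp at hv

theorem stable_cleared (s : S) (m : M) : Stable (Cleared R s m) := by
  rintro _ _ _ _ _ u' v' x' r' y' h ⟨⟩
  case one x r y z e =>
    cases h with
    | buffered _ _ _ h =>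
      obtain ⟨h₁, h₂⟩ := h.update (r := .msg m)
      rw [h₁]; exact .buffered _ _ _ h₂
    | visible _ _ _ h =>
      obtain ⟨h₁, h₂⟩ := h.update (r := .msg m)
      rw [h₁]; exact .visible _ _ _ h₂
  case two x r y z e =>
    generalize hv : v' ++ [(z, e)] = v₀ at h
    cases h with
    | buffered _ _ _ h =>
      obtain ⟨rfl, h'⟩ := append_singleton_eq_singleton hv
      cases h'
      refine .visible _ _ _ ?_
      cases h with
      | clean w h => exact .clean w h
      | spoiled u m h => exact .spoiled _ m _ h
    | visible => simp at hv

theorem stable_finished (s : S) (m : M) : Stable (Finished R s m) := by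
  rintro _ _ _ _ _ u' v' x' r' y' h ⟨⟩
  case one x r y z e =>
    cases h with
    | buffered _ _ _ h =>
      obtain ⟨h₁, h₂⟩ := h.update (r := .msg m)
      rw [h₁]; exact .buffered _ _ _ h₂
    | visible _ _ _ h =>
      obtain ⟨h₁, h₂⟩ := h.update (r := .bot)
      rw [h₁]; exact .visible _ _ _ h₂
  case two x r y z e =>
    generalize hv : v' ++ [(z, e)] = v₀ at h
    cases h with
    | buffered _ _ _ h =>
      obtain ⟨rfl, h'⟩ := append_singleton_eq_singleton hv
      cases h'
      exact .visible _ _ _ h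
    | visible => simp at hv

variable (L R) in
/-- The configurations with player B to move in the plays in which player A follows her
strategy. -/
inductive InvB : State1 L → State2 M → Phase M
  | q1 {s u v x r y} (h : Idle R s u v x r y) : InvB (.chan s) .q1 u v x r y
  | q3 {s m u v x r y} (h : Fetched R s m u v x r y) : InvB (.chan s) .q3 u v x r y
  | q5 {s m u v x r y} (h : Reset R s m u v x r y) : InvB (.chan s) .q5 u v x r y
  | q6 {s s' m} (ht) {u v x r y} (h : Reset R s m u v x r y) :
      InvB (.aux ⟨(s, .recv m, s'), ht⟩) .q6 u v x r y
  | q8 {s s' m} (ht) {u v x r y} (h : Waiting R s' m u v x r y) :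
      InvB (.aux ⟨(s, .recv m, s'), ht⟩) .q8 u v x r y
  | q10 {s s' m} (ht) {u v x r y} (h : Cleared R s' m u v x r y) :
      InvB (.aux ⟨(s, .recv m, s'), ht⟩) .q10 u v x r y
  | q12 {s s' m} (ht) {u x y} (h : Clean R s' u x y) :
      InvB (.aux ⟨(s, .recv m, s'), ht⟩) .q12 u [] x (.msg m) y
  | q14 {s s' m} (ht) {u v x r y} (h : Finished R s' m u v x r y) :
      InvB (.aux ⟨(s, .recv m, s'), ht⟩) .q14 u v x r y
  | hL {u v x r y} : InvB .hL .q5 u v x r y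
  | qL {a u v x r y} : InvB a .qL u v x r y

variable (L SF R) in
/-- The configurations with player A to move in the plays in which she follows her strategy. -/
inductive InvA : State1 L → State2 M → Phase M
  | h1 {s u v x r y} (h : Idle R s u v x r y) : InvA (.chan s) .h1 u v x r y
  | nop {s s' w} (ht) (h : R (s', w)) :
      InvA (.aux ⟨(s, .nop, s'), ht⟩) .q1 (enc w) [] .bot .bot .zero
  | send {s s' m w} (ht) (h : R (s', m :: w)) :
      InvA (.aux ⟨(s, .send m, s'), ht⟩) .q1 ((.xw, .msg m) :: enc w) [] .bot .bot .zero
  | escape {a u m r y} (h : MsgBuf u) : InvA a .q1 u [] (.msg m) r y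
  | qm {s m u x y} (h : Taken R s m u y) : InvA (.chan s) (.qm m) u [] x .bot y
  | q3 {a u v x r y} : InvA a .q3 u v x r y
  | h2 {s m u v x r y} (h : Fetched R s m u v x r y) : InvA (.chan s) .h2 u v x r y
  | q4 {s m u x y} (h : Taken R s m u y) : InvA (.chan s) .q4 u [] x (.msg m) y
  | q5 {s s' m} (ht) {u v x r y} (h : Reset R s m u v x r y) :
      InvA (.aux ⟨(s, .recv m, s'), ht⟩) .q5 u v x r y
  | trap {a m u v x y} (ha : Trans1 L SF a (.rd .xr (.msg m)) .hL)
      (hu : MsgBuf u) (hv : ∀ e ∈ v, e.1 ≠ .xr) : InvA a .q5 u v x (.msg m) y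
  | q6 {a u v x r y} : InvA a .q6 u v x r y
  | q7 {s s' m} (ht) {u x y} (h : Taken R s m u y) (hx : y = .zero → x = .bot) :
      InvA (.aux ⟨(s, .recv m, s'), ht⟩) .q7 u [] x (.msg m) y
  | h3 {s s' m} (ht) {u v x r y} (h : Waiting R s' m u v x r y) :
      InvA (.aux ⟨(s, .recv m, s'), ht⟩) .h3 u v x r y
  | q9 {s s' m} (ht) {u v x r y} (h : Seen R s' m u v x r y) :
      InvA (.aux ⟨(s, .recv m, s'), ht⟩) .q9 u v x r y
  | h4 {s s' m} (ht) {u v x r y} (h : Cleared R s' m u v x r y) :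
      InvA (.aux ⟨(s, .recv m, s'), ht⟩) .h4 u v x r y
  | q11 {s s' m} (ht) {u x y} (h : Clean R s' u x y) :
      InvA (.aux ⟨(s, .recv m, s'), ht⟩) .q11 u [] x (.msg m) y
  | q13 {s s' m} (ht) {u v x r y} (h : Finished R s' m u v x r y) :
      InvA (.aux ⟨(s, .recv m, s'), ht⟩) .q13 u v x r y
  | h5 {s s' m} (ht) {u v x r y} (h : Finished R s' m u v x r y) :
      InvA (.aux ⟨(s, .recv m, s'), ht⟩) .h5 u v x r y
  | q14 {s u x y} (h : Clean R s u x y) : InvA (.chan s) .q14 u [] x .bot y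
  | q1 {s s' m} (ht) {u x y} (h : Clean R s' u x y) :
      InvA (.aux ⟨(s, .recv m, s'), ht⟩) .q1 u [] x .bot y
  | hL {u v x r y} : InvA .hL .q5 u v x r y
  | qL {a u v x r y} : InvA a .qL u v x r y

/-- `Clean` as a phase: the second buffer is empty, and `xr` has the value `r`. -/
inductive CleanPhase (R : S × List M → Prop) (s : S) (r : RVal M) : Phase M
  | mk {u x y} (h : Clean R s u x y) : CleanPhase R s r u [] x r y

theorem stable_clean (s : S) (r : RVal M) : Stable (CleanPhase R s r) := by
  rintro _ _ _ _ _ u' v' x' r' y' h ⟨⟩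
  case one x _ y z e =>
    obtain ⟨h⟩ := h
    obtain ⟨h₁, h₂⟩ := h.update (r := r)
    rw [h₁]; exact .mk h₂
  case two x r y z e =>
    generalize hv : v' ++ [(z, e)] = v₀ at h
    cases h; simp at hv

/-- `Taken` as a phase: the second buffer is empty, and `xr` has the value `r`. -/
inductive TakenPhase (R : S × List M → Prop) (s : S) (m : M) (r : RVal M) : Phase M
  | mk {u x y} (h : Taken R s m u y) : TakenPhase R s m r u [] x r y

theorem stable_taken (s : S) (m : M) (r : RVal M) : Stable (TakenPhase R s m r) := by
  rintro _ _ _ _ _ u' v' x' r' y' h ⟨⟩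
  case one x _ y z e =>
    obtain ⟨h⟩ := h
    obtain ⟨h₁, h₂, -⟩ := h.update (x := x) (r := r)
    rw [h₁]; exact .mk h₂
  case two x r y z e =>
    generalize hv : v' ++ [(z, e)] = v₀ at h
    cases h; simp at hv

theorem stable_invB (a : State1 L) (b : State2 M) : Stable (InvB L R a b) := by
  intro u v x r y u' v' x' r' y' h hu
  cases h with
  | q1 h => exact .q1 (stable_idle _ h hu)
  | q3 h => exact .q3 (stable_fetched _ _ h hu)
  | q5 h => exact .q5 (stable_reset _ _ h hu)
  | q6 ht h => exact .q6 ht (stable_reset _ _ h hu)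
  | q8 ht h => exact .q8 ht (stable_waiting _ _ h hu)
  | q10 ht h => exact .q10 ht (stable_cleared _ _ h hu)
  | q12 ht h =>
    obtain ⟨h'⟩ := stable_clean _ _ (.mk h) hu
    exact .q12 ht h'
  | q14 ht h => exact .q14 ht (stable_finished _ _ h hu)
  | hL => exact .hL
  | qL => exact .qL

theorem stable_escape (a : State1 L) {u v u' v' : RBuf M} {x r y x' r' y' : RVal M} {m : M}
    (hv : v = []) (hx : x = .msg m) (hb : MsgBuf u) (h : Updated u v x r y u' v' x' r' y') :
    InvA L SF R a .q1 u' v' x' r' y' := by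
  cases h with
  | one _ _ z e _ _ _ =>
    subst hv hx
    obtain ⟨h₁, h₂, m', h₃⟩ := MsgBuf.update (m := m) (r := r) hb
    rw [h₃]
    exact .escape h₂
  | two => simp at hv

theorem stable_invA (a : State1 L) (b : State2 M) : Stable (InvA L SF R a b) := by
  intro u v x r y u' v' x' r' y' h hu
  cases h with
  | h1 h => exact .h1 (stable_idle _ h hu)
  | nop ht h =>
    generalize hu₀ : enc _ = u₀ at hu
    generalize hv₀ : [] = v₀ at hu
    cases hu with
    | one _ _ z e =>
      subst hv₀
      obtain ⟨h₁, h₂, h₃, w', m, rfl, rfl, h₄⟩ :=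
        update_enc (x := .bot) (r := .bot) (y := .zero) hu₀.symm
      rw [h₄]
      exact .escape h₃.msgBuf
    | two => simp at hv₀
  | @send s s' m w ht h =>
    have hb : MsgBuf ((.xw, .msg m) :: enc w) :=
      List.forall_mem_cons.2 ⟨by simp, (chanBuf_enc w).msgBuf⟩
    generalize hu₀ : _ :: enc _ = u₀ at hu hb
    generalize hv₀ : [] = v₀ at hu
    cases hu with
    | one _ _ z e =>
      subst hv₀
      have hz : z = .xw := by
        rcases List.eq_nil_or_concat w with rfl | ⟨w', m', rfl⟩
        · obtain ⟨-, h⟩ := append_singleton_eq_singleton hu₀.symm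
          cases h; rfl
        · rw [List.concat_eq_append, enc_concat, ← List.cons_append] at hu₀
          obtain ⟨-, h⟩ := List.append_inj' hu₀ rfl
          cases h; rfl
      subst hz
      obtain ⟨hb', he⟩ := msgBuf_append.1 hb
      obtain ⟨m', rfl⟩ := (he _ (List.mem_singleton_self _)).1 rfl
      exact .escape hb'
    | two => simp at hv₀
  | escape h => exact stable_escape a rfl rfl h hu
  | qm h =>
    obtain ⟨h'⟩ := stable_taken _ _ _ (.mk h) hu
    exact .qm h'
  | q3 => exact .q3
  | h2 h => exact .h2 (stable_fetched _ _ h hu)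
  | q4 h =>
    obtain ⟨h'⟩ := stable_taken _ _ _ (.mk h) hu
    exact .q4 h'
  | q5 ht h => exact .q5 ht (stable_reset _ _ h hu)
  | @trap _ m _ _ _ _ ha h hv =>
    cases hu with
    | one _ _ z e =>
      obtain ⟨h₁, h₂, -⟩ := MsgBuf.update (m := m) (r := .msg m) h
      rw [h₁]
      exact .trap ha h₂ hv
    | two _ _ z e =>
      rw [List.forall_mem_append] at hv
      have hz : z ≠ .xr := hv.2 _ (List.mem_singleton_self _)
      have : store z e .xr (.msg m) = .msg m := if_neg hz
      rw [this]
      exact .trap ha h hv.1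
  | q6 => exact .q6
  | @q7 _ _ m _ _ x y h hx =>
    generalize hv : [] = v₀ at hu
    have h' := stable_reset _ _ (.visible _ _ _ h hx) (hv ▸ hu)
    cases hu with
    | one =>
      subst hv
      obtain ⟨h₁, -⟩ := h.update (x := x) (r := .msg m)
      rw [h₁] at h' ⊢
      cases h' with
      | visible _ _ _ h hx => exact .q7 _ h hx
    | two => simp at hv
  | h3 ht h => exact .h3 ht (stable_waiting _ _ h hu)
  | q9 ht h => exact .q9 ht (stable_seen _ _ h hu)
  | h4 ht h => exact .h4 ht (stable_cleared _ _ h hu)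
  | q11 ht h =>
    obtain ⟨h'⟩ := stable_clean _ _ (.mk h) hu
    exact .q11 ht h'
  | q13 ht h => exact .q13 ht (stable_finished _ _ h hu)
  | h5 ht h => exact .h5 ht (stable_finished _ _ h hu)
  | q14 h =>
    obtain ⟨h'⟩ := stable_clean _ _ (.mk h) hu
    exact .q14 h'
  | q1 ht h =>
    obtain ⟨h'⟩ := stable_clean _ _ (.mk h) hu
    exact .q1 ht h'
  | hL => exact .hL
  | qL => exact .qL

end ASide

/-! ### Player A keeps the invariant -/

section ASide

variable {S M : Type} {L : PCS S M} {SF : Set S} {R : S × List M → Prop}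

/-- The invariant on a configuration, as a predicate on the flat representation. -/
def OnConf (Φ : State1 L → State2 M → Phase M) (c : Config (reductionProgram L SF)) : Prop :=
  ∃ a b u v x r y, c = conf L SF a b u v x r y ∧ Φ a b u v x r y

theorem OnConf.updates {Φ : State1 L → State2 M → Phase M} (hΦ : ∀ a b, Stable (Φ a b))
    {c c' : Config (reductionProgram L SF)} (h : OnConf Φ c)
    (hu : Updates (reductionProgram L SF) c c') : OnConf Φ c' := by
  induction hu with
  | refl => exact h
  | tail _ hu ih =>
    obtain ⟨a, b, u, v, x, r, y, rfl, h⟩ := ih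
    rcases update_iff.1 hu with ⟨u', z, e, rfl, rfl⟩ | ⟨v', z, e, rfl, rfl⟩
    · exact ⟨_, _, _, _, _, _, _, rfl, hΦ a b h (.one _ _ _ _ _ _ _)⟩
    · exact ⟨_, _, _, _, _, _, _, rfl, hΦ a b h (.two _ _ _ _ _ _ _)⟩

theorem readVal_nil (m : RVar → RVal M) (z : RVar) : readVal [] m z = m z := rfl

theorem Reset.msgBuf {s : S} {m : M} {u v : RBuf M} {x r y : RVal M}
    (h : Reset R s m u v x r y) : MsgBuf u ∧ r = .msg m ∧ ∀ e ∈ v, e.1 ≠ .xr := by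
  cases h with
  | buffered _ _ _ h => exact ⟨h.chanBuf.msgBuf, rfl, by simp⟩
  | visible _ _ _ h => exact ⟨h.chanBuf.msgBuf, rfl, by simp⟩

theorem Reset.exists_reach {s : S} {m : M} {u v : RBuf M} {x r y : RVal M}
    (h : Reset R s m u v x r y) : ∃ w, R (s, w) := by
  cases h with
  | buffered _ _ _ h => exact h.exists_reach
  | visible _ _ _ h => exact h.exists_reach

theorem Clean.msgBuf {s : S} {u : RBuf M} {x y : RVal M} (h : Clean R s u x y) : MsgBuf u := by
  cases h with
  | clean w h => exact (chanBuf_enc w).msgBuf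
  | spoiled _ m _ h => exact h

theorem Released.msgBuf {s : S} {u : RBuf M} {x : RVal M} (h : Released R s u x) : MsgBuf u := by
  cases h with
  | clean w h => exact (chanBuf_enc w).msgBuf
  | spoiled _ m h => exact h

theorem Confirm.msgBuf {s : S} {u : RBuf M} {x y : RVal M} (h : Confirm R s u x y) :
    MsgBuf u := by
  cases h with
  | pending w h => exact msgBuf_append.2 ⟨(chanBuf_enc w).msgBuf, by simp [MsgBuf]⟩
  | released _ _ h => exact h.msgBuf
  | spoiled _ m _ h => exact h

/-- While `xr` holds a message, the first process cannot complete a receive. -/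
theorem no_step_recv {t : S × ChanOp M × S} {m' : M} (hm : t.2.1 = .recv m') {ht : t ∈ L.trans}
    {u u' : RBuf M} {x r y : RVal M} {m : M} {mem' : RVar → RVal M} (hu : MsgBuf u)
    (hr : r = .msg m) {a' : State1 L} {ins : Instr RVar (RVal M)}
    (h : Trans1 L SF (.aux ⟨t, ht⟩) ins a') (he : ins.Exec u (mem3 x r y) u' mem') :
    False := by
  subst hr
  cases h
  case recv2 =>
    have := he.1
    rw [hu.readVal_xr] at this
    simp at this
  all_goals simp at hm

/-- Whatever player B does, player A keeps her invariant. -/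
theorem InvB.step (hR : ∀ c c', R c → L.Step c c' → R c') (hF : ∀ s ∈ SF, ∀ w, ¬ R (s, w))
    {a : State1 L} {b : State2 M} {u v : RBuf M} {x r y : RVal M} (h : InvB L R a b u v x r y)
    {i ins c'} (hs : Step (reductionProgram L SF) (conf L SF a b u v x r y) i ins c') :
    OnConf (InvA L SF R) c' := by
  cases i with
  | one =>
    obtain ⟨a', u', x', r', y', ht, he, rfl⟩ := step_one_iff.1 hs
    refine ⟨_, _, _, _, _, _, _, rfl, ?_⟩
    cases h with
    | q1 h =>
      cases ht with
      | nop1 s s' hL =>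
        obtain ⟨rfl, hm⟩ := he
        obtain ⟨rfl, rfl, rfl⟩ := mem3_inj.1 hm
        cases h with
        | clean w h => exact .nop hL (hR _ _ h (.nop _ _ _ hL))
        | taken m _ _ h => exact .escape h.chanBuf.msgBuf
      | send1 s s' m hL =>
        obtain ⟨rfl, hm⟩ := he
        obtain ⟨rfl, rfl, rfl⟩ := mem3_inj.1 hm
        cases h with
        | clean w h => exact .send hL (hR _ _ h (.send _ _ _ _ hL))
        | taken m _ _ h =>
          exact .escape (List.forall_mem_cons.2 ⟨by simp, h.chanBuf.msgBuf⟩)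
      | recv1 s s' m hL =>
        have := he.1
        cases h with
        | clean w h => simp [(chanBuf_enc w).msgBuf.readVal_xr] at this
        | taken m _ _ h => simp [h.chanBuf.msgBuf.readVal_xr] at this
      | final _ hsF =>
        cases h with
        | clean w h => exact absurd h (hF _ hsF _)
        | taken m _ _ h => exact absurd h.exists_reach.choose_spec (hF _ hsF _)
    | q3 h => exact .q3
    | q5 h =>
      obtain ⟨h₁, rfl, h₂⟩ := h.msgBuf
      cases ht with
      | nop1 s s' hL =>
        obtain ⟨rfl, hm⟩ := he
        obtain ⟨rfl, rfl, rfl⟩ := mem3_inj.1 hm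
        exact .trap (.nopL _ _ hL _) h₁ h₂
      | send1 s s' m hL =>
        obtain ⟨rfl, hm⟩ := he
        obtain ⟨rfl, rfl, rfl⟩ := mem3_inj.1 hm
        exact .trap (.sendL _ _ _ hL _) (List.forall_mem_cons.2 ⟨by simp, h₁⟩) h₂
      | recv1 s s' m hL =>
        obtain ⟨hr, rfl, hm⟩ := he
        obtain ⟨rfl, rfl, rfl⟩ := mem3_inj.1 hm
        rw [h₁.readVal_xr] at hr
        cases hr
        exact .q5 hL h
      | final _ hsF => exact absurd h.exists_reach.choose_spec (hF _ hsF _)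
    | q6 ht' h =>
      obtain ⟨h₁, h₂, -⟩ := h.msgBuf
      exact (no_step_recv rfl h₁ h₂ ht he).elim
    | q8 ht' h =>
      obtain ⟨_, _, _, h⟩ := h
      exact (no_step_recv rfl h.msgBuf rfl ht he).elim
    | q10 ht' h =>
      cases h with
      | buffered _ _ _ h => exact (no_step_recv rfl h.msgBuf rfl ht he).elim
      | visible _ _ _ h => exact (no_step_recv rfl h.msgBuf rfl ht he).elim
    | q12 ht' h => exact (no_step_recv rfl h.msgBuf rfl ht he).elim
    | q14 ht' h =>
      cases h with
      | buffered _ _ _ h => exact (no_step_recv rfl h.msgBuf rfl ht he).elim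
      | visible _ _ _ h =>
        cases ht
        obtain ⟨-, rfl, hm⟩ := he
        obtain ⟨rfl, rfl, rfl⟩ := mem3_inj.1 hm
        exact .q14 h
    | hL =>
      cases ht
      exact .hL
    | qL => exact .qL
  | two =>
    obtain ⟨b', v', x', r', y', ht, he, rfl⟩ := step_two_iff.1 hs
    refine ⟨_, _, _, _, _, _, _, rfl, ?_⟩
    cases h with
    | q1 h =>
      cases ht with
      | t1 m =>
        obtain ⟨hr, rfl, hm⟩ := he
        obtain ⟨rfl, rfl, rfl⟩ := mem3_inj.1 hm
        cases h with
        | clean w h => simp [readVal_nil] at hr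
        | taken m' _ _ h =>
          simp only [readVal_nil, mem3_xw, RVal.msg.injEq] at hr
          subst hr
          exact .qm h
      | d1 =>
        obtain ⟨rfl, hm⟩ := he
        obtain ⟨rfl, rfl, rfl⟩ := mem3_inj.1 hm
        exact .h1 h
      | e1L m => exact .qL
      | e1F =>
        have := he.1
        cases h <;> simp [readVal_nil] at this
    | q3 h =>
      cases ht with
      | t3 =>
        obtain ⟨rfl, rfl, hm⟩ := he
        obtain ⟨rfl, rfl, rfl⟩ := mem3_inj.1 hm
        cases h with
        | visible _ _ _ h => exact .q4 h
      | d2 =>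
        obtain ⟨rfl, hm⟩ := he
        obtain ⟨rfl, rfl, rfl⟩ := mem3_inj.1 hm
        exact .h2 h
      | e3L => exact .qL
    | q5 h => cases ht; exact .q6
    | q6 hL h =>
      cases ht with
      | t6 =>
        obtain ⟨rfl, rfl, hm⟩ := he
        obtain ⟨rfl, rfl, rfl⟩ := mem3_inj.1 hm
        cases h with
        | visible _ _ _ h hx => exact .q7 hL h hx
      | e6L => exact .qL
    | q8 hL h =>
      cases ht with
      | t8 =>
        obtain ⟨hr, rfl, hm⟩ := he
        obtain ⟨rfl, rfl, rfl⟩ := mem3_inj.1 hm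
        obtain ⟨_, _, _, h⟩ := h
        simp only [readVal_nil, mem3_y] at hr
        subst hr
        generalize hy : RVal.one = y at h
        cases h with
        | pending => simp at hy
        | released _ _ h => exact .q9 hL (.mk _ _ _ h)
        | spoiled _ m _ h => exact .q9 hL (.mk _ _ _ (.spoiled _ _ h))
      | d3 =>
        obtain ⟨rfl, hm⟩ := he
        obtain ⟨rfl, rfl, rfl⟩ := mem3_inj.1 hm
        exact .h3 hL h
    | q10 hL h =>
      cases ht with
      | t10 =>
        obtain ⟨rfl, rfl, hm⟩ := he
        obtain ⟨rfl, rfl, rfl⟩ := mem3_inj.1 hm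
        cases h with
        | visible _ _ _ h => exact .q11 hL h
      | d4 =>
        obtain ⟨rfl, hm⟩ := he
        obtain ⟨rfl, rfl, rfl⟩ := mem3_inj.1 hm
        exact .h4 hL h
    | q12 hL h =>
      cases ht
      obtain ⟨rfl, hm⟩ := he
      obtain ⟨rfl, rfl, rfl⟩ := mem3_inj.1 hm
      exact .q13 hL (.buffered _ _ _ h)
    | q14 hL h =>
      cases ht with
      | t14 =>
        obtain ⟨rfl, rfl, hm⟩ := he
        obtain ⟨rfl, rfl, rfl⟩ := mem3_inj.1 hm
        cases h with
        | visible _ _ _ h => exact .q1 hL h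
      | d5 =>
        obtain ⟨rfl, hm⟩ := he
        obtain ⟨rfl, rfl, rfl⟩ := mem3_inj.1 hm
        exact .h5 hL h
      | e14L m => exact .qL
    | hL =>
      cases ht
      exact .q6
    | qL =>
      cases ht
      exact .qL

/-- Player A always has a move that keeps her invariant. -/
theorem InvA.exists_step (hR : ∀ c c', R c → L.Step c c' → R c') {a : State1 L} {b : State2 M}
    {u v : RBuf M} {x r y : RVal M}
    (h : InvA L SF R a b u v x r y) :
    ∃ c', (∃ i ins, Step (reductionProgram L SF) (conf L SF a b u v x r y) i ins c') ∧
      OnConf (InvB L R) c' := by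
  have key : ∀ {a b u v x r y a' b' u' v' x' r' y'},
      (∃ i ins, Step (reductionProgram L SF) (conf L SF a b u v x r y) i ins
        (conf L SF a' b' u' v' x' r' y')) → InvB L R a' b' u' v' x' r' y' →
      ∃ c', (∃ i ins, Step (reductionProgram L SF) (conf L SF a b u v x r y) i ins c') ∧
        OnConf (InvB L R) c' :=
    fun hs h => ⟨_, hs, _, _, _, _, _, _, _, rfl, h⟩
  cases h with
  | h1 h => exact key (step_two_nop .d1') (.q1 h)
  | nop ht h => exact key (step_one_nop (.nop2 _ _ ht)) (.q1 (.clean _ h))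
  | send ht h => exact key (step_one_wr (.send2 _ _ _ ht)) (.q1 (.clean (_ :: _) h))
  | escape h => exact key (step_two_rd (.e1L _) rfl) .qL
  | qm h => exact key (step_two_wr (.tm _)) (.q3 (.buffered _ _ _ h))
  | q3 => exact key (step_two_nop .e3L) .qL
  | h2 h => exact key (step_two_nop .d2') (.q3 h)
  | q4 h => exact key (step_two_wr .t4) (.q5 (.buffered _ _ _ h))
  | q5 ht h => exact key (step_two_nop .t5) (.q6 ht h)
  | trap ha hu hv => exact key (step_one_rd ha (hu.readVal_xr _)) .hL
  | q6 => exact key (step_two_nop .e6L) .qL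
  | q7 ht h hx =>
    cases h with
    | fresh w h =>
      obtain rfl := hx rfl
      exact key (step_two_rd .t7 rfl) (.q8 ht (.mk _ _ _ (.pending w (hR _ _ h (.recv _ _ _ _ ht)))))
    | stale => exact key (step_two_rd .e7L rfl) .qL
  | h3 ht h => exact key (step_two_nop .d3') (.q8 ht h)
  | q9 ht h =>
    obtain ⟨_, _, _, h⟩ := h
    exact key (step_two_wr .t9) (.q10 ht (.buffered _ _ _ h))
  | h4 ht h => exact key (step_two_nop .d4') (.q10 ht h)
  | q11 ht h =>
    cases h with
    | clean w h => exact key (step_two_rd .t11 rfl) (.q12 ht (.clean w h))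
    | spoiled _ m _ h => exact key (step_two_rd (.e11L m) rfl) .qL
  | q13 ht h => exact key (step_two_nop .t13) (.q14 ht h)
  | h5 ht h => exact key (step_two_nop .d5') (.q14 ht h)
  | q14 h =>
    cases h with
    | clean w h => exact key (step_two_mf .t14) (.q1 (.clean w h))
    | spoiled _ m _ h => exact key (step_two_rd (.e14L m) rfl) .qL
  | q1 ht h =>
    cases h with
    | clean w h =>
      exact key (step_one_rd (.recv2 _ _ _ ht) ((chanBuf_enc w).msgBuf.readVal_xr _))
        (.q1 (.clean w h))
    | spoiled _ m _ h => exact key (step_two_rd (.e1L m) rfl) .qL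
  | hL => exact key (step_one_nop .loopL) .hL
  | qL => exact key (step_two_nop .loopL) .qL

/-- Player B always has a move, so that no play gets stuck inside the invariant. -/
theorem InvB.exists_step {a : State1 L} {b : State2 M} {u v : RBuf M} {x r y : RVal M}
    (h : InvB L R a b u v x r y) :
    ∃ c', ∃ i ins, Step (reductionProgram L SF) (conf L SF a b u v x r y) i ins c' := by
  cases h with
  | q1 => exact ⟨_, step_two_nop .d1⟩
  | q3 => exact ⟨_, step_two_nop .d2⟩
  | q5 => exact ⟨_, step_two_nop .t5⟩
  | q6 => exact ⟨_, step_two_nop .e6L⟩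
  | q8 => exact ⟨_, step_two_nop .d3⟩
  | q10 => exact ⟨_, step_two_nop .d4⟩
  | q12 => exact ⟨_, step_two_wr .t12⟩
  | q14 => exact ⟨_, step_two_nop .d5⟩
  | hL => exact ⟨_, step_two_nop .t5⟩
  | qL => exact ⟨_, step_two_nop .loopL⟩

variable (L SF) in
/-- The set of configurations in which player A stays if no final state of the channel system is
reachable. -/
def safeSet (R : S × List M → Prop) (t : Timing) : Set (reductionGame L SF t).Conf :=
  {c | match c.2 with
    | .A => OnConf (InvA L SF R) c.1
    | .B => OnConf (InvB L R) c.1}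

theorem trap_safeSet (hR : ∀ c c', R c → L.Step c c' → R c') (hF : ∀ s ∈ SF, ∀ w, ¬ R (s, w))
    (t : Timing) : (reductionGame L SF t).Trap (safeSet L SF R t) where
  not_final := by
    rintro ⟨c, p⟩ hc ⟨hp, i, hi⟩
    obtain rfl : p = .A := hp
    obtain ⟨a, b, u, v, x, r, y, rfl, h⟩ := hc
    cases i with
    | one => exact hi
    | two =>
      obtain rfl : b = .qF := hi
      cases h
  moveA := by
    rintro ⟨c, p⟩ hc hp
    obtain rfl : p = .A := hp
    obtain ⟨a, b, u, v, x, r, y, rfl, h⟩ := hc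
    obtain ⟨c', hs, hc'⟩ := h.exists_step hR
    exact ⟨(c', .B), hc', move_A_iff.2 ⟨rfl, hs⟩⟩
  existsB := by
    rintro ⟨c, p⟩ hc hp
    obtain rfl : p = .B := hp
    obtain ⟨a, b, u, v, x, r, y, rfl, h⟩ := hc
    obtain ⟨c', hs⟩ := h.exists_step (SF := SF)
    exact ⟨(c', .A), move_B_of_step hs⟩
  moveB := by
    rintro ⟨c, p⟩ hc hp ⟨c', p'⟩ hm
    obtain rfl : p = .B := hp
    obtain ⟨rfl, c₁, c₂, h₁, ⟨i, ins, h₂⟩, h₃⟩ := move_B_cases hm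
    obtain ⟨a, b, u, v, x, r, y, rfl, h⟩ := OnConf.updates stable_invB hc h₁
    exact (h.step hR hF h₂).updates stable_invA h₃

/-- The configurations of the channel system that are reachable from `c₀`. -/
def PCS.ReachSet (L : PCS S M) (c₀ c : S × List M) : Prop := Relation.ReflTransGen L.Step c₀ c

theorem startConf_mem_safeSet (s : S) (w : List M) (t : Timing) :
    ((startConf L SF s w, .B) : Config (reductionProgram L SF) × Player) ∈
      safeSet L SF (L.ReachSet (s, w)) t :=
  ⟨_, _, _, _, _, _, _, rfl, .q1 (.clean w .refl)⟩

/-- The simulation is correct, for every initial channel content. -/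
theorem reaches_iff_winningB {s₀ : S} {w₀ : List M} {t : Timing} (ht : t ≠ .never) :
    (∃ s ∈ SF, ∃ w, Relation.ReflTransGen L.Step (s₀, w₀) (s, w)) ↔
      (reductionGame L SF t).WinningB (startConf L SF s₀ w₀, .B) := by
  constructor
  · rintro ⟨s, hs, w, h⟩
    obtain ⟨n, hn⟩ := BWins.of_reachable ht h hs
    exact hn.winningB
  · intro hB
    by_contra hne
    push Not at hne
    exact hB.not_winningA
      ((trap_safeSet (R := L.ReachSet (s₀, w₀)) (fun c c' h h' => h.tail h') hne t).winningA
        (startConf_mem_safeSet s₀ w₀ t))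

end ASide

/-! ### Programs in which a player can resign -/

section Resign

/-- The additional local states of a process that can resign. -/
inductive Resign
  | resigned
  | wonA
  | wonB

variable {I X V : Type} [DecidableEq I] [DecidableEq X]

/-- The transitions of the processes of `P` if the process `i₀` can resign in each of its states.
Whoever resigns loses: the opponent can move on to `wonA` or `wonB`. -/
inductive ResignTrans (P : Program I X V) (i₀ : I) :
    ∀ i, P.State i ⊕ Resign → Instr X V → P.State i ⊕ Resign → Prop
  | old {i q a q'} (h : P.trans i q a q') : ResignTrans P i₀ i (.inl q) a (.inl q')
  | resign (q) : ResignTrans P i₀ i₀ (.inl q) .nop (.inr .resigned)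
  | claimA : ResignTrans P i₀ i₀ (.inr .resigned) .nop (.inr .wonA)
  | claimB : ResignTrans P i₀ i₀ (.inr .resigned) .nop (.inr .wonB)
  | loopA : ResignTrans P i₀ i₀ (.inr .wonA) .nop (.inr .wonA)
  | loopB : ResignTrans P i₀ i₀ (.inr .wonB) .nop (.inr .wonB)

instance : Finite Resign :=
  Finite.of_surjective (fun k : Fin 3 => match k with
    | 0 => Resign.resigned
    | 1 => .wonA
    | 2 => .wonB) (by rintro (_ | _ | _); exacts [⟨0, rfl⟩, ⟨1, rfl⟩, ⟨2, rfl⟩])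

/-- The program `P` with the additional possibility to resign by a move of the process `i₀`. -/
def resignProgram (P : Program I X V) (i₀ : I) : Program I X V where
  State i := P.State i ⊕ Resign
  trans := ResignTrans P i₀
  finite_proc := P.finite_proc
  finite_var := P.finite_var
  finite_val := P.finite_val
  finite_state i := by have := P.finite_state i; infer_instance

/-- The final local states of `P`, together with `wonB`. -/
def resignFinal (P : Program I X V) (i₀ : I) (F : ∀ i, Set (P.State i)) :
    ∀ i, Set ((resignProgram P i₀).State i) :=
  fun i => {q | match q with
    | .inl q => q ∈ F i
    | .inr .wonB => i = i₀
    | .inr _ => False}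

variable {P : Program I X V} {i₀ : I}

/-- A configuration of `P` as a configuration of the program in which one can resign. -/
def resignConf (P : Program I X V) (i₀ : I) (c : Config P) : Config (resignProgram P i₀) where
  state i := .inl (c.state i)
  buf := c.buf
  mem := c.mem

omit [DecidableEq X] in
theorem resignConf_mk (c : Config P) (i : I) (q : P.State i) (b : I → List (X × V)) (m : X → V) :
    (⟨Function.update (resignConf P i₀ c).state i (.inl q), b, m⟩ : Config (resignProgram P i₀)) =
      resignConf P i₀ ⟨Function.update c.state i q, b, m⟩ :=
  congrArg (fun s => (⟨s, b, m⟩ : Config (resignProgram P i₀)))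
    (funext fun j => (Function.apply_update (fun i (q : P.State i) => (.inl q : P.State i ⊕ Resign))
      c.state i q j).symm)

theorem resignConf_step {c : Config P} {i : I} {a : Instr X V}
    {d : Config (resignProgram P i₀)} (h : Step (resignProgram P i₀) (resignConf P i₀ c) i a d) :
    (∃ c', d = resignConf P i₀ c' ∧ Step P c i a c') ∨ d.state i₀ = .inr .resigned := by
  obtain ⟨q, b', m', ht, he, rfl⟩ := step_iff.1 h
  generalize hq : (resignConf P i₀ c).state i = q₀ at ht
  cases ht with
  | @old i q a q' ht =>
    left
    cases hq
    exact ⟨⟨Function.update c.state i q', Function.update c.buf i b', m'⟩, resignConf_mk _ _ _ _ _,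
      step_iff.2 ⟨q', b', m', ht, he, rfl⟩⟩
  | resign => exact .inr (Function.update_self _ _ _)
  | _ => cases hq

theorem Step.resignConf {c c' : Config P} {i : I} {a : Instr X V} (h : Step P c i a c') :
    Step (resignProgram P i₀) (resignConf P i₀ c) i a (resignConf P i₀ c') := by
  obtain ⟨q, b', m', ht, he, rfl⟩ := step_iff.1 h
  exact step_iff.2 ⟨.inl q, b', m', .old ht, he, (resignConf_mk _ _ _ _ _).symm⟩

theorem resignConf_updates {c : Config P} {d : Config (resignProgram P i₀)}
    (h : Updates (resignProgram P i₀) (resignConf P i₀ c) d) :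
    ∃ c', d = resignConf P i₀ c' ∧ Updates P c c' := by
  induction h with
  | refl => exact ⟨c, rfl, .refl⟩
  | tail _ h ih =>
    obtain ⟨c', rfl, hc⟩ := ih
    obtain ⟨i, w, x, v, hb⟩ := h
    exact ⟨_, rfl, hc.tail (.mk c' i w x v hb)⟩

theorem Updates.resignConf {c c' : Config P} (h : Updates P c c') :
    Updates (resignProgram P i₀) (resignConf P i₀ c) (resignConf P i₀ c') := by
  induction h with
  | refl => exact .refl
  | @tail c₁ _ _ h ih =>
    obtain ⟨i, w, x, v, hb⟩ := h
    exact ih.tail (.mk (TSO.resignConf P i₀ c₁) i w x v hb)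

theorem Updates.state_eq {c c' : Config P} (h : Updates P c c') : c'.state = c.state := by
  induction h with
  | refl => rfl
  | tail _ h ih => obtain ⟨i, w, x, v, hb⟩ := h; exact ih

theorem resignConf_turn {t : Timing} {c : Config P} {d : Config (resignProgram P i₀)}
    (h : Turn (resignProgram P i₀) t (resignConf P i₀ c) d) :
    (∃ c', d = resignConf P i₀ c' ∧ Turn P t c c') ∨ d.state i₀ = .inr .resigned := by
  obtain ⟨d₁, d₂, h₁, ⟨i, a, h₂⟩, h₃⟩ := h
  obtain ⟨c₁, rfl, g₁⟩ : ∃ c₁, d₁ = resignConf P i₀ c₁ ∧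
      (c₁ = c ∨ t.AllowsBefore ∧ Updates P c c₁) := by
    rcases h₁ with rfl | ⟨ht, h₁⟩
    · exact ⟨c, rfl, .inl rfl⟩
    · obtain ⟨c₁, hd, g₁⟩ := resignConf_updates h₁
      exact ⟨c₁, hd, .inr ⟨ht, g₁⟩⟩
  rcases resignConf_step h₂ with ⟨c₂, rfl, g₂⟩ | g₂
  · left
    rcases h₃ with rfl | ⟨ht, h₃⟩
    · exact ⟨c₂, rfl, c₁, c₂, g₁, ⟨i, a, g₂⟩, .inl rfl⟩
    · obtain ⟨c₃, hd, g₃⟩ := resignConf_updates h₃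
      exact ⟨c₃, hd, c₁, c₂, g₁, ⟨i, a, g₂⟩, .inr ⟨ht, g₃⟩⟩
  · right
    rcases h₃ with rfl | ⟨ht, h₃⟩
    · exact g₂
    · rw [h₃.state_eq, g₂]

theorem Turn.resignConf {t : Timing} {c c' : Config P} (h : Turn P t c c') :
    Turn (resignProgram P i₀) t (resignConf P i₀ c) (resignConf P i₀ c') := by
  obtain ⟨c₁, c₂, h₁, ⟨i, a, h₂⟩, h₃⟩ := h
  refine ⟨_, _, ?_, ⟨i, a, h₂.resignConf⟩, ?_⟩
  · rcases h₁ with rfl | ⟨ht, h₁⟩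
    exacts [.inl rfl, .inr ⟨ht, h₁.resignConf⟩]
  · rcases h₃ with rfl | ⟨ht, h₃⟩
    exacts [.inl rfl, .inr ⟨ht, h₃.resignConf⟩]

/-- A `nop` transition of the process `i₀` to the state `q`. -/
theorem turn_of_nop {t : Timing} {c : Config (resignProgram P i₀)} {q : P.State i₀ ⊕ Resign}
    (h : ResignTrans P i₀ i₀ (c.state i₀) .nop q) :
    ∃ c' : Config (resignProgram P i₀), c'.state i₀ = q ∧ Turn (resignProgram P i₀) t c c' :=
  ⟨c.goto i₀ q, Function.update_self _ _ _, c, _, .inl rfl, ⟨i₀, _, .skip c i₀ q h⟩, .inl rfl⟩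

theorem exists_turn (t : Timing) (c : Config (resignProgram P i₀)) :
    ∃ c', Turn (resignProgram P i₀) t c c' := by
  suffices ∃ q, ResignTrans P i₀ i₀ (c.state i₀) .nop q by
    obtain ⟨q, hq⟩ := this
    obtain ⟨c', -, h⟩ := turn_of_nop (t := t) hq
    exact ⟨c', h⟩
  rcases c.state i₀ with q | _ | _ | _
  exacts [⟨_, .resign q⟩, ⟨_, .claimA⟩, ⟨_, .loopA⟩, ⟨_, .loopB⟩]

variable {F : ∀ i, Set (P.State i)} {ρ : Player → Timing}

/-- If it is possible to resign, then there are no deadlocks at all. -/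
theorem deadlockFree_resign : (tsoGame (resignProgram P i₀) (resignFinal P i₀ F) ρ).DeadlockFree := by
  rintro ⟨c, p⟩
  obtain ⟨c', h⟩ := exists_turn (ρ p) c
  exact ⟨(c', p.other), rfl, h⟩

/-- Player B still wins if the players can resign. The bound grows by two: one move in which
player A resigns, and one in which player B moves on to `wonB`. -/
theorem Game.Attr.resign {n : ℕ} {x : (tsoGame P F ρ).Conf} (h : (tsoGame P F ρ).Attr n x) :
    (tsoGame (resignProgram P i₀) (resignFinal P i₀ F) ρ).Attr (n + 2)
      (resignConf P i₀ x.1, x.2) := by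
  induction h with
  | @final n c hc => exact .final ⟨hc.1, hc.2⟩
  | @moveB n c c' ho hm _ ih =>
    exact .moveB ho ⟨hm.1, hm.2.resignConf⟩ ih
  | @moveA n c ho he _ ih =>
    obtain ⟨c, p⟩ := c
    obtain rfl : p = .A := ho
    obtain ⟨⟨c', p'⟩, hp, ht⟩ := he
    refine .moveA rfl ⟨(resignConf P i₀ c', p'), hp, ht.resignConf⟩ ?_
    rintro ⟨d, p⟩ ⟨hp, hd⟩
    obtain rfl : p = .B := hp
    rcases resignConf_turn hd with ⟨c', rfl, hc'⟩ | hr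
    · exact ih (c', .B) ⟨rfl, hc'⟩
    · obtain ⟨d', hd', hm⟩ := turn_of_nop (t := ρ .B) (c := d) (q := .inr .wonB)
        (by rw [show d.state i₀ = _ from hr]; exact .claimB)
      refine .mono (n := 1) (.moveB rfl (c' := (d', .A)) ⟨rfl, hm⟩ (.final ⟨rfl, i₀, ?_⟩)) (by omega)
      show d'.state i₀ ∈ resignFinal P i₀ F i₀
      rw [hd']
      exact rfl

theorem Turn.wonA {t : Timing} {c c' : Config (resignProgram P i₀)}
    (hc : c.state i₀ = .inr .wonA) (h : Turn (resignProgram P i₀) t c c') :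
    c'.state i₀ = .inr .wonA := by
  obtain ⟨c₁, c₂, h₁, ⟨i, a, h₂⟩, h₃⟩ := h
  have hc₁ : c₁.state i₀ = .inr .wonA := by
    rcases h₁ with rfl | ⟨-, h₁⟩
    exacts [hc, by rw [h₁.state_eq, hc]]
  have hc₂ : c₂.state i₀ = .inr .wonA := by
    obtain ⟨q, b', m', ht, he, rfl⟩ := step_iff.1 h₂
    rcases eq_or_ne i₀ i with rfl | hne
    · rw [hc₁] at ht
      cases ht
      exact Function.update_self _ _ _
    · exact (Function.update_of_ne hne _ _).trans hc₁
  rcases h₃ with rfl | ⟨-, h₃⟩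
  exacts [hc₂, by rw [h₃.state_eq, hc₂]]

/-- A trap `W` of the game of `P`, extended by the configurations in which player B has resigned and
player A has not yet claimed the win or has already claimed it. -/
def resignTrap (P : Program I X V) (i₀ : I) (W : Set (Config P × Player)) :
    Set (Config (resignProgram P i₀) × Player) :=
  {x | (∃ c, x.1 = resignConf P i₀ c ∧ (c, x.2) ∈ W) ∨ x.1.state i₀ = .inr .wonA ∨
    x.1.state i₀ = .inr .resigned ∧ x.2 = .A}

/-- Player A still wins if the players can resign: once player B has resigned, player A moves on
to `wonA`, which cannot be left. -/
theorem Game.Trap.resign {W : Set (Config P × Player)} (h : (tsoGame P F ρ).Trap W)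
    (hF : ∀ i, i ≠ i₀ → F i = ∅) :
    (tsoGame (resignProgram P i₀) (resignFinal P i₀ F) ρ).Trap (resignTrap P i₀ W) where
  not_final := by
    rintro ⟨d, p⟩ hd ⟨hp, i, hi⟩
    rcases hd with ⟨c, rfl, hc⟩ | hd
    · exact h.not_final _ hc ⟨hp, i, hi⟩
    · have hi' : d.state i ∈ resignFinal P i₀ F i := hi
      have hd' : d.state i₀ = .inr .wonA ∨ d.state i₀ = .inr .resigned := hd.imp id And.left
      rcases eq_or_ne i i₀ with rfl | hne
      · rcases hd' with hd' | hd' <;> rw [hd'] at hi' <;> exact hi'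
      · rcases hs : d.state i with q | _ | _ | _ <;> rw [hs] at hi'
        · have : q ∈ F i := hi'
          rw [hF i hne] at this
          exact this
        exacts [hi', hi', hne hi']
  moveA := by
    rintro ⟨d, p⟩ hd hp
    obtain rfl : p = .A := hp
    rcases hd with ⟨c, rfl, hc⟩ | hd | ⟨hd, -⟩
    · obtain ⟨⟨c', p⟩, hc', hm⟩ := h.moveA _ hc rfl
      exact ⟨(resignConf P i₀ c', p), .inl ⟨c', rfl, hc'⟩, hm.1, hm.2.resignConf⟩
    · obtain ⟨d', hd', hm⟩ := turn_of_nop (t := ρ .A) (c := d) (q := .inr .wonA)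
        (by rw [show d.state i₀ = _ from hd]; exact .loopA)
      exact ⟨(d', .B), .inr (.inl hd'), rfl, hm⟩
    · obtain ⟨d', hd', hm⟩ := turn_of_nop (t := ρ .A) (c := d) (q := .inr .wonA)
        (by rw [show d.state i₀ = _ from hd]; exact .claimA)
      exact ⟨(d', .B), .inr (.inl hd'), rfl, hm⟩
  existsB := fun c _ _ => deadlockFree_resign c
  moveB := by
    rintro ⟨d, p⟩ hd hp ⟨d', p'⟩ ⟨hp', hm⟩
    obtain rfl : p = .B := hp
    obtain rfl : p' = .A := hp'
    rcases hd with ⟨c, rfl, hc⟩ | hd | ⟨-, hd⟩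
    · rcases resignConf_turn hm with ⟨c', rfl, hm'⟩ | hr
      · exact .inl ⟨c', rfl, h.moveB _ hc rfl (c', .A) ⟨rfl, hm'⟩⟩
      · exact .inr (.inr ⟨hr, rfl⟩)
    · exact .inr (.inl (hm.wonA hd))
    · cases hd

end Resign

/-! ### Channel systems that rewrite cyclic words -/

section Rewriting

open Relation

variable {M : Type}

/-- One step of the queue rewriting system with the rules `R`: a left-hand side is removed from
the front and the corresponding right-hand side is appended at the back. -/
def Requeue (R : Set (List M × List M)) (x x' : List M) : Prop :=
  ∃ u v y, (u, v) ∈ R ∧ x = u ++ y ∧ x' = y ++ v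

/-- The lists of length at most three. -/
abbrev Short (M : Type) : Type := {l : List M // l.length ≤ 3}

/-- The transitions of the channel system for the rules `R`. Its states are pairs `(u, v)`, where `u`
is still to be received and `v` is still to be sent. -/
inductive RequeueTrans (R : Set (List M × List M)) :
    (Short M × Short M) × ChanOp M × (Short M × Short M) → Prop
  | start (p : Short M × Short M) (h : (p.1.1, p.2.1) ∈ R) (e : Short M) (he : e.1 = []) :
      RequeueTrans R ((e, e), .nop, p)
  | recv (m : M) (u u' v : Short M) (hu : u'.1 = m :: u.1) :
      RequeueTrans R ((u', v), .recv m, (u, v))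
  | send (m : M) (e v v' : Short M) (he : e.1 = []) (hv : v'.1 = m :: v.1) :
      RequeueTrans R ((e, v'), .send m, (e, v))

/-- The channel system that applies the rules `R` to its channel contents. -/
def requeuePCS [Finite M] (R : Set (List M × List M)) : PCS (Short M × Short M) M where
  trans := {t | RequeueTrans R t}
  finite_state :=
    have : Finite (Short M) := List.finite_length_le M 3
    inferInstance
  finite_msg := inferInstance

/-- The empty list as a short list. -/
def Short.nil : Short M := ⟨[], by simp⟩

variable [Finite M] {R : Set (List M × List M)}

theorem requeuePCS_recv (p : List M) : ∀ (u : Short M) (v : Short M) (w : List M), u.1 = p →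
    ReflTransGen (requeuePCS R).Step ((u, v), w ++ p.reverse) ((Short.nil, v), w) := by
  induction p with
  | nil =>
    intro u v w hu
    obtain rfl : u = Short.nil := Subtype.ext hu
    simp only [List.reverse_nil, List.append_nil]
    exact .refl
  | cons m p ih =>
    intro u v w hu
    have hp : p.length ≤ 3 := by
      have := u.2
      rw [hu] at this
      simp only [List.length_cons] at this
      omega
    have := PCS.Step.recv (L := requeuePCS R) (u, v) (⟨p, hp⟩, v) m (w ++ p.reverse)
      (RequeueTrans.recv m ⟨p, hp⟩ u v hu)
    refine .head ?_ (ih ⟨p, hp⟩ v w rfl)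
    simpa using this

theorem requeuePCS_send (p : List M) : ∀ (v : Short M) (w : List M), v.1 = p →
    ReflTransGen (requeuePCS R).Step ((Short.nil, v), w)
      ((Short.nil, Short.nil), p.reverse ++ w) := by
  induction p with
  | nil =>
    intro v w hv
    obtain rfl : v = Short.nil := Subtype.ext hv
    exact .refl
  | cons m p ih =>
    intro v w hv
    have hp : p.length ≤ 3 := by
      have := v.2
      rw [hv] at this
      simp only [List.length_cons] at this
      omega
    have := PCS.Step.send (L := requeuePCS R) (Short.nil, v) (Short.nil, ⟨p, hp⟩) m w
      (RequeueTrans.send m Short.nil ⟨p, hp⟩ v rfl hv)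
    refine .head this ?_
    simpa using ih ⟨p, hp⟩ (m :: w) rfl

variable (hR : ∀ u v, (u, v) ∈ R → u.length ≤ 3 ∧ v.length ≤ 3)
include hR

/-- Receiving the left-hand side of a rule. -/
theorem requeuePCS_fire {u v : List M} (h : (u, v) ∈ R) (y : List M) :
    ReflTransGen (requeuePCS R).Step ((Short.nil, Short.nil), (u ++ y).reverse)
      ((Short.nil, ⟨v, (hR u v h).2⟩), y.reverse) := by
  refine .head (PCS.Step.nop _ (⟨u, (hR u v h).1⟩, ⟨v, (hR u v h).2⟩) _
    (RequeueTrans.start _ h _ rfl)) ?_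
  rw [List.reverse_append]
  exact requeuePCS_recv u _ _ _ rfl

theorem requeuePCS_of_requeue {x x' : List M} (h : ReflTransGen (Requeue R) x x') :
    ReflTransGen (requeuePCS R).Step ((Short.nil, Short.nil), x.reverse)
      ((Short.nil, Short.nil), x'.reverse) := by
  induction h with
  | refl => exact .refl
  | tail _ h ih =>
    obtain ⟨u, v, y, hm, rfl, rfl⟩ := h
    refine ih.trans ((requeuePCS_fire hR hm y).trans ?_)
    rw [List.reverse_append]
    exact requeuePCS_send v _ _ rfl

omit hR

/-- What the reachable configurations of the channel system mean: the contents is reachable in the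
rewriting system, or a rule `(p ++ u, v)` is being applied and `p` has been received, or a rule
`(p, s ++ v)` is being applied and `s` has been sent. -/
theorem requeuePCS_sound {x₀ : List M} {c : (Short M × Short M) × List M}
    (h : ReflTransGen (requeuePCS R).Step ((Short.nil, Short.nil), x₀.reverse) c) :
    (c.1.1.1 = [] ∧ c.1.2.1 = [] ∧ ReflTransGen (Requeue R) x₀ c.2.reverse) ∨
    (∃ p, (p ++ c.1.1.1, c.1.2.1) ∈ R ∧ ReflTransGen (Requeue R) x₀ (p ++ c.2.reverse)) ∨
    (c.1.1.1 = [] ∧ ∃ p s y, (p, s ++ c.1.2.1) ∈ R ∧ ReflTransGen (Requeue R) x₀ (p ++ y) ∧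
      c.2.reverse = y ++ s) := by
  induction h with
  | refl => exact .inl ⟨rfl, rfl, by simpa using .refl⟩
  | @tail b c _ h ih =>
    obtain ⟨⟨u, v⟩, w⟩ := b
    -- a configuration in which nothing is left to be received or sent
    have idle : ∀ e : Short M, u = e → v = e → e.1 = [] → ReflTransGen (Requeue R) x₀ w.reverse := by
      rintro e rfl hv he
      subst hv
      rcases ih with h | ⟨p, hp, h⟩ | ⟨-, p, s, y, hp, h, hw⟩
      · exact h.2.2
      · rw [he, List.append_nil] at hp
        exact h.tail ⟨p, [], w.reverse, hp, rfl, by simp⟩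
      · simp only [he, List.append_nil] at hp
        exact h.tail ⟨p, s, y, hp, rfl, hw⟩
    cases h with
    | nop s s' w h =>
      cases h with
      | start p h e he =>
        have := idle _ rfl rfl he
        exact .inr (.inl ⟨[], h, this⟩)
    | recv s s' m w h =>
      cases h with
      | recv m u u' v hu =>
        refine .inr (.inl ?_)
        rcases ih with h | ⟨p, hp, h⟩ | ⟨h, -⟩
        · simp [hu] at h
        · refine ⟨p ++ [m], ?_, ?_⟩
          · simpa [hu] using hp
          · simpa using h
        · simp [hu] at h
    | send s s' m w h =>
      cases h with
      | send m e v v' he hv =>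
        refine .inr (.inr ⟨he, ?_⟩)
        rcases ih with h | ⟨p, hp, h⟩ | ⟨-, p, s, y, hp, h, hw⟩
        · simp [hv] at h
        · refine ⟨p, [m], w.reverse, ?_, h, by simp⟩
          simpa [he, hv] using hp
        · refine ⟨p, s ++ [m], y, by simpa [hv] using hp, h, ?_⟩
          simp only at hw
          simp [hw]

include hR

/-- If `v₀` is the suffix of no other right-hand side, then the state in which `v₀` has to be sent is
reachable exactly if a rule with right-hand side `v₀` becomes applicable. -/
theorem requeuePCS_reaches_iff {v₀ : Short M} (h₀ : v₀.1 ≠ [])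
    (hv : ∀ p s, (p, s ++ v₀.1) ∈ R → s = []) (x₀ : List M) :
    (∃ w, ReflTransGen (requeuePCS R).Step ((Short.nil, Short.nil), x₀.reverse)
      ((Short.nil, v₀), w)) ↔
    ∃ p y, (p, v₀.1) ∈ R ∧ ReflTransGen (Requeue R) x₀ (p ++ y) := by
  constructor
  · rintro ⟨w, h⟩
    rcases requeuePCS_sound h with ⟨-, h, -⟩ | ⟨p, hp, h⟩ | ⟨-, p, s, y, hp, h, hw⟩
    · exact absurd h h₀
    · exact ⟨p, w.reverse, by simpa [Short.nil] using hp, h⟩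
    · obtain rfl := hv _ _ hp
      exact ⟨p, y, hp, h⟩
  · rintro ⟨p, y, hp, h⟩
    exact ⟨y.reverse, (requeuePCS_of_requeue hR h).trans (requeuePCS_fire hR hp y)⟩

end Rewriting

/-! ### Turing machines on cyclic words -/

section Cyclic

open Relation Turing

/-- The letters of the cyclic words: tape cells, the head with the machine state, and a mark where
both ends of the tape meet. -/
inductive Cell (Γ Q : Type)
  | tape (a : Γ)
  | head (q : Q)
  | mark

variable {Γ Q : Type}

instance [Finite Γ] [Finite Q] : Finite (Cell Γ Q) := by
  refine Finite.of_surjective (fun z : Γ ⊕ Q ⊕ Unit => match z with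
    | .inl a => .tape a
    | .inr (.inl q) => .head q
    | .inr (.inr _) => .mark) ?_
  rintro (a | q | _)
  exacts [⟨.inl a, rfl⟩, ⟨.inr (.inl q), rfl⟩, ⟨.inr (.inr ()), rfl⟩]

/-- The cyclic word, read from the head, of a machine with the state `q`, the cells `l` to the left of
the head (nearest first) and the cells `r` from the head on. -/
def tapeWord (q : Q) (l r : List Γ) : List (Cell Γ Q) :=
  .head q :: (r.map .tape ++ .mark :: l.reverse.map .tape)

/-- A cyclic word with a single head can be read from its head in one way only. -/
theorem eq_of_isRotated_head {q q' : Q} {z z' : List (Cell Γ Q)} (h : .head q :: z ~r .head q' :: z')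
    (hz : ∀ p, Cell.head p ∉ z') : q = q' ∧ z = z' := by
  obtain ⟨n, hn, h⟩ := List.isRotated_iff_mod.1 h.symm
  rw [List.rotate_eq_drop_append_take hn] at h
  set a := List.take n (Cell.head q' :: z') with ha
  have hab : a ++ List.drop n (Cell.head q' :: z') = Cell.head q' :: z' := List.take_append_drop _ _
  set b := List.drop n (Cell.head q' :: z') with hb
  rcases a with _ | ⟨a0, a⟩
  · simp only [List.nil_append, List.append_nil] at hab h
    rw [hab] at h
    simpa [eq_comm] using h
  · rcases b with _ | ⟨b0, b⟩
    · simp only [List.append_nil, List.nil_append] at hab h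
      rw [hab] at h
      simpa [eq_comm] using h
    · simp only [List.cons_append, List.cons.injEq] at hab h
      exact absurd (hab.2 ▸ by simp [h.1]) (hz q)

theorem head_notMem_tape (l r : List Γ) (p : Q) :
    Cell.head p ∉ r.map (Cell.tape (Q := Q)) ++ .mark :: l.reverse.map .tape := by
  simp

theorem tapeWord_eq_of_isRotated {q q' : Q} {l r : List Γ} {z : List (Cell Γ Q)}
    (h : .head q :: z ~r tapeWord q' l r) :
    q = q' ∧ z = r.map .tape ++ .mark :: l.reverse.map .tape :=
  eq_of_isRotated_head h (head_notMem_tape l r)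

variable [Inhabited Γ]

/-- `x` is a rotation of a cyclic word for the configuration `c`. -/
def CodesCfg (x : List (Cell Γ Q)) (c : TM0.Cfg Γ Q) : Prop :=
  ∃ l r : List Γ, c.Tape = Tape.mk' (ListBlank.mk l) (ListBlank.mk r) ∧ x ~r tapeWord c.q l r

theorem ListBlank.mk_singleton_default :
    ListBlank.mk [(default : Γ)] = ListBlank.mk [] :=
  (Quotient.sound (s := BlankRel.setoid Γ) (a := []) (.inl ⟨1, rfl⟩)).symm

variable [Inhabited Q]

/-- The rewriting rules that simulate a Turing machine on cyclic words. The head stands to the left of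
the scanned cell. The rule `halt` is the only one that breaks the word, and leaves two marks. -/
inductive CyclicRule (T : TM0.Machine Γ Q) : List (Cell Γ Q) × List (Cell Γ Q) → Prop
  | rotate (s : Cell Γ Q) : CyclicRule T ([s], [s])
  | write (q q' : Q) (a b : Γ) (h : T q a = some (q', .write b)) :
      CyclicRule T ([.head q, .tape a], [.head q', .tape b])
  | right (q q' : Q) (a : Γ) (h : T q a = some (q', .move .right)) :
      CyclicRule T ([.head q, .tape a], [.tape a, .head q'])
  | left (q q' : Q) (a x : Γ) (h : T q a = some (q', .move .left)) :
      CyclicRule T ([.tape x, .head q, .tape a], [.head q', .tape x, .tape a])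
  | padRight (q : Q) : CyclicRule T ([.head q, .mark], [.head q, .tape default, .mark])
  | padLeft (q : Q) : CyclicRule T ([.mark, .head q], [.mark, .tape default, .head q])
  | halt (q : Q) (a : Γ) (h : T q a = none) : CyclicRule T ([.head q, .tape a], [.mark, .mark])

/-- One rewriting step does nothing, or performs one step of the machine, or shows that the machine
halts. -/
theorem CodesCfg.requeue {T : TM0.Machine Γ Q} {x x' : List (Cell Γ Q)} {c : TM0.Cfg Γ Q}
    (hx : CodesCfg x c) (h : Requeue {t | CyclicRule T t} x x') :
    TM0.step T c = none ∨ ∃ c', ReflTransGen (fun a b => b ∈ TM0.step T a) c c' ∧ CodesCfg x' c' := by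
  obtain ⟨u, v, y, hm, rfl, rfl⟩ := h
  obtain ⟨l, r, hT, hr⟩ := hx
  obtain ⟨q₀, tp⟩ := c
  simp only at hT hr
  subst hT
  cases hm with
  | rotate s =>
    refine .inr ⟨_, .refl, l, r, rfl, .trans ?_ hr⟩
    exact List.isRotated_append
  | write q q' a b h =>
    obtain ⟨rfl, hz⟩ := tapeWord_eq_of_isRotated hr
    rcases r with _ | ⟨a', r⟩
    · simp at hz
    · obtain ⟨rfl, rfl⟩ : a = a' ∧ y = r.map .tape ++ .mark :: l.reverse.map .tape := by
        simpa using hz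
      refine .inr ⟨⟨q', Tape.mk' (ListBlank.mk l) (ListBlank.mk (b :: r))⟩, .single ?_, l, b :: r, rfl,
        List.isRotated_append⟩
      simp [TM0.step, h, ← ListBlank.cons_mk]
  | right q q' a h =>
    obtain ⟨rfl, hz⟩ := tapeWord_eq_of_isRotated hr
    rcases r with _ | ⟨a', r⟩
    · simp at hz
    · obtain ⟨rfl, rfl⟩ : a = a' ∧ y = r.map .tape ++ .mark :: l.reverse.map .tape := by
        simpa using hz
      refine .inr ⟨⟨q', Tape.mk' (ListBlank.mk (a :: l)) (ListBlank.mk r)⟩, .single ?_, a :: l, r, rfl,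
        ?_⟩
      · simp [TM0.step, h, ← ListBlank.cons_mk]
      · have := List.isRotated_append (l := (r.map .tape ++ .mark :: l.reverse.map .tape) ++
          [Cell.tape a]) (l' := [Cell.head q'])
        simpa [tapeWord] using this
  | left q q' a x h =>
    have hr' : Cell.head q :: (.tape a :: (y ++ [.tape x])) ~r tapeWord q₀ l r := by
      refine .trans ?_ hr
      have := List.isRotated_append (l := Cell.head q :: .tape a :: y) (l' := [Cell.tape x])
      simpa using this
    obtain ⟨rfl, hz⟩ := tapeWord_eq_of_isRotated hr'
    rcases r with _ | ⟨a', r⟩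
    · simp at hz
    rcases l with _ | ⟨x', l⟩
    · have := (List.append_inj' (s₁ := Cell.tape a :: y) (s₂ := (a' :: r).map .tape) hz rfl).2
      simp at this
    · have h2 : (Cell.tape a :: y) ++ [.tape x] =
          ((a' :: r).map .tape ++ .mark :: l.reverse.map .tape) ++ [.tape x'] := by
        simpa using hz
      obtain ⟨hy, hx⟩ := List.append_inj' h2 rfl
      obtain ⟨rfl, rfl⟩ : a = a' ∧ y = r.map .tape ++ .mark :: l.reverse.map .tape := by
        simpa using hy
      obtain rfl : x = x' := by simpa using hx
      refine .inr ⟨⟨q', Tape.mk' (ListBlank.mk l) (ListBlank.mk (x :: a :: r))⟩, .single ?_, l,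
        x :: a :: r, rfl, List.isRotated_append⟩
      simp [TM0.step, h, ← ListBlank.cons_mk]
  | padRight q =>
    obtain ⟨rfl, hz⟩ := tapeWord_eq_of_isRotated hr
    rcases r with _ | ⟨a', r⟩
    · obtain rfl : y = l.reverse.map .tape := by simpa using hz
      refine .inr ⟨_, .refl, l, [default], ?_, ?_⟩
      · rw [ListBlank.mk_singleton_default]
      · exact List.isRotated_append
    · simp at hz
  | padLeft q =>
    have hr' : Cell.head q :: (y ++ [.mark]) ~r tapeWord q₀ l r := by
      refine .trans ?_ hr
      have := List.isRotated_append (l := Cell.head q :: y) (l' := [Cell.mark])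
      simpa using this
    obtain ⟨rfl, hz⟩ := tapeWord_eq_of_isRotated hr'
    rcases l with _ | ⟨x', l⟩
    · have hy : y = r.map .tape := by simpa using hz
      subst hy
      refine .inr ⟨_, .refl, [default], r, ?_, ?_⟩
      · rw [ListBlank.mk_singleton_default]
      · have := List.isRotated_append (l := r.map Cell.tape ++ [.mark, .tape default])
          (l' := [Cell.head q])
        simpa [tapeWord] using this
    · exfalso
      simp only [List.reverse_cons, List.map_append, List.map_cons, List.map_nil,
        ← List.cons_append, ← List.append_assoc] at hz
      have := (List.append_inj' hz rfl).2
      simp at this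
  | halt q a h =>
    obtain ⟨rfl, hz⟩ := tapeWord_eq_of_isRotated hr
    rcases r with _ | ⟨a', r⟩
    · simp at hz
    · obtain ⟨rfl, -⟩ : a = a' ∧ y = r.map .tape ++ .mark :: l.reverse.map .tape := by
        simpa using hz
      exact .inl (by simp [TM0.step, h])

variable {T : TM0.Machine Γ Q}

theorem requeue_rotate (y z : List (Cell Γ Q)) :
    ReflTransGen (Requeue {t | CyclicRule T t}) (y ++ z) (z ++ y) := by
  induction y generalizing z with
  | nil => simpa using .refl
  | cons s y ih =>
    refine .head ⟨[s], [s], y ++ z, .rotate s, rfl, rfl⟩ ?_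
    simpa using ih (z ++ [s])

theorem requeue_of_isRotated {x y : List (Cell Γ Q)} (h : x ~r y) :
    ReflTransGen (Requeue {t | CyclicRule T t}) x y := by
  obtain ⟨n, hn, rfl⟩ := List.isRotated_iff_mod.1 h
  rw [List.rotate_eq_drop_append_take hn]
  nth_rewrite 1 [← List.take_append_drop n x]
  exact requeue_rotate _ _

/-- A cyclic word for `c` can be brought into a form in which both sides of the tape are nonempty. -/
theorem CodesCfg.exists_padded {x : List (Cell Γ Q)} {c : TM0.Cfg Γ Q} (h : CodesCfg x c) :
    ∃ b l a r, c.Tape = Tape.mk' (ListBlank.mk (b :: l)) (ListBlank.mk (a :: r)) ∧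
      ReflTransGen (Requeue {t | CyclicRule T t}) x (tapeWord c.q (b :: l) (a :: r)) := by
  obtain ⟨l, r, hT, hr⟩ := h
  have hx := requeue_of_isRotated (T := T) hr
  have : ∃ a r', ListBlank.mk r = ListBlank.mk (a :: r') ∧
      ReflTransGen (Requeue {t | CyclicRule T t}) x (tapeWord c.q l (a :: r')) := by
    rcases r with _ | ⟨a, r⟩
    · refine ⟨default, [], ListBlank.mk_singleton_default.symm, hx.trans (.head
        ⟨_, _, _, .padRight c.q, rfl, rfl⟩ (requeue_of_isRotated List.isRotated_append))⟩
    · exact ⟨a, r, rfl, hx⟩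
  obtain ⟨a, r', hr', hx⟩ := this
  rw [hr'] at hT
  rcases l with _ | ⟨b, l⟩
  · refine ⟨default, [], a, r', by rw [ListBlank.mk_singleton_default]; exact hT, hx.trans ?_⟩
    have h1 : tapeWord c.q [] (a :: r') ~r [.mark, .head c.q] ++ (a :: r').map .tape := by
      have := List.isRotated_append (l := Cell.head c.q :: (a :: r').map Cell.tape) (l' := [.mark])
      simpa [tapeWord] using this
    refine (requeue_of_isRotated h1).trans (.head ⟨_, _, _, .padLeft c.q, rfl, rfl⟩
      (requeue_of_isRotated ?_))
    have := List.isRotated_append (l := (a :: r').map Cell.tape ++ [.mark, .tape default])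
      (l' := [Cell.head c.q])
    simpa [tapeWord] using this
  · exact ⟨b, l, a, r', hT, hx⟩

/-- The rewriting system can perform every step of the machine. -/
theorem CodesCfg.exists_requeue {x : List (Cell Γ Q)} {c c' : TM0.Cfg Γ Q} (hx : CodesCfg x c)
    (h : c' ∈ TM0.step T c) :
    ∃ x', ReflTransGen (Requeue {t | CyclicRule T t}) x x' ∧ CodesCfg x' c' := by
  obtain ⟨b, l, a, r, hT, hr⟩ := hx.exists_padded (T := T)
  obtain ⟨q, tp⟩ := c
  simp only at hT hr
  subst hT
  rcases e : T q a with _ | ⟨q', d | b'⟩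
  · simp [TM0.step, e] at h
  · cases d with
    | left =>
      have h1 : tapeWord q (b :: l) (a :: r) ~r
          [.tape b, .head q, .tape a] ++ (r.map .tape ++ .mark :: l.reverse.map .tape) := by
        have := List.isRotated_append (l := Cell.head q :: ((a :: r).map Cell.tape ++
          .mark :: l.reverse.map .tape)) (l' := [.tape b])
        simpa [tapeWord] using this
      refine ⟨_, (hr.trans (requeue_of_isRotated h1)).tail ⟨_, _, _, .left q q' a b e, rfl, rfl⟩,
        l, b :: a :: r, ?_, ?_⟩
      · simp only [TM0.step, Tape.mk'_head, ListBlank.head_mk, List.headI_cons, e, Option.map_some,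
          Option.mem_def, Option.some.injEq] at h
        rw [← h]
        simp [Tape.move_left_mk', ListBlank.cons_mk]
      · simp only [TM0.step, Tape.mk'_head, ListBlank.head_mk, List.headI_cons, e, Option.map_some,
          Option.mem_def, Option.some.injEq] at h
        rw [← h]
        exact List.isRotated_append
    | right =>
      refine ⟨_, hr.tail ⟨_, _, _, .right q q' a e, rfl, rfl⟩, a :: b :: l, r, ?_, ?_⟩
      · simp only [TM0.step, Tape.mk'_head, ListBlank.head_mk, List.headI_cons, e, Option.map_some,
          Option.mem_def, Option.some.injEq] at h
        rw [← h]
        simp [Tape.move_right_mk', ListBlank.cons_mk]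
      · simp only [TM0.step, Tape.mk'_head, ListBlank.head_mk, List.headI_cons, e, Option.map_some,
          Option.mem_def, Option.some.injEq] at h
        rw [← h]
        have := List.isRotated_append (l := (r.map .tape ++ .mark :: (b :: l).reverse.map .tape) ++
          [Cell.tape a]) (l' := [Cell.head q'])
        simpa [tapeWord] using this
  · refine ⟨_, hr.tail ⟨_, _, _, .write q q' a b' e, rfl, rfl⟩, b :: l, b' :: r, ?_, ?_⟩
    · simp only [TM0.step, Tape.mk'_head, ListBlank.head_mk, List.headI_cons, e, Option.map_some,
        Option.mem_def, Option.some.injEq] at h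
      rw [← h]
      simp [Tape.write_mk', ← ListBlank.cons_mk]
    · simp only [TM0.step, Tape.mk'_head, ListBlank.head_mk, List.headI_cons, e, Option.map_some,
        Option.mem_def, Option.some.injEq] at h
      rw [← h]
      exact List.isRotated_append

/-- The rewriting system makes the rule `halt` applicable exactly if the machine halts. -/
theorem requeue_halt_iff {x : List (Cell Γ Q)} {c : TM0.Cfg Γ Q} (hx : CodesCfg x c) :
    (∃ p y, CyclicRule T (p, [.mark, .mark]) ∧
      ReflTransGen (Requeue {t | CyclicRule T t}) x (p ++ y)) ↔
    (StateTransition.eval (TM0.step T) c).Dom := by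
  constructor
  · rintro ⟨p, y, hp, h⟩
    have key : ∀ x', ReflTransGen (Requeue {t | CyclicRule T t}) x x' →
        (StateTransition.eval (TM0.step T) c).Dom ∨
        ∃ c', StateTransition.Reaches (TM0.step T) c c' ∧ CodesCfg x' c' := by
      intro x' h
      induction h with
      | refl => exact .inr ⟨c, .refl, hx⟩
      | tail _ h ih =>
        rcases ih with ih | ⟨c', hc, hx'⟩
        · exact .inl ih
        · rcases hx'.requeue h with h0 | ⟨c'', h1, h2⟩
          · exact .inl (Part.dom_iff_mem.2 ⟨c', StateTransition.mem_eval.2 ⟨hc, h0⟩⟩)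
          · exact .inr ⟨c'', hc.trans h1, h2⟩
    rcases key _ h with h | ⟨c', hc, hx'⟩
    · exact h
    · refine Part.dom_iff_mem.2 ⟨c', StateTransition.mem_eval.2 ⟨hc, ?_⟩⟩
      cases hp with
      | halt q a hq =>
        obtain ⟨l, r, hT, hr⟩ := hx'
        obtain ⟨q₀, tp⟩ := c'
        simp only at hT hr
        subst hT
        obtain ⟨rfl, hz⟩ := tapeWord_eq_of_isRotated hr
        rcases r with _ | ⟨a', r⟩
        · simp at hz
        · obtain ⟨rfl, -⟩ : a = a' ∧ y = r.map .tape ++ .mark :: l.reverse.map .tape := by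
            simpa using hz
          simp [TM0.step, hq]
  · intro h
    obtain ⟨c', hc'⟩ := Part.dom_iff_mem.1 h
    obtain ⟨hc, h0⟩ := StateTransition.mem_eval.1 hc'
    have key : ∃ x', ReflTransGen (Requeue {t | CyclicRule T t}) x x' ∧ CodesCfg x' c' := by
      clear h0 hc'
      induction hc with
      | refl => exact ⟨x, .refl, hx⟩
      | tail _ h ih =>
        obtain ⟨x', h1, h2⟩ := ih
        obtain ⟨x'', h3, h4⟩ := h2.exists_requeue h
        exact ⟨x'', h1.trans h3, h4⟩
    obtain ⟨x', h1, h2⟩ := key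
    obtain ⟨b, l, a, r, hT, hr⟩ := h2.exists_padded (T := T)
    refine ⟨_, _, .halt c'.q a ?_, h1.trans hr⟩
    obtain ⟨q, tp⟩ := c'
    simp only at hT
    subst hT
    simpa [TM0.step] using h0

/-- Whether a Turing machine with finitely many states and letters halts can be expressed by
reachability in a channel system, with the tape in the initial channel contents. -/
theorem requeuePCS_halt_iff [Finite Γ] [Finite Q] (T : TM0.Machine Γ Q) {x : List (Cell Γ Q)}
    {c : TM0.Cfg Γ Q} (hx : CodesCfg x c) :
    (∃ w, ReflTransGen (requeuePCS {t | CyclicRule T t}).Step ((Short.nil, Short.nil), x.reverse)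
      ((Short.nil, ⟨[.mark, .mark], by simp⟩), w)) ↔
    (StateTransition.eval (TM0.step T) c).Dom := by
  rw [← requeue_halt_iff hx, requeuePCS_reaches_iff]
  · rfl
  · rintro u v (_ | _ | _ | _ | _ | _ | _) <;> simp
  · simp
  · intro p s h
    generalize hw : s ++ [Cell.mark, Cell.mark] = w at h
    cases h with
    | halt => simpa using hw
    | _ =>
      rcases s with _ | ⟨_, _ | ⟨_, _ | ⟨_, s⟩⟩⟩ <;> simp_all

end Cyclic

/-! ### A channel system with an undecidable reachability problem -/

section Undecidable

open Relation Turing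

theorem trPosNum_eq_map_bits (p : PosNum) :
    PartrecToTM2.trPosNum p =
      (p : ℕ).bits.map fun b => cond b PartrecToTM2.Γ'.bit1 PartrecToTM2.Γ'.bit0 := by
  induction p with
  | one => simp [PartrecToTM2.trPosNum]
  | bit0 p ih =>
    rw [PosNum.cast_bit0, ← two_mul, Nat.bit0_bits _ (PosNum.cast_pos p).ne']
    simp [PartrecToTM2.trPosNum, ih]
  | bit1 p ih =>
    rw [PosNum.cast_bit1, ← two_mul, Nat.bit1_bits]
    simp [PartrecToTM2.trPosNum, ih]

theorem trNat_eq_map_bits (n : ℕ) :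
    PartrecToTM2.trNat n =
      n.bits.map fun b => cond b PartrecToTM2.Γ'.bit1 PartrecToTM2.Γ'.bit0 := by
  rw [PartrecToTM2.trNat]
  conv_rhs => rw [← Num.to_of_nat n]
  cases (n : Num) with
  | zero => rfl
  | pos p => exact trPosNum_eq_map_bits p

/-- Some fixed code has an undecidable halting problem. -/
theorem exists_code_halting_undecidable :
    ∃ c : ToPartrec.Code, ¬ ∃ f : ℕ → Bool, Computable f ∧ ∀ n, f n = true ↔ (c.eval [n]).Dom := by
  have hu : Partrec fun m : ℕ => Nat.Partrec.Code.eval (Denumerable.ofNat _ m) 0 :=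
    Nat.Partrec.Code.eval_part.comp (Computable.ofNat _) (Computable.const 0)
  obtain ⟨c, hc⟩ := ToPartrec.Code.exists_code (Nat.Partrec'.part_iff₁.2 hu)
  refine ⟨c, fun ⟨f, hf, h⟩ => ComputablePred.halting_problem 0 ?_⟩
  refine ComputablePred.computable_iff.2
    ⟨fun d => f (Encodable.encode d), hf.comp Computable.encode, ?_⟩
  funext d
  rw [h]
  have := hc ⟨[Encodable.encode d], rfl⟩
  simp only [List.Vector.head, Denumerable.ofNat_encode] at this
  rw [this]
  simp

/-- The halting problem of a code on inputs of length one, for a Turing machine with finitely many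
states and letters. The tape carries the binary digits of the input. -/
theorem exists_tm0_of_code (c : ToPartrec.Code) :
    ∃ (Γ Q : Type) (_ : Inhabited Γ) (_ : Inhabited Q) (_ : Finite Γ) (_ : Finite Q)
      (T : TM0.Machine Γ Q) (a : Γ) (g : Bool → Γ), ∀ n : ℕ,
      (StateTransition.eval (TM0.step T) (TM0.init (a :: n.bits.reverse.map g))).Dom ↔
        (c.eval [n]).Dom := by
  let _ : Inhabited PartrecToTM2.Λ' := ⟨PartrecToTM2.trNormal c .halt⟩
  let T1 := TM2to1.tr PartrecToTM2.tr
  let T0 := TM1to0.tr T1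
  have s2 : TM2.Supports PartrecToTM2.tr (PartrecToTM2.codeSupp c .halt) :=
    PartrecToTM2.tr_supports c .halt
  have s1 : TM1.Supports T1 _ := TM2to1.tr_supports _ s2
  have s0 : TM0.Supports T0 _ := TM1to0.tr_supports _ s1
  set Qs := TM1to0.trStmts T1 (TM2to1.trSupp PartrecToTM2.tr (PartrecToTM2.codeSupp c .halt))
  let _ : Inhabited {q // q ∈ Qs} := ⟨⟨default, s0.1⟩⟩
  classical
  let g₁ : PointedMap (TM1to0.Λ' T1) {q // q ∈ Qs} :=
    ⟨fun q => if h : q ∈ Qs then ⟨q, h⟩ else default, dif_pos s0.1⟩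
  let idΓ : PointedMap (TM2to1.Γ' PartrecToTM2.K' fun _ => PartrecToTM2.Γ')
      (TM2to1.Γ' PartrecToTM2.K' fun _ => PartrecToTM2.Γ') := ⟨id, rfl⟩
  -- a cell of the tape with its bottom mark and the symbol `d` of the main stack
  let cell (t : Bool) (d : PartrecToTM2.Γ') : TM2to1.Γ' PartrecToTM2.K' fun _ => PartrecToTM2.Γ' :=
    (t, Function.update (fun _ => none) .main (some d))
  refine ⟨TM2to1.Γ' PartrecToTM2.K' fun _ => PartrecToTM2.Γ', {q // q ∈ Qs}, inferInstance,
    inferInstance, ?_, inferInstance, TM0.Machine.map T0 idΓ idΓ g₁ Subtype.val,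
    cell true .cons, fun b => cell false (cond b .bit1 .bit0), fun n => ?_⟩
  · have : Finite PartrecToTM2.K' := Finite.of_surjective
      (fun z : Fin 4 => match z with
        | 0 => PartrecToTM2.K'.main | 1 => .rev | 2 => .aux | 3 => .stack)
      (by rintro (_ | _ | _ | _); exacts [⟨0, rfl⟩, ⟨1, rfl⟩, ⟨2, rfl⟩, ⟨3, rfl⟩])
    unfold TM2to1.Γ'
    infer_instance
  have htape : TM2to1.trInit (K := PartrecToTM2.K') (Γ := fun _ => PartrecToTM2.Γ') .main
      (PartrecToTM2.trList [n]) =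
      cell true .cons :: n.bits.reverse.map fun b => cell false (cond b .bit1 .bit0) := by
    have hL : (PartrecToTM2.trList [n]).reverse = .cons ::
        n.bits.reverse.map fun b => cond b PartrecToTM2.Γ'.bit1 PartrecToTM2.Γ'.bit0 := by
      simp [trNat_eq_map_bits]
    rw [TM2to1.trInit, hL]
    change cell true .cons :: List.map (cell false) (List.map _ n.bits.reverse) = _
    rw [List.map_map]
    rfl
  rw [← htape]
  set l := TM2to1.trInit (K := PartrecToTM2.K') (Γ := fun _ => PartrecToTM2.Γ') .main
      (PartrecToTM2.trList [n])
  have e0 := StateTransition.tr_eval_dom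
    (TM0.Machine.map_respects T0 idΓ idΓ (S := Qs) g₁ Subtype.val s0 (fun _ => rfl)
      (fun q hq => by simp [g₁, show q ∈ Qs from hq])) (a₁ := TM0.init l)
    (a₂ := TM0.Cfg.map idΓ g₁ (TM0.init l)) ⟨s0.1, rfl⟩
  rw [TM0.map_init, show l.map idΓ = l from List.map_id l] at e0
  rw [e0]
  have e1 : (TM0.eval T0 l).Dom ↔ (TM1.eval T1 l).Dom := by rw [TM1to0.tr_eval T1 l]
  have e2 := TM2to1.tr_eval_dom PartrecToTM2.tr .main (PartrecToTM2.trList [n])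
  have e3 := PartrecToTM2.tr_eval c [n]
  have e4 : (TM2.init .main (PartrecToTM2.trList [n]) : PartrecToTM2.Cfg') =
      PartrecToTM2.init c [n] := by
    unfold TM2.init PartrecToTM2.init
    congr 1
    funext k
    cases k <;> rfl
  refine (show _ ↔ (TM0.eval T0 l).Dom from Iff.rfl).trans (e1.trans (e2.trans ?_))
  change (StateTransition.eval _ (TM2.init _ _)).Dom ↔ _
  rw [e4, e3]
  rfl

/-- Reachability in some fixed channel system is undecidable if a number, written in binary, is given
in the initial channel contents. -/
theorem exists_pcs_undecidable :
    ∃ (S M : Type) (L : PCS S M) (s₀ : S) (SF : Set S) (a b : List M) (g : Bool → M),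
      ¬ ∃ f : ℕ → Bool, Computable f ∧ ∀ n, f n = true ↔
        ∃ s ∈ SF, ∃ w, ReflTransGen L.Step (s₀, a ++ n.bits.map g ++ b) (s, w) := by
  obtain ⟨c, hc⟩ := exists_code_halting_undecidable
  obtain ⟨Γ, Q, _, _, _, _, T, a, g, h⟩ := exists_tm0_of_code c
  refine ⟨_, _, requeuePCS {t | CyclicRule T t}, (Short.nil, Short.nil),
    {(Short.nil, ⟨[.mark, .mark], by simp⟩)}, [.mark], [.tape a, .head default],
    fun b => .tape (g b), ?_⟩
  rintro ⟨f, hf, hn⟩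
  refine hc ⟨f, hf, fun n => ?_⟩
  rw [hn, ← h]
  have hx : CodesCfg (tapeWord default [] (a :: n.bits.reverse.map g))
      (TM0.init (a :: n.bits.reverse.map g) : TM0.Cfg Γ Q) := ⟨[], _, rfl, List.IsRotated.refl _⟩
  have := requeuePCS_halt_iff T hx
  rw [← this]
  simp [tapeWord, Function.comp_def]

end Undecidable

/-! ### Numbering programs with two processes -/

section Coding

theorem Instr.map_injective {X V X' V' : Type} {f : X → X'} {g : V → V'} (hf : f.Injective)
    (hg : g.Injective) : (Instr.map f g).Injective := by
  rintro (_ | _ | _ | _ | _) (_ | _ | _ | _ | _) h <;>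
    simp_all [Instr.map, hf.eq_iff, hg.eq_iff]

/-- The two process identifiers as numbers. -/
def Proc2.equivFin : Proc2 ≃ Fin 2 where
  toFun
    | .one => 0
    | .two => 1
  invFun
    | 0 => .one
    | 1 => .two
  left_inv := by rintro (_ | _) <;> rfl
  right_inv i := by fin_cases i <;> rfl

/-- The variables as numbers. -/
def RVar.equivFin : RVar ≃ Fin 3 where
  toFun
    | .xw => 0
    | .xr => 1
    | .y => 2
  invFun
    | 0 => .xw
    | 1 => .xr
    | 2 => .y
  left_inv := by rintro (_ | _ | _) <;> rfl
  right_inv i := by fin_cases i <;> rfl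

/-- A list of numbered transitions that is the image of the transition relation describes it. -/
theorem trans_iff_mem {Q X V : Type} {n m k : ℕ} {r : Q → Instr X V → Q → Prop}
    (e : Q ≃ Fin n) (eX : X ≃ Fin m) (eV : V ≃ Fin k) {l : List (ℕ × Instr ℕ ℕ × ℕ)}
    (h : ∀ z, z ∈ l ↔ ∃ q a q', r q a q' ∧
      z = ((e q : ℕ), a.map (fun x => (eX x : ℕ)) (fun v => (eV v : ℕ)), (e q' : ℕ)))
    (q : Q) (a : Instr X V) (q' : Q) :
    r q a q' ↔
      ((e q : ℕ), a.map (fun x => (eX x : ℕ)) (fun v => (eV v : ℕ)), (e q' : ℕ)) ∈ l := by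
  rw [h]
  constructor
  · exact fun h => ⟨q, a, q', h, rfl⟩
  · rintro ⟨p, b, p', hr, h⟩
    simp only [Prod.mk.injEq] at h
    obtain rfl : q = p := e.injective (Fin.ext h.1)
    obtain rfl : q' = p' := e.injective (Fin.ext h.2.2)
    obtain rfl : a = b := Instr.map_injective (Fin.val_injective.comp eX.injective)
      (Fin.val_injective.comp eV.injective) h.2.1
    exact hr

theorem GameCode.describes_of_two {X V : Type} {P : Program Proc2 X V} {F : ∀ i, Set (P.State i)}
    {c : Config P} {p : Player} {g : GameCode} {nX nV n₁ n₂ : ℕ} {l₁ l₂ : List (ℕ × Instr ℕ ℕ × ℕ)}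
    (hX : g.numVars = nX) (hV : g.numVals = nV) (hg : g.procs = [(n₁, l₁), (n₂, l₂)])
    (e₁ : P.State .one ≃ Fin n₁) (e₂ : P.State .two ≃ Fin n₂)
    (eX : X ≃ Fin nX) (eV : V ≃ Fin nV)
    (h₁ : ∀ z, z ∈ l₁ ↔ ∃ q a q', P.trans .one q a q' ∧
      z = ((e₁ q : ℕ), a.map (fun x => (eX x : ℕ)) (fun v => (eV v : ℕ)), (e₁ q' : ℕ)))
    (h₂ : ∀ z, z ∈ l₂ ↔ ∃ q a q', P.trans .two q a q' ∧
      z = ((e₂ q : ℕ), a.map (fun x => (eX x : ℕ)) (fun v => (eV v : ℕ)), (e₂ q' : ℕ)))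
    (hF₁ : ∀ q, q ∈ F .one ↔ (0, (e₁ q : ℕ)) ∈ g.finals)
    (hF₂ : ∀ q, q ∈ F .two ↔ (1, (e₂ q : ℕ)) ∈ g.finals)
    (hs : g.states = [(e₁ (c.state .one) : ℕ), (e₂ (c.state .two) : ℕ)])
    (hb : g.bufs = [(c.buf .one).map fun m => ((eX m.1 : ℕ), (eV m.2 : ℕ)),
      (c.buf .two).map fun m => ((eX m.1 : ℕ), (eV m.2 : ℕ))])
    (hm : ∀ x, g.mem[(eX x : ℕ)]? = some (eV (c.mem x) : ℕ)) (hp : g.player = p) :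
    g.Describes P F c p := by
  obtain ⟨_, _, procs, finals, states, bufs, mem, pl⟩ := g
  simp only at *
  subst hX hV hg hs hb hp
  refine ⟨Proc2.equivFin, eX, eV, fun i => match i with | .one => e₁ | .two => e₂, ?_, ?_, ?_, ?_,
    hm, rfl⟩
  · rintro (_ | _)
    exacts [trans_iff_mem e₁ eX eV h₁, trans_iff_mem e₂ eX eV h₂]
  · rintro (_ | _)
    exacts [hF₁, hF₂]
  · rintro (_ | _) <;> rfl
  · rintro (_ | _) <;> rfl

/-! ### Computing the two-process program -/

theorem primrec_rd : Primrec₂ (Instr.rd : ℕ → ℕ → Instr ℕ ℕ) :=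
  (Primrec.of_equiv_symm (e := Instr.equivSum ℕ ℕ)).comp
    (Primrec.sumInl.comp (Primrec.pair Primrec.fst Primrec.snd))

theorem primrec_wr : Primrec₂ (Instr.wr : ℕ → ℕ → Instr ℕ ℕ) :=
  (Primrec.of_equiv_symm (e := Instr.equivSum ℕ ℕ)).comp
    (Primrec.sumInr.comp (Primrec.sumInl.comp (Primrec.pair Primrec.fst Primrec.snd)))

theorem primrec_arw : Primrec fun p : ℕ × ℕ × ℕ => (Instr.arw p.1 p.2.1 p.2.2 : Instr ℕ ℕ) :=
  (Primrec.of_equiv_symm (e := Instr.equivSum ℕ ℕ)).comp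
    (Primrec.sumInr.comp (Primrec.sumInr.comp (Primrec.sumInl.comp Primrec.id)))

/-- The numbers of the data values, for `k` messages with the numbers `f`. -/
def RVal.num {M : Type} (k : ℕ) (f : M → ℕ) : RVal M → ℕ
  | .msg m => f m
  | .zero => k
  | .one => k + 1
  | .bot => k + 2
  | .top => k + 3

/-- The data values as a sum. -/
def RVal.equivSum (M : Type) : RVal M ≃ M ⊕ Fin 4 where
  toFun
    | .msg m => .inl m
    | .zero => .inr 0
    | .one => .inr 1
    | .bot => .inr 2
    | .top => .inr 3
  invFun
    | .inl m => .msg m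
    | .inr 0 => .zero
    | .inr 1 => .one
    | .inr 2 => .bot
    | .inr 3 => .top
  left_inv := by rintro (_ | _ | _ | _ | _) <;> rfl
  right_inv := by
    rintro (m | j)
    · rfl
    · fin_cases j <;> rfl

theorem RVal.exists_equiv {M : Type} {k : ℕ} (eM : M ≃ Fin k) :
    ∃ e : RVal M ≃ Fin (k + 4), ∀ v, (e v : ℕ) = v.num k fun m => (eM m : ℕ) := by
  refine ⟨(RVal.equivSum M).trans ((eM.sumCongr (Equiv.refl _)).trans finSumFinEquiv), ?_⟩
  rintro (_ | _ | _ | _ | _) <;> rfl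

/-- The numbers of the states of the second process, for `k` messages with the numbers `f`. -/
def State2.num {M : Type} (k : ℕ) (f : M → ℕ) : State2 M → ℕ
  | .qm m => f m
  | .q1 => k
  | .q3 => k + 1
  | .q4 => k + 2
  | .q5 => k + 3
  | .q6 => k + 4
  | .q7 => k + 5
  | .q8 => k + 6
  | .q9 => k + 7
  | .q10 => k + 8
  | .q11 => k + 9
  | .q12 => k + 10
  | .q13 => k + 11
  | .q14 => k + 12
  | .h1 => k + 13
  | .h2 => k + 14
  | .h3 => k + 15
  | .h4 => k + 16
  | .h5 => k + 17
  | .qL => k + 18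
  | .qF => k + 19

/-- The states of the second process as a sum. -/
def State2.equivSum (M : Type) : State2 M ≃ M ⊕ Fin 20 where
  toFun
    | .qm m => .inl m
    | .q1 => .inr 0
    | .q3 => .inr 1
    | .q4 => .inr 2
    | .q5 => .inr 3
    | .q6 => .inr 4
    | .q7 => .inr 5
    | .q8 => .inr 6
    | .q9 => .inr 7
    | .q10 => .inr 8
    | .q11 => .inr 9
    | .q12 => .inr 10
    | .q13 => .inr 11
    | .q14 => .inr 12
    | .h1 => .inr 13
    | .h2 => .inr 14
    | .h3 => .inr 15
    | .h4 => .inr 16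
    | .h5 => .inr 17
    | .qL => .inr 18
    | .qF => .inr 19
  invFun
    | .inl m => .qm m
    | .inr j => ![.q1, .q3, .q4, .q5, .q6, .q7, .q8, .q9, .q10, .q11, .q12, .q13, .q14, .h1, .h2,
        .h3, .h4, .h5, .qL, .qF] j
  left_inv q := by cases q <;> rfl
  right_inv := by
    rintro (m | j)
    · rfl
    · fin_cases j <;> rfl

theorem State2.exists_equiv {M : Type} {k : ℕ} (eM : M ≃ Fin k) :
    ∃ e : State2 M ≃ Fin (k + 20), ∀ q, (e q : ℕ) = q.num k fun m => (eM m : ℕ) := by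
  refine ⟨(State2.equivSum M).trans ((eM.sumCongr (Equiv.refl _)).trans finSumFinEquiv), ?_⟩
  intro q
  cases q <;> rfl

/-- The numbered transitions of the second process that do not depend on a message, for an empty set
of messages. -/
def fixedEdges : List (ℕ × Instr ℕ ℕ × ℕ) :=
  [(1, .mf, 2), (2, .wr 0 2, 3), (3, .nop, 4), (4, .mf, 5), (5, .rd 2 0, 6), (6, .rd 2 1, 7),
    (7, .wr 2 0, 8), (8, .mf, 9), (9, .rd 0 2, 10), (10, .wr 1 2, 11), (11, .nop, 12),
    (12, .mf, 0), (0, .nop, 13), (13, .nop, 0), (13, .nop, 19), (1, .nop, 14), (14, .nop, 1),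
    (14, .nop, 19), (6, .nop, 15), (15, .nop, 6), (15, .nop, 19), (8, .nop, 16), (16, .nop, 8),
    (16, .nop, 19), (12, .nop, 17), (17, .nop, 12), (17, .nop, 19), (1, .nop, 18), (2, .nop, 19),
    (4, .nop, 18), (5, .rd 2 1, 18), (0, .rd 0 3, 19), (18, .nop, 18), (19, .nop, 19)]

/-- Adding `k` to the numbers of states and values makes room for `k` messages. -/
def shiftEdge (k : ℕ) (z : ℕ × Instr ℕ ℕ × ℕ) : ℕ × Instr ℕ ℕ × ℕ :=
  (k + z.1, z.2.1.map id (fun v => k + v), k + z.2.2)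

/-- The numbered transitions of the second process that depend on the message `m`, out of `k`. -/
def msgEdges (k m : ℕ) : List (ℕ × Instr ℕ ℕ × ℕ) :=
  [(k, .rd 0 m, m), (m, .wr 1 m, k + 1), (k, .rd 0 m, k + 18), (m, .nop, k + 19),
    (k + 9, .rd 0 m, k + 18), (k + 12, .rd 0 m, k + 18)]

/-- The numbered transitions of the second process for `k` messages. -/
def edges2 (k : ℕ) : List (ℕ × Instr ℕ ℕ × ℕ) :=
  fixedEdges.map (shiftEdge k) ++ (List.range k).flatMap (msgEdges k)

theorem mem_edges2 {M : Type} {k : ℕ} (eM : M ≃ Fin k) (z : ℕ × Instr ℕ ℕ × ℕ) :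
    z ∈ edges2 k ↔ ∃ q a q', Trans2 M q a q' ∧
      z = (q.num k fun m => (eM m : ℕ), a.map (fun x => (RVar.equivFin x : ℕ))
        (fun v => v.num k fun m => (eM m : ℕ)), q'.num k fun m => (eM m : ℕ)) := by
  constructor
  · intro h
    rw [edges2, List.mem_append] at h
    rcases h with h | h
    · simp only [fixedEdges, List.map_cons, List.map_nil, List.mem_cons, List.not_mem_nil,
        or_false] at h
      rcases h with rfl | rfl | rfl | rfl | rfl | rfl | rfl | rfl | rfl | rfl | rfl | rfl | rfl |
        rfl | rfl | rfl | rfl | rfl | rfl | rfl | rfl | rfl | rfl | rfl | rfl | rfl | rfl | rfl |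
        rfl | rfl | rfl | rfl | rfl | rfl
      exacts [⟨_, _, _, .t3, rfl⟩, ⟨_, _, _, .t4, rfl⟩, ⟨_, _, _, .t5, rfl⟩, ⟨_, _, _, .t6, rfl⟩,
        ⟨_, _, _, .t7, rfl⟩, ⟨_, _, _, .t8, rfl⟩, ⟨_, _, _, .t9, rfl⟩, ⟨_, _, _, .t10, rfl⟩,
        ⟨_, _, _, .t11, rfl⟩, ⟨_, _, _, .t12, rfl⟩, ⟨_, _, _, .t13, rfl⟩, ⟨_, _, _, .t14, rfl⟩,
        ⟨_, _, _, .d1, rfl⟩, ⟨_, _, _, .d1', rfl⟩, ⟨_, _, _, .d1F, rfl⟩, ⟨_, _, _, .d2, rfl⟩,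
        ⟨_, _, _, .d2', rfl⟩, ⟨_, _, _, .d2F, rfl⟩, ⟨_, _, _, .d3, rfl⟩, ⟨_, _, _, .d3', rfl⟩,
        ⟨_, _, _, .d3F, rfl⟩, ⟨_, _, _, .d4, rfl⟩, ⟨_, _, _, .d4', rfl⟩, ⟨_, _, _, .d4F, rfl⟩,
        ⟨_, _, _, .d5, rfl⟩, ⟨_, _, _, .d5', rfl⟩, ⟨_, _, _, .d5F, rfl⟩, ⟨_, _, _, .e3L, rfl⟩,
        ⟨_, _, _, .e4F, rfl⟩, ⟨_, _, _, .e6L, rfl⟩, ⟨_, _, _, .e7L, rfl⟩, ⟨_, _, _, .e1F, rfl⟩,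
        ⟨_, _, _, .loopL, rfl⟩, ⟨_, _, _, .loopF, rfl⟩]
    · obtain ⟨m, hm, h⟩ := List.mem_flatMap.1 h
      obtain ⟨m, rfl⟩ : ∃ m' : M, m = (eM m' : ℕ) :=
        ⟨eM.symm ⟨m, List.mem_range.1 hm⟩, by simp⟩
      simp only [msgEdges, List.mem_cons, List.not_mem_nil, or_false] at h
      rcases h with rfl | rfl | rfl | rfl | rfl | rfl
      exacts [⟨_, _, _, .t1 m, rfl⟩, ⟨_, _, _, .tm m, rfl⟩, ⟨_, _, _, .e1L m, rfl⟩,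
        ⟨_, _, _, .emF m, rfl⟩, ⟨_, _, _, .e11L m, rfl⟩, ⟨_, _, _, .e14L m, rfl⟩]
  · rintro ⟨q, a, q', h, rfl⟩
    have hmsg : ∀ (m : M) (z : ℕ × Instr ℕ ℕ × ℕ), z ∈ msgEdges k (eM m) → z ∈ edges2 k :=
      fun m z hz => List.mem_append_right _
        (List.mem_flatMap.2 ⟨_, List.mem_range.2 (eM m).2, hz⟩)
    have hfix : ∀ z ∈ fixedEdges, shiftEdge k z ∈ edges2 k :=
      fun z hz => List.mem_append_left _ (List.mem_map_of_mem hz)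
    cases h with
    | t1 m | tm m | e1L m | emF m | e11L m | e14L m =>
      exact hmsg m _ (by simp [msgEdges, State2.num, RVal.num, Instr.map, RVar.equivFin])
    | t3 => exact hfix (1, .mf, 2) (by simp [fixedEdges])
    | t4 => exact hfix (2, .wr 0 2, 3) (by simp [fixedEdges])
    | t5 => exact hfix (3, .nop, 4) (by simp [fixedEdges])
    | t6 => exact hfix (4, .mf, 5) (by simp [fixedEdges])
    | t7 => exact hfix (5, .rd 2 0, 6) (by simp [fixedEdges])
    | t8 => exact hfix (6, .rd 2 1, 7) (by simp [fixedEdges])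
    | t9 => exact hfix (7, .wr 2 0, 8) (by simp [fixedEdges])
    | t10 => exact hfix (8, .mf, 9) (by simp [fixedEdges])
    | t11 => exact hfix (9, .rd 0 2, 10) (by simp [fixedEdges])
    | t12 => exact hfix (10, .wr 1 2, 11) (by simp [fixedEdges])
    | t13 => exact hfix (11, .nop, 12) (by simp [fixedEdges])
    | t14 => exact hfix (12, .mf, 0) (by simp [fixedEdges])
    | d1 => exact hfix (0, .nop, 13) (by simp [fixedEdges])
    | d1' => exact hfix (13, .nop, 0) (by simp [fixedEdges])
    | d1F => exact hfix (13, .nop, 19) (by simp [fixedEdges])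
    | d2 => exact hfix (1, .nop, 14) (by simp [fixedEdges])
    | d2' => exact hfix (14, .nop, 1) (by simp [fixedEdges])
    | d2F => exact hfix (14, .nop, 19) (by simp [fixedEdges])
    | d3 => exact hfix (6, .nop, 15) (by simp [fixedEdges])
    | d3' => exact hfix (15, .nop, 6) (by simp [fixedEdges])
    | d3F => exact hfix (15, .nop, 19) (by simp [fixedEdges])
    | d4 => exact hfix (8, .nop, 16) (by simp [fixedEdges])
    | d4' => exact hfix (16, .nop, 8) (by simp [fixedEdges])
    | d4F => exact hfix (16, .nop, 19) (by simp [fixedEdges])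
    | d5 => exact hfix (12, .nop, 17) (by simp [fixedEdges])
    | d5' => exact hfix (17, .nop, 12) (by simp [fixedEdges])
    | d5F => exact hfix (17, .nop, 19) (by simp [fixedEdges])
    | e3L => exact hfix (1, .nop, 18) (by simp [fixedEdges])
    | e4F => exact hfix (2, .nop, 19) (by simp [fixedEdges])
    | e6L => exact hfix (4, .nop, 18) (by simp [fixedEdges])
    | e7L => exact hfix (5, .rd 2 1, 18) (by simp [fixedEdges])
    | e1F => exact hfix (0, .rd 0 3, 19) (by simp [fixedEdges])
    | loopL => exact hfix (18, .nop, 18) (by simp [fixedEdges])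
    | loopF => exact hfix (19, .nop, 19) (by simp [fixedEdges])

theorem primrec_map_shiftEdge (l : List (ℕ × Instr ℕ ℕ × ℕ)) :
    Primrec fun k => l.map (shiftEdge k) := by
  have hadd : ∀ j, Primrec fun k : ℕ => k + j := fun j => Primrec.nat_add.comp .id (.const j)
  induction l with
  | nil => exact .const []
  | cons z l ih =>
    refine Primrec.list_cons.comp (Primrec.pair (hadd _) (Primrec.pair ?_ (hadd _))) ih
    obtain ⟨_, a, _⟩ := z
    cases a with
    | rd x v => exact primrec_rd.comp (.const x) (hadd v)
    | wr x v => exact primrec_wr.comp (.const x) (hadd v)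
    | arw x v v' => exact primrec_arw.comp (.pair (.const x) (.pair (hadd v) (hadd v')))
    | nop => exact .const _
    | mf => exact .const _

theorem primrec_singleton {α β : Type} [Primcodable α] [Primcodable β] {f : α → β}
    (hf : Primrec f) : Primrec fun a => [f a] :=
  Primrec.list_cons.comp hf (.const [])

theorem primrec_msgEdges : Primrec₂ msgEdges := by
  have hk : Primrec fun p : ℕ × ℕ => p.1 := .fst
  have hm : Primrec fun p : ℕ × ℕ => p.2 := .snd
  have hadd : ∀ j, Primrec fun p : ℕ × ℕ => p.1 + j := fun j => Primrec.nat_add.comp hk (.const j)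
  have hrd : Primrec fun p : ℕ × ℕ => (Instr.rd 0 p.2 : Instr ℕ ℕ) := primrec_rd.comp (.const 0) hm
  have hwr : Primrec fun p : ℕ × ℕ => (Instr.wr 1 p.2 : Instr ℕ ℕ) := primrec_wr.comp (.const 1) hm
  exact Primrec.list_cons.comp (hk.pair (hrd.pair hm)) <|
    Primrec.list_cons.comp (hm.pair (hwr.pair (hadd 1))) <|
    Primrec.list_cons.comp (hk.pair (hrd.pair (hadd 18))) <|
    Primrec.list_cons.comp (hm.pair ((Primrec.const Instr.nop).pair (hadd 19))) <|
    Primrec.list_cons.comp ((hadd 9).pair (hrd.pair (hadd 18))) <|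
    primrec_singleton ((hadd 12).pair (hrd.pair (hadd 18)))

theorem primrec_edges2 : Primrec edges2 :=
  Primrec.list_append.comp (primrec_map_shiftEdge _)
    (Primrec.list_flatMap Primrec.list_range primrec_msgEdges)

end Coding

section Coding

/-- The numbered transitions of the first process for a transition from `s` to `s'` of the channel
system with `k` messages, where `h` is the auxiliary state and `l` the state `hL`. -/
def opEdges (k h l s s' : ℕ) (o : ChanOp ℕ) : List (ℕ × Instr ℕ ℕ × ℕ) :=
  match o with
  | .send m => (s, .wr 0 m, h) :: (h, .wr 2 (k + 1), s') ::
      (List.range k).map fun m' => (h, .rd 1 m', l)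
  | .recv m => [(s, .rd 1 m, h), (h, .rd 1 (k + 2), s')]
  | .nop => (s, .nop, h) :: (h, .nop, s') :: (List.range k).map fun m' => (h, .rd 1 m', l)

/-- The numbered transitions of the first process. -/
def edges1 (d : PCSCode) : List (ℕ × Instr ℕ ℕ × ℕ) :=
  ((List.range d.trans.length).flatMap fun i => (d.trans[i]?).elim [] fun t =>
    opEdges d.numMsgs (d.numStates + i) (d.numStates + d.trans.length) t.1 t.2.2 t.2.1) ++
  ((d.finals.filter fun s => s < d.numStates).map fun s =>
    (s, .wr 0 (d.numMsgs + 3), d.numStates + d.trans.length + 1)) ++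
  [(d.numStates + d.trans.length, .nop, d.numStates + d.trans.length),
    (d.numStates + d.trans.length + 1, .nop, d.numStates + d.trans.length + 1)]

/-- The description of the two-process program for a description of a channel system. -/
def reductionCode (d : PCSCode) : GameCode where
  numVars := 3
  numVals := d.numMsgs + 4
  procs := [(d.numStates + d.trans.length + 2, edges1 d), (d.numMsgs + 20, edges2 d.numMsgs)]
  finals := [(1, d.numMsgs + 19)]
  states := [d.init, d.numMsgs]
  bufs := [[], []]
  mem := [d.numMsgs + 2, d.numMsgs + 2, d.numMsgs]
  player := .B

/-- The numbers of the states of the first process. -/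
def State1.num {S M : Type} {L : PCS S M} (n k : ℕ) (f : S → ℕ) (g : L.trans → ℕ) : State1 L → ℕ
  | .chan s => f s
  | .aux t => n + g t
  | .hL => n + k
  | .hF => n + k + 1

/-- The states of the first process as a sum. -/
def State1.equivSum {S M : Type} (L : PCS S M) : State1 L ≃ (S ⊕ L.trans) ⊕ Fin 2 where
  toFun
    | .chan s => .inl (.inl s)
    | .aux t => .inl (.inr t)
    | .hL => .inr 0
    | .hF => .inr 1
  invFun
    | .inl (.inl s) => .chan s
    | .inl (.inr t) => .aux t
    | .inr 0 => .hL
    | .inr 1 => .hF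
  left_inv := by rintro (_ | _ | _ | _) <;> rfl
  right_inv := by
    rintro ((s | t) | j)
    · rfl
    · rfl
    · fin_cases j <;> rfl

theorem State1.exists_equiv {S M : Type} {L : PCS S M} {n k : ℕ} (eS : S ≃ Fin n)
    (eT : L.trans ≃ Fin k) :
    ∃ e : State1 L ≃ Fin (n + k + 2), ∀ q, (e q : ℕ) =
      q.num n k (fun s => (eS s : ℕ)) fun t => (eT t : ℕ) := by
  refine ⟨(State1.equivSum L).trans (((((eS.sumCongr eT).trans finSumFinEquiv)).sumCongr
    (Equiv.refl _)).trans finSumFinEquiv), ?_⟩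
  rintro (_ | _ | _ | _) <;> rfl

theorem ChanOp.map_injective {M M' : Type} {f : M → M'} (hf : f.Injective) :
    (ChanOp.map f).Injective := by
  rintro (_ | _ | _) (_ | _ | _) h <;> simp_all [ChanOp.map, hf.eq_iff]

/-- The numbering of the transitions of a channel system by their positions in its description. -/
theorem PCSCode.exists_trans_equiv {d : PCSCode} {S M : Type} {L : PCS S M}
    (eS : S ≃ Fin d.numStates) (eM : M ≃ Fin d.numMsgs) (hd : d.trans.Nodup)
    (ht : ∀ t : ℕ × ChanOp ℕ × ℕ, t ∈ d.trans ↔ ∃ s o s', (s, o, s') ∈ L.trans ∧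
      t = ((eS s : ℕ), o.map (fun m => (eM m : ℕ)), (eS s' : ℕ))) :
    ∃ eT : L.trans ≃ Fin d.trans.length, ∀ s o s' (h : (s, o, s') ∈ L.trans),
      d.trans[(eT ⟨_, h⟩ : ℕ)]? =
        some ((eS s : ℕ), o.map (fun m => (eM m : ℕ)), (eS s' : ℕ)) := by
  let f : L.trans → {t // t ∈ d.trans} := fun t =>
    ⟨((eS t.1.1 : ℕ), t.1.2.1.map (fun m => (eM m : ℕ)), (eS t.1.2.2 : ℕ)),
      (ht _).2 ⟨_, _, _, t.2, rfl⟩⟩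
  have hf : f.Bijective := by
    constructor
    · rintro ⟨⟨s, o, s'⟩, h⟩ ⟨⟨p, b, p'⟩, h'⟩ e
      simp only [f, Subtype.mk.injEq, Prod.mk.injEq] at e
      obtain rfl : s = p := eS.injective (Fin.ext e.1)
      obtain rfl : s' = p' := eS.injective (Fin.ext e.2.2)
      obtain rfl : o = b := ChanOp.map_injective (Fin.val_injective.comp eM.injective) e.2.1
      rfl
    · rintro ⟨t, h⟩
      obtain ⟨s, o, s', hL, rfl⟩ := (ht t).1 h
      exact ⟨⟨_, hL⟩, rfl⟩
  classical
  refine ⟨(Equiv.ofBijective f hf).trans (hd.getEquiv d.trans).symm, fun s o s' h => ?_⟩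
  have : d.trans.get ((hd.getEquiv d.trans).symm (f ⟨_, h⟩)) = (f ⟨_, h⟩).1 := by
    rw [← List.Nodup.getEquiv_apply_coe d.trans hd, Equiv.apply_symm_apply]
  rw [List.getElem?_eq_some_iff]
  exact ⟨Fin.is_lt _, this⟩

theorem mem_edges1 {d : PCSCode} {S M : Type} {L : PCS S M} {SF : Set S}
    (eS : S ≃ Fin d.numStates) (eM : M ≃ Fin d.numMsgs) (eT : L.trans ≃ Fin d.trans.length)
    (hT : ∀ s o s' (h : (s, o, s') ∈ L.trans), d.trans[(eT ⟨_, h⟩ : ℕ)]? =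
      some ((eS s : ℕ), o.map (fun m => (eM m : ℕ)), (eS s' : ℕ)))
    (hF : ∀ s, s ∈ SF ↔ (eS s : ℕ) ∈ d.finals) (z : ℕ × Instr ℕ ℕ × ℕ) :
    z ∈ edges1 d ↔ ∃ q a q', Trans1 L SF q a q' ∧
      z = (q.num d.numStates d.trans.length (fun s => (eS s : ℕ)) fun t => (eT t : ℕ),
        a.map (fun x => (RVar.equivFin x : ℕ)) (fun v => v.num d.numMsgs fun m => (eM m : ℕ)),
        q'.num d.numStates d.trans.length (fun s => (eS s : ℕ)) fun t => (eT t : ℕ)) := by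
  constructor
  · intro h
    rw [edges1, List.mem_append, List.mem_append] at h
    rcases h with (h | h) | h
    · obtain ⟨i, hi, h⟩ := List.mem_flatMap.1 h
      obtain ⟨⟨⟨s, o, s'⟩, ht⟩, rfl⟩ : ∃ t : L.trans, i = (eT t : ℕ) :=
        ⟨eT.symm ⟨i, List.mem_range.1 hi⟩, by simp⟩
      rw [hT s o s' ht] at h
      cases o with
      | send m =>
        simp only [Option.elim_some, ChanOp.map, opEdges, List.mem_cons, List.mem_map,
          List.mem_range] at h
        rcases h with rfl | rfl | ⟨m', hm', rfl⟩
        · exact ⟨_, _, _, .send1 s s' m ht, rfl⟩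
        · exact ⟨_, _, _, .send2 s s' m ht, rfl⟩
        · refine ⟨_, _, _, .sendL s s' m ht (eM.symm ⟨m', hm'⟩), ?_⟩
          simp [State1.num, Instr.map, RVal.num, RVar.equivFin]
      | recv m =>
        simp only [Option.elim_some, ChanOp.map, opEdges, List.mem_cons, List.not_mem_nil,
          or_false] at h
        rcases h with rfl | rfl
        · exact ⟨_, _, _, .recv1 s s' m ht, rfl⟩
        · exact ⟨_, _, _, .recv2 s s' m ht, rfl⟩
      | nop =>
        simp only [Option.elim_some, ChanOp.map, opEdges, List.mem_cons, List.mem_map,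
          List.mem_range] at h
        rcases h with rfl | rfl | ⟨m', hm', rfl⟩
        · exact ⟨_, _, _, .nop1 s s' ht, rfl⟩
        · exact ⟨_, _, _, .nop2 s s' ht, rfl⟩
        · refine ⟨_, _, _, .nopL s s' ht (eM.symm ⟨m', hm'⟩), ?_⟩
          simp [State1.num, Instr.map, RVal.num, RVar.equivFin]
    · simp only [List.mem_map, List.mem_filter, decide_eq_true_eq] at h
      obtain ⟨n, ⟨hn, hlt⟩, rfl⟩ := h
      obtain ⟨s, rfl⟩ : ∃ s, n = (eS s : ℕ) := ⟨eS.symm ⟨n, hlt⟩, by simp⟩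
      exact ⟨_, _, _, .final s ((hF s).2 hn), rfl⟩
    · simp only [List.mem_cons, List.not_mem_nil, or_false] at h
      rcases h with rfl | rfl
      · exact ⟨_, _, _, .loopL, rfl⟩
      · exact ⟨_, _, _, .loopF, rfl⟩
  · rintro ⟨q, a, q', h, rfl⟩
    have hop : ∀ s o s' (h : (s, o, s') ∈ L.trans) (z : ℕ × Instr ℕ ℕ × ℕ),
        z ∈ opEdges d.numMsgs (d.numStates + eT ⟨_, h⟩) (d.numStates + d.trans.length) (eS s)
          (eS s') (o.map fun m => (eM m : ℕ)) → z ∈ edges1 d := by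
      intro s o s' h z hz
      refine List.mem_append_left _ (List.mem_append_left _ (List.mem_flatMap.2
        ⟨eT ⟨_, h⟩, List.mem_range.2 (Fin.is_lt _), ?_⟩))
      rw [hT s o s' h]
      exact hz
    cases h with
    | nop1 s s' h | nop2 s s' h | nopL s s' h m' | send1 s s' m h | send2 s s' m h
    | sendL s s' m h m' | recv1 s s' m h | recv2 s s' m h =>
      exact hop _ _ _ h _ (by
        simp [opEdges, State1.num, RVal.num, Instr.map, RVar.equivFin, ChanOp.map])
    | final s h =>
      refine List.mem_append_left _ (List.mem_append_right _ (List.mem_map.2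
        ⟨eS s, List.mem_filter.2 ⟨(hF s).1 h, ?_⟩, rfl⟩))
      simp
    | loopL => exact List.mem_append_right _ (by simp [State1.num, Instr.map])
    | loopF => exact List.mem_append_right _ (by simp [State1.num, Instr.map])

theorem reductionCode_describes {d : PCSCode} {S M : Type} {L : PCS S M} {s₀ : S} {SF : Set S}
    (h : d.Describes L s₀ SF) :
    (reductionCode d).Describes (reductionProgram L SF) (reductionFinal L SF)
      (reductionInit L SF s₀) .B := by
  obtain ⟨eS, eM, hd, ht, hi, hF⟩ := h
  obtain ⟨eT, hT⟩ := PCSCode.exists_trans_equiv eS eM hd ht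
  obtain ⟨e₁, he₁⟩ := State1.exists_equiv eS eT
  obtain ⟨e₂, he₂⟩ := State2.exists_equiv eM
  obtain ⟨eV, heV⟩ := RVal.exists_equiv eM
  refine GameCode.describes_of_two (P := reductionProgram L SF) (g := reductionCode d) rfl rfl rfl
    e₁ e₂ RVar.equivFin eV ?_ ?_ ?_ ?_ ?_ rfl ?_ rfl
  · intro z
    change _ ↔ ∃ (q : State1 L) (a : Instr RVar (RVal M)) (q' : State1 L), Trans1 L SF q a q' ∧
      z = ((e₁ q : ℕ), a.map (fun x => (RVar.equivFin x : ℕ)) (fun v => (eV v : ℕ)), (e₁ q' : ℕ))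
    simp only [he₁, heV]
    exact mem_edges1 eS eM eT hT hF z
  · intro z
    change _ ↔ ∃ (q : State2 M) (a : Instr RVar (RVal M)) (q' : State2 M), Trans2 M q a q' ∧
      z = ((e₂ q : ℕ), a.map (fun x => (RVar.equivFin x : ℕ)) (fun v => (eV v : ℕ)), (e₂ q' : ℕ))
    simp only [he₂, heV]
    exact mem_edges2 eM z
  · intro q
    exact ⟨False.elim, fun h => by simp [reductionCode] at h⟩
  · intro q
    change q = State2.qF ↔ _
    have : (e₂ State2.qF : ℕ) = d.numMsgs + 19 := he₂ _
    rw [reductionCode, List.mem_singleton, ← this, Prod.mk.injEq]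
    exact ⟨fun h => ⟨rfl, congrArg (fun q => (e₂ q : ℕ)) h⟩, fun h => e₂.injective (Fin.ext h.2)⟩
  · change [d.init, d.numMsgs] = [(e₁ (.chan s₀) : ℕ), (e₂ .q1 : ℕ)]
    rw [he₁, he₂, hi]
    rfl
  · rintro (_ | _ | _)
    exacts [(congrArg some (heV .bot)).symm, (congrArg some (heV .bot)).symm,
      (congrArg some (heV .zero)).symm]

theorem primrec_opEdges : Primrec fun p : (ℕ × ℕ × ℕ) × (ℕ × ChanOp ℕ × ℕ) =>
    opEdges p.1.1 p.1.2.1 p.1.2.2 p.2.1 p.2.2.2 p.2.2.1 := by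
  have hk : Primrec fun p : (ℕ × ℕ × ℕ) × (ℕ × ChanOp ℕ × ℕ) => p.1.1 := .comp .fst .fst
  have hh : Primrec fun p : (ℕ × ℕ × ℕ) × (ℕ × ChanOp ℕ × ℕ) => p.1.2.1 :=
    .comp .fst (.comp .snd .fst)
  have hl : Primrec fun p : (ℕ × ℕ × ℕ) × (ℕ × ChanOp ℕ × ℕ) => p.1.2.2 :=
    .comp .snd (.comp .snd .fst)
  have hs : Primrec fun p : (ℕ × ℕ × ℕ) × (ℕ × ChanOp ℕ × ℕ) => p.2.1 := .comp .fst .snd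
  have hs' : Primrec fun p : (ℕ × ℕ × ℕ) × (ℕ × ChanOp ℕ × ℕ) => p.2.2.2 :=
    .comp .snd (.comp .snd .snd)
  have ho : Primrec fun p : (ℕ × ℕ × ℕ) × (ℕ × ChanOp ℕ × ℕ) =>
      ChanOp.equivSum ℕ p.2.2.1 :=
    (Primrec.of_equiv (e := ChanOp.equivSum ℕ)).comp (.comp .fst (.comp .snd .snd))
  have hrest : Primrec fun p : (ℕ × ℕ × ℕ) × (ℕ × ChanOp ℕ × ℕ) =>
      (List.range p.1.1).map fun m' => (p.1.2.1, (Instr.rd 1 m' : Instr ℕ ℕ), p.1.2.2) :=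
    Primrec.list_map (Primrec.list_range.comp hk)
      ((hh.comp .fst).pair ((primrec_rd.comp (.const 1) .snd).pair (hl.comp .fst))).to₂
  have hadd : ∀ j, Primrec fun p : (ℕ × ℕ × ℕ) × (ℕ × ChanOp ℕ × ℕ) => p.1.1 + j :=
    fun j => Primrec.nat_add.comp hk (.const j)
  have hsend : Primrec₂ fun (p : (ℕ × ℕ × ℕ) × (ℕ × ChanOp ℕ × ℕ)) (m : ℕ) =>
      opEdges p.1.1 p.1.2.1 p.1.2.2 p.2.1 p.2.2.2 (.send m) :=
    Primrec.list_cons.comp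
      ((hs.comp .fst).pair ((primrec_wr.comp (.const 0) .snd).pair (hh.comp .fst))) <|
    Primrec.list_cons.comp
      ((hh.comp .fst).pair ((primrec_wr.comp (.const 2) ((hadd 1).comp .fst)).pair
        (hs'.comp .fst))) (hrest.comp .fst)
  have hrecv : Primrec₂ fun (p : (ℕ × ℕ × ℕ) × (ℕ × ChanOp ℕ × ℕ)) (m : ℕ) =>
      opEdges p.1.1 p.1.2.1 p.1.2.2 p.2.1 p.2.2.2 (.recv m) :=
    Primrec.list_cons.comp
      ((hs.comp .fst).pair ((primrec_rd.comp (.const 1) .snd).pair (hh.comp .fst))) <|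
    primrec_singleton
      ((hh.comp .fst).pair ((primrec_rd.comp (.const 1) ((hadd 2).comp .fst)).pair
        (hs'.comp .fst)))
  have hnop : Primrec fun p : (ℕ × ℕ × ℕ) × (ℕ × ChanOp ℕ × ℕ) =>
      opEdges p.1.1 p.1.2.1 p.1.2.2 p.2.1 p.2.2.2 .nop :=
    Primrec.list_cons.comp (hs.pair ((Primrec.const Instr.nop).pair hh)) <|
    Primrec.list_cons.comp (hh.pair ((Primrec.const Instr.nop).pair hs')) hrest
  refine (Primrec.sumCasesOn ho hsend (Primrec.sumCasesOn (Primrec.snd (α := (ℕ × ℕ × ℕ) ×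
    (ℕ × ChanOp ℕ × ℕ)) (β := ℕ ⊕ Unit)) (hrecv.comp (Primrec.fst.comp .fst) .snd).to₂
    (hnop.comp (Primrec.fst.comp .fst)).to₂).to₂).of_eq ?_
  rintro ⟨⟨k, h, l⟩, s, o, s'⟩
  cases o <;> rfl

theorem primrec_numStates : Primrec PCSCode.numStates :=
  Primrec.fst.comp (Primrec.of_equiv (e := PCSCode.equivProd))

theorem primrec_numMsgs : Primrec PCSCode.numMsgs :=
  Primrec.fst.comp (Primrec.snd.comp (Primrec.of_equiv (e := PCSCode.equivProd)))

theorem primrec_trans : Primrec PCSCode.trans :=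
  Primrec.fst.comp (Primrec.snd.comp (Primrec.snd.comp
    (Primrec.of_equiv (e := PCSCode.equivProd))))

theorem primrec_finals : Primrec PCSCode.finals :=
  Primrec.snd.comp (Primrec.snd.comp (Primrec.snd.comp (Primrec.snd.comp
    (Primrec.of_equiv (e := PCSCode.equivProd)))))

theorem primrec_edges1 : Primrec edges1 := by
  have hn := primrec_numStates
  have hk := primrec_numMsgs
  have ht := primrec_trans
  have hlen : Primrec fun d : PCSCode => d.trans.length := Primrec.list_length.comp ht
  have hl : Primrec fun d : PCSCode => d.numStates + d.trans.length := Primrec.nat_add.comp hn hlen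
  have hl' : Primrec fun d : PCSCode => d.numStates + d.trans.length + 1 := Primrec.succ.comp hl
  have h1 : Primrec fun d : PCSCode => (List.range d.trans.length).flatMap fun i =>
      (d.trans[i]?).elim [] fun t =>
        opEdges d.numMsgs (d.numStates + i) (d.numStates + d.trans.length) t.1 t.2.2 t.2.1 := by
    refine Primrec.list_flatMap (Primrec.list_range.comp hlen) ?_
    have hargs : Primrec fun p : (PCSCode × ℕ) × (ℕ × ChanOp ℕ × ℕ) =>
        ((p.1.1.numMsgs, p.1.1.numStates + p.1.2, p.1.1.numStates + p.1.1.trans.length), p.2) := by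
      have h0 : Primrec fun p : (PCSCode × ℕ) × (ℕ × ChanOp ℕ × ℕ) => p.1.1 :=
        Primrec.fst.comp Primrec.fst
      have h1 : Primrec fun p : (PCSCode × ℕ) × (ℕ × ChanOp ℕ × ℕ) => p.1.2 :=
        Primrec.snd.comp Primrec.fst
      exact ((hk.comp h0).pair ((Primrec.nat_add.comp (hn.comp h0) h1).pair (hl.comp h0))).pair .snd
    have ho : Primrec₂ fun (p : PCSCode × ℕ) (t : ℕ × ChanOp ℕ × ℕ) =>
        opEdges p.1.numMsgs (p.1.numStates + p.2) (p.1.numStates + p.1.trans.length) t.1 t.2.2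
          t.2.1 := by
      have := primrec_opEdges.comp hargs
      exact this
    refine (Primrec.option_casesOn (Primrec.list_getElem?.comp (ht.comp .fst) .snd) (.const []) ho
      ).of_eq ?_
    rintro ⟨d, i⟩
    simp only
    cases d.trans[i]? <;> rfl
  have h2 : Primrec fun d : PCSCode => (d.finals.filter fun s => s < d.numStates).map fun s =>
      (s, (Instr.wr 0 (d.numMsgs + 3) : Instr ℕ ℕ), d.numStates + d.trans.length + 1) := by
    have : Primrec fun d : PCSCode => d.finals.flatMap fun s => if s < d.numStates then
        [(s, (Instr.wr 0 (d.numMsgs + 3) : Instr ℕ ℕ), d.numStates + d.trans.length + 1)] else [] :=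
      Primrec.list_flatMap primrec_finals (Primrec.ite (Primrec.nat_lt.comp .snd (hn.comp .fst))
        (primrec_singleton (Primrec.snd.pair ((primrec_wr.comp (.const 0)
          (Primrec.nat_add.comp (hk.comp .fst) (.const 3))).pair (hl'.comp .fst)))) (.const []))
    refine this.of_eq fun d => ?_
    induction d.finals with
    | nil => rfl
    | cons s l ih =>
      rw [List.flatMap_cons, ih, List.filter_cons]
      by_cases h : s < d.numStates <;> simp [h]
  exact Primrec.list_append.comp (Primrec.list_append.comp h1 h2) <|
    Primrec.list_cons.comp (hl.pair ((Primrec.const Instr.nop).pair hl)) <|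
    primrec_singleton (hl'.pair ((Primrec.const Instr.nop).pair hl'))

theorem primrec_reductionCode : Primrec reductionCode := by
  have hn := primrec_numStates
  have hk := primrec_numMsgs
  have hi : Primrec PCSCode.init := Primrec.fst.comp (Primrec.snd.comp (Primrec.snd.comp
    (Primrec.snd.comp (Primrec.of_equiv (e := PCSCode.equivProd)))))
  have hadd : ∀ j, Primrec fun d : PCSCode => d.numMsgs + j :=
    fun j => Primrec.nat_add.comp hk (.const j)
  have hl : Primrec fun d : PCSCode => d.numStates + d.trans.length + 2 :=
    Primrec.nat_add.comp (Primrec.nat_add.comp hn (Primrec.list_length.comp primrec_trans)) (.const 2)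
  refine (Primrec.of_equiv_iff GameCode.equivProd).1 ?_
  exact (Primrec.const 3).pair <| (hadd 4).pair <|
    (Primrec.list_cons.comp (hl.pair primrec_edges1)
      (primrec_singleton ((hadd 20).pair (primrec_edges2.comp hk)))).pair <|
    (primrec_singleton ((Primrec.const 1).pair (hadd 19))).pair <|
    (Primrec.list_cons.comp hi (primrec_singleton hk)).pair <|
    (Primrec.const [[], []]).pair <|
    (Primrec.list_cons.comp (hadd 2) (Primrec.list_cons.comp (hadd 2) (primrec_singleton hk))).pair
      (.const Player.B)

end Coding

/-! ### Undecidability of the safety problem -/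

section Safety

open Relation

/-- Every program with two processes has a description in which only the buffers depend on the buffers
of the described configuration. -/
theorem exists_gameCode_describes {X V : Type} (P : Program Proc2 X V) (F : ∀ i, Set (P.State i))
    (st : ∀ i, P.State i) (mem : X → V) (p : Player) {nX nV : ℕ} (eX : X ≃ Fin nX)
    (eV : V ≃ Fin nV) :
    ∃ g : GameCode, ∀ buf : Proc2 → List (X × V),
      ({ g with bufs := [(buf .one).map fun m => ((eX m.1 : ℕ), (eV m.2 : ℕ)),
        (buf .two).map fun m => ((eX m.1 : ℕ), (eV m.2 : ℕ))] } : GameCode).Describes P F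
          ⟨st, buf, mem⟩ p := by
  have hX := P.finite_var
  have hV := P.finite_val
  have h₁ := P.finite_state .one
  have h₂ := P.finite_state .two
  have hI : Finite (Instr X V) := Finite.of_equiv _ (Instr.equivSum X V).symm
  let e₁ := Finite.equivFin (P.State .one)
  let e₂ := Finite.equivFin (P.State .two)
  have edges : ∀ (Q : Type) [Finite Q] (n : ℕ) (e : Q ≃ Fin n) (r : Q → Instr X V → Q → Prop),
      ∃ l : List (ℕ × Instr ℕ ℕ × ℕ), ∀ z, z ∈ l ↔ ∃ q a q', r q a q' ∧
        z = ((e q : ℕ), a.map (fun x => (eX x : ℕ)) (fun v => (eV v : ℕ)), (e q' : ℕ)) := by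
    intro Q _ n e r
    have hfin : {z | ∃ q a q', r q a q' ∧ z = ((e q : ℕ),
        a.map (fun x => (eX x : ℕ)) (fun v => (eV v : ℕ)), (e q' : ℕ))}.Finite := by
      refine (Set.finite_range fun t : Q × Instr X V × Q => ((e t.1 : ℕ),
        t.2.1.map (fun x => (eX x : ℕ)) (fun v => (eV v : ℕ)), (e t.2.2 : ℕ))).subset ?_
      rintro _ ⟨q, a, q', -, rfl⟩
      exact ⟨(q, a, q'), rfl⟩
    exact ⟨hfin.toFinset.toList, fun z => by simp⟩
  obtain ⟨l₁, hl₁⟩ := edges _ _ e₁ (P.trans .one)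
  obtain ⟨l₂, hl₂⟩ := edges _ _ e₂ (P.trans .two)
  have hF : ({z | ∃ q ∈ F .one, z = (0, (e₁ q : ℕ))} ∪
      {z | ∃ q ∈ F .two, z = (1, (e₂ q : ℕ))} : Set (ℕ × ℕ)).Finite := by
    refine Set.Finite.union
      ((Set.finite_range fun q => ((0 : ℕ), (e₁ q : ℕ))).subset ?_)
      ((Set.finite_range fun q => ((1 : ℕ), (e₂ q : ℕ))).subset ?_)
    · rintro _ ⟨q, -, rfl⟩
      exact ⟨q, rfl⟩
    · rintro _ ⟨q, -, rfl⟩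
      exact ⟨q, rfl⟩
  refine ⟨⟨nX, nV, [(Nat.card (P.State .one), l₁), (Nat.card (P.State .two), l₂)], hF.toFinset.toList,
    [(e₁ (st .one) : ℕ), (e₂ (st .two) : ℕ)], [],
    (List.finRange nX).map fun i => (eV (mem (eX.symm i)) : ℕ), p⟩, fun buf => ?_⟩
  refine GameCode.describes_of_two rfl rfl rfl e₁ e₂ eX eV hl₁ hl₂ ?_ ?_ rfl rfl ?_ rfl
  · intro q
    simp [Fin.val_inj]
  · intro q
    simp [Fin.val_inj]
  · intro x
    simp

theorem primrec_bits : Primrec Nat.bits := by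
  have hg : Primrec₂ fun (_ : Unit) (l : List (List Bool)) => if l.length = 0 then some [] else
      (l[l.length.div2]?).map fun w => l.length.bodd :: w := by
    have hl : Primrec fun p : Unit × List (List Bool) => p.2.length :=
      Primrec.list_length.comp .snd
    exact Primrec.ite (Primrec.eq.comp hl (.const 0)) (.const _)
      (Primrec.option_map (Primrec.list_getElem?.comp .snd (Primrec.nat_div2.comp hl))
        (Primrec.list_cons.comp (Primrec.nat_bodd.comp (hl.comp .fst)) .snd))
  refine (Primrec.nat_strong_rec (fun _ : Unit => Nat.bits) hg ?_).comp (.const ()) .id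
  rintro - n
  rcases Nat.eq_zero_or_pos n with rfl | hn
  · simp
  have hlt : n.div2 < n := by rw [Nat.div2_val]; omega
  have hne : n.bits ≠ [] := by
    rw [← List.length_pos_iff, Nat.size_eq_bits_len]
    exact Nat.size_pos.2 hn
  simp only [List.length_map, List.length_range, hn.ne', if_false, List.getElem?_map,
    List.getElem?_range hlt, Option.map_some, Option.some.injEq]
  rw [Nat.bodd_eq_bits_head, Nat.div2_bits_eq_tail]
  cases h : n.bits with
  | nil => exact absurd h hne
  | cons b l => rfl

variable {S M : Type} {L : PCS S M} {SF : Set S}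

/-- If the second process of the simulating program can resign, then player A wins exactly if no
final state of the channel system is reachable. -/
theorem winningA_resign_iff {s₀ : S} {w₀ : List M} {t : Timing} (ht : t ≠ .never) :
    (tsoGame (resignProgram (reductionProgram L SF) .two)
      (resignFinal (reductionProgram L SF) .two (reductionFinal L SF)) (onlyB t)).WinningA
        (resignConf _ .two (startConf L SF s₀ w₀), .B) ↔
      ¬ ∃ s ∈ SF, ∃ w, ReflTransGen L.Step (s₀, w₀) (s, w) := by
  constructor
  · rintro hA ⟨s, hs, w, h⟩
    obtain ⟨n, hn⟩ := BWins.of_reachable ht h hs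
    exact (Game.Attr.resign hn).winningB.not_winningA hA
  · intro hne
    push Not at hne
    refine (Game.Trap.resign (trap_safeSet (R := L.ReachSet (s₀, w₀)) (fun c c' h h' => h.tail h')
      hne t) ?_).winningA (.inl ⟨_, rfl, startConf_mem_safeSet s₀ w₀ t⟩)
    rintro (_ | _) h
    exacts [rfl, absurd rfl h]

/-- A decision procedure for safety would decide reachability in a fixed channel system: the number
that the channel initially contains can be written into the buffer of the first process. -/
theorem not_safetyDecidable {t : Timing} (ht : t ≠ .never) : ¬ SafetyDecidable (onlyB t) := by
  rintro ⟨f, hf, hdec⟩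
  obtain ⟨S, M, L, s₀, SF, a, b, g, hund⟩ := exists_pcs_undecidable
  have := (reductionProgram L SF).finite_val
  let eV := Finite.equivFin (RVal M)
  let c₀ := startConf L SF s₀ []
  obtain ⟨code, hcode⟩ := exists_gameCode_describes (resignProgram (reductionProgram L SF) .two)
    (resignFinal (reductionProgram L SF) .two (reductionFinal L SF))
    (resignConf _ .two c₀).state c₀.mem .B RVar.equivFin eV
  let num (w : List M) : List (ℕ × ℕ) :=
    (enc w).map fun m => ((RVar.equivFin m.1 : ℕ), (eV m.2 : ℕ))
  let h (n : ℕ) : GameCode := { code with bufs := [num (a ++ n.bits.map g ++ b), []] }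
  have hnum : ∀ n : ℕ, num (a ++ n.bits.map g ++ b) =
      num a ++ n.bits.flatMap (fun d => num [g d]) ++ num b := by
    intro n
    simp only [num, enc_append, List.map_append]
    congr 2
    induction n.bits with
    | nil => rfl
    | cons d l ih =>
      rw [List.flatMap_cons, ← ih]
      rfl
  have hh : Primrec h := by
    have h1 : Primrec fun n : ℕ => num (a ++ n.bits.map g ++ b) :=
      (Primrec.list_append.comp (Primrec.list_append.comp (.const (num a))
        (Primrec.list_flatMap primrec_bits ((Primrec.dom_bool fun d => num [g d]).comp .snd).to₂))
        (.const (num b))).of_eq fun n => (hnum n).symm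
    refine (Primrec.of_equiv_iff GameCode.equivProd).1 ?_
    exact (Primrec.const code.numVars).pair <| (Primrec.const code.numVals).pair <|
      (Primrec.const code.procs).pair <| (Primrec.const code.finals).pair <|
      (Primrec.const code.states).pair <|
      (Primrec.list_cons.comp h1 (.const [[]])).pair <|
      (Primrec.const code.mem).pair (.const code.player)
  refine hund ⟨fun n => !f (h n), (Primrec.not.to_comp).comp (hf.comp hh.to_comp), fun n => ?_⟩
  have hd := hdec (h n) _ _ _ _ _ _ _ (hcode (startConf L SF s₀ (a ++ n.bits.map g ++ b)).buf)
    deadlockFree_resign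
  have hw := winningA_resign_iff (L := L) (SF := SF) (s₀ := s₀) (w₀ := a ++ n.bits.map g ++ b) ht
  have hdw : f (h n) = true ↔ ¬ ∃ s ∈ SF, ∃ w,
      ReflTransGen L.Step (s₀, a ++ n.bits.map g ++ b) (s, w) := Iff.trans hd hw
  rw [Bool.not_eq_true', ← Bool.not_eq_true, hdw, not_not]

end Safety

end TSO

theorem mainTheorem5 :
    -- undecidability, for updates before and after, only before, only after the own move
    (∀ t : TSO.Timing, t ≠ TSO.Timing.never → ¬ TSO.SafetyDecidable (TSO.onlyB t)) ∧
    -- correctness of the two-process reduction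
    (∀ (S M : Type) (L : TSO.PCS S M) (s₀ : S) (SF : Set S) (t : TSO.Timing),
      t ≠ TSO.Timing.never →
        (TSO.reductionGame L SF t).DeadlockFreeFrom (TSO.reductionInit L SF s₀, TSO.Player.B) ∧
        (L.Reaches s₀ SF ↔
          (TSO.reductionGame L SF t).WinningB (TSO.reductionInit L SF s₀, TSO.Player.B))) ∧
    -- the reduction is computable
    (∃ r : TSO.PCSCode → TSO.GameCode, Computable r ∧
      ∀ (d : TSO.PCSCode) (S M : Type) (L : TSO.PCS S M) (s₀ : S) (SF : Set S),
        d.Describes L s₀ SF →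
          (r d).Describes (TSO.reductionProgram L SF) (TSO.reductionFinal L SF)
            (TSO.reductionInit L SF s₀) TSO.Player.B) := by
  refine ⟨fun t ht => TSO.not_safetyDecidable ht, fun S M L s₀ SF t ht => ?_,
    TSO.reductionCode, TSO.primrec_reductionCode.to_comp, fun d S M L s₀ SF h =>
      TSO.reductionCode_describes h⟩
  rw [TSO.reductionInit_eq]
  exact ⟨TSO.deadlockFreeFrom_startConf s₀ [] t .B, TSO.reaches_iff_winningB ht⟩
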